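/- **Set systems.** A set system over $[n]=\{1,\dots,n\}$ is a family $\mathcal F\subseteq 2^{[n]}$. Let $C(\mathcal F)$ be the number of chains $S_0\subsetneq S_1\subsetneq\dots\subsetneq S_n$ with all $S_i\in\mathcal F$. For $n\ge 1$ put $$S(\mathcal F)=|\mathcal F|^{1/n},\qquad P(\mathcal F)=\left(\frac{n!}{C(\mathcal F)}\right)^{1/n},$$ with $P(\mathcal F)=+\infty$ if $C(\mathcal F)=0$. For real $S$ let $$P_S=\inf\{P(\mathcal F)\mid n\ge 1,\ \mathcal F\text{ a set system over }[n],\ S(\mathcal F)\le S\}.$$ **TSP.** An instance with $n\ge1$ cities is an arbitrary function $d:[n]^2\to\mathbb R$. Its optimum is the minimum over all permutations $\pi$ of $[n]$ of $d(\pi(n),\pi(1))+\sum_{i=1}^{n-1}d(\pi(i),\pi(i+1))$. **Machine model.** Algorithms are programs (assignment, sequencing, if, while) of a deterministic random access machine with logarithmic cost and finitely many arrays. Integer cells hold natural numbers, with operations $+$, truncated $-$, $\cdot$, integer division and remainder, and comparison; a number is charged its binary length. Weight cells hold sums of input distances as exact real numbers, which can only be added and compared; such a sum is charged its number of summands. The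 input $d$ is read-only and $n$ is given in an integer cell. The machine has the real number $S$ as a constant, usable only in tests $a\le S\cdot b$ for integers $a,b$. The time is the total cost of all steps; the space is the maximum, over all memory contents that occur, of the total length of the addresses and contents of the nonzero cells. **Theorem.** For every real $1<S\le 2$ there are a single program of the machine with constant $S$, and functions $f,g:\mathbb N\to\mathbb R$ with $f(n)=o(n)$ and $g(n)=o(n)$, such that for all $n\ge1$ the program halts on every TSP instance with $n$ cities and outputs its optimum, simultaneously in time at most $(S\cdot P_S)^{n+f(n)}$ and space at most $S^{n+g(n)}$. -/

import Mathlib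

open scoped ENNReal Nat Asymptotics

namespace TSP

/-! ## Set systems and their maximal chains -/

/-- A set system over a ground set of `n` elements. -/
abbrev SetSystem (n : ℕ) := Finset (Finset (Fin n))

/-- The number of maximal chains `c 0 ⊂ c 1 ⊂ ⋯ ⊂ c n` of `F`; only chains with `n + 1` members,
which are maximal in the full power set, are counted. -/
noncomputable def numMaximalChains {n : ℕ} (F : SetSystem n) : ℕ :=
  Nat.card {c : Fin (n + 1) → Finset (Fin n) // (∀ i, c i ∈ F) ∧ StrictMono c}

/-- The normalized size `|F| ^ (1 / n)`. -/
noncomputable def normSize {n : ℕ} (F : SetSystem n) : ℝ :=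
  (F.card : ℝ) ^ (1 / (n : ℝ))

/-- The normalized inverse chain density `(n! / C(F)) ^ (1 / n)`. For `n > 0` it is `∞` exactly if
`F` has no maximal chain. -/
noncomputable def invChainDensity {n : ℕ} (F : SetSystem n) : ℝ≥0∞ :=
  ((n ! : ℝ≥0∞) / (numMaximalChains F : ℝ≥0∞)) ^ (1 / (n : ℝ))

/-- The infimum of the normalized inverse chain density over all set systems, on nonempty finite
ground sets, whose normalized size is at most `S`. -/
noncomputable def extremalDensity (S : ℝ) : ℝ≥0∞ :=
  ⨅ (n : ℕ) (_ : 0 < n) (F : SetSystem n) (_ : normSize F ≤ S), invChainDensity F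

/-! ## The traveling salesman problem -/

/-- The length of the closed tour `π 0, π 1, …, π (n - 1), π 0`
(`finRotate n` is the cyclic successor on `Fin n`). -/
def tourLength {n : ℕ} (d : Fin n → Fin n → ℝ) (π : Equiv.Perm (Fin n)) : ℝ :=
  ∑ i, d (π i) (π (finRotate n i))

/-! ## The machine model

A random access machine with logarithmic cost and structured control flow. The memory consists of
integer arrays and weight arrays, each named by a natural number that is a literal of the program,
so that a program uses finitely many of them, and each with cells indexed by all of `ℕ`.

* An integer cell holds a natural number and is charged its binary length.
* A weight cell holds a sum of distances of the instance. It is represented by the real value of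
  the sum together with the number of its summands, and is charged that number. Weights can only be
  added and compared.

Distances are thus arbitrary real numbers, but a program can not hide an unbounded amount of
information in one cell. -/

/-- A memory content: `ints (k, i)` is cell `i` of integer array `k`; `weights (k, i)` is cell `i`
of weight array `k`, a pair of a real value and a number of summands. -/
structure State where
  ints : ℕ × ℕ →₀ ℕ
  weights : ℕ × ℕ →₀ ℝ × ℕ

/-- The space occupied by a memory content: every nonzero cell is charged for its address and
its content. -/
noncomputable def State.space (s : State) : ℕ :=
  (s.ints.sum fun a v => 1 + a.2.size + v.size) +
    s.weights.sum fun a w => 1 + a.2.size + w.2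

/-- The binary arithmetic operations; subtraction is truncated at `0`, and `x / 0 = 0`,
`x % 0 = x`. -/
inductive Op
  | add
  | sub
  | mul
  | div
  | mod

def Op.apply : Op → ℕ → ℕ → ℕ
  | .add, x, y => x + y
  | .sub, x, y => x - y
  | .mul, x, y => x * y
  | .div, x, y => x / y
  | .mod, x, y => x % y

/-- Integer expressions: literals, array access, arithmetic. -/
inductive IntExpr
  | lit (c : ℕ)
  | get (k : ℕ) (i : IntExpr)
  | op (o : Op) (a b : IntExpr)

noncomputable def IntExpr.eval (s : State) : IntExpr → ℕ
  | .lit c => c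
  | .get k i => s.ints (k, i.eval s)
  | .op o a b => o.apply (a.eval s) (b.eval s)

/-- The logarithmic cost of evaluating an integer expression. -/
noncomputable def IntExpr.cost (s : State) : IntExpr → ℕ
  | .lit c => 1 + c.size
  | .get k i => i.cost s + 1 + (i.eval s).size + (s.ints (k, i.eval s)).size
  | .op _ a b => a.cost s + b.cost s + 1 + (a.eval s).size + (b.eval s).size

/-- Weight expressions: the empty sum, the distance between two cities (given by their numbers
`0, …, n - 1`), array access, addition. -/
inductive WeightExpr
  | zero
  | dist (x y : IntExpr)
  | get (k : ℕ) (i : IntExpr)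
  | add (a b : WeightExpr)

/-- The value and the number of summands. An invalid pair of cities yields the empty sum. -/
noncomputable def WeightExpr.eval {n : ℕ} (d : Fin n → Fin n → ℝ) (s : State) :
    WeightExpr → ℝ × ℕ
  | .zero => 0
  | .dist x y =>
      if h : x.eval s < n ∧ y.eval s < n then (d ⟨x.eval s, h.1⟩ ⟨y.eval s, h.2⟩, 1) else 0
  | .get k i => s.weights (k, i.eval s)
  | .add a b => a.eval d s + b.eval d s

/-- The cost of evaluating a weight expression: that of its addresses plus the numbers of summands
that are handled. -/
noncomputable def WeightExpr.cost {n : ℕ} (d : Fin n → Fin n → ℝ) (s : State) : WeightExpr → ℕ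
  | .zero => 1
  | .dist x y => x.cost s + y.cost s + 2 + (x.eval s).size + (y.eval s).size
  | .get k i => i.cost s + 1 + (i.eval s).size + (s.weights (k, i.eval s)).2
  | .add a b => a.cost d s + b.cost d s + 1 + (a.eval d s).2 + (b.eval d s).2

/-- Tests: comparison of integers, comparison of weights, comparison of the integer `a` with
`S` times the integer `b`, where `S` is the fixed real constant of the machine, and Boolean
combinations. -/
inductive Test
  | eq (a b : IntExpr)
  | le (a b : IntExpr)
  | leWeight (a b : WeightExpr)
  | leConst (a b : IntExpr)
  | not (p : Test)
  | and (p q : Test)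

def Test.Holds (S : ℝ) {n : ℕ} (d : Fin n → Fin n → ℝ) (s : State) : Test → Prop
  | .eq a b => a.eval s = b.eval s
  | .le a b => a.eval s ≤ b.eval s
  | .leWeight a b => (a.eval d s).1 ≤ (b.eval d s).1
  | .leConst a b => (a.eval s : ℝ) ≤ S * (b.eval s : ℝ)
  | .not p => ¬ p.Holds S d s
  | .and p q => p.Holds S d s ∧ q.Holds S d s

noncomputable def Test.cost {n : ℕ} (d : Fin n → Fin n → ℝ) (s : State) : Test → ℕ
  | .eq a b => a.cost s + b.cost s + 1 + (a.eval s).size + (b.eval s).size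
  | .le a b => a.cost s + b.cost s + 1 + (a.eval s).size + (b.eval s).size
  | .leWeight a b => a.cost d s + b.cost d s + 1 + (a.eval d s).2 + (b.eval d s).2
  | .leConst a b => a.cost s + b.cost s + 1 + (a.eval s).size + (b.eval s).size
  | .not p => p.cost d s + 1
  | .and p q => p.cost d s + q.cost d s + 1

/-- Programs. `setInt k i e` writes `e` to cell `i` of integer array `k`, and `setWeight k i e`
writes `e` to cell `i` of weight array `k`. -/
inductive Program
  | skip
  | setInt (k : ℕ) (i e : IntExpr)
  | setWeight (k : ℕ) (i : IntExpr) (e : WeightExpr)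
  | seq (p q : Program)
  | ite (b : Test) (p q : Program)
  | while (b : Test) (p : Program)

noncomputable def State.setInt (s : State) (k i v : ℕ) : State :=
  { s with ints := s.ints.update (k, i) v }

noncomputable def State.setWeight (s : State) (k i : ℕ) (w : ℝ × ℕ) : State :=
  { s with weights := s.weights.update (k, i) w }

/-- `Exec S d p s s' t m`: on a machine with real constant `S` and instance `d`, the program `p`
started in `s` halts in `s'` after time `t`, and `m` is the maximum space of the memory contents
that occur on the way. -/
inductive Exec (S : ℝ) {n : ℕ} (d : Fin n → Fin n → ℝ) :
    Program → State → State → ℕ → ℕ → Prop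
  | skip (s : State) : Exec S d .skip s s 1 s.space
  | setInt (s : State) (k : ℕ) (i e : IntExpr) :
      Exec S d (.setInt k i e) s (s.setInt k (i.eval s) (e.eval s))
        (i.cost s + e.cost s + 1 + (i.eval s).size + (e.eval s).size)
        (max s.space (s.setInt k (i.eval s) (e.eval s)).space)
  | setWeight (s : State) (k : ℕ) (i : IntExpr) (e : WeightExpr) :
      Exec S d (.setWeight k i e) s (s.setWeight k (i.eval s) (e.eval d s))
        (i.cost s + e.cost d s + 1 + (i.eval s).size + (e.eval d s).2)
        (max s.space (s.setWeight k (i.eval s) (e.eval d s)).space)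
  | seq {p q : Program} {s s' s'' : State} {t t' m m' : ℕ} :
      Exec S d p s s' t m → Exec S d q s' s'' t' m' →
        Exec S d (.seq p q) s s'' (t + t') (max m m')
  | iteTrue {b : Test} {p q : Program} {s s' : State} {t m : ℕ} :
      b.Holds S d s → Exec S d p s s' t m →
        Exec S d (.ite b p q) s s' (b.cost d s + 1 + t) m
  | iteFalse {b : Test} {p q : Program} {s s' : State} {t m : ℕ} :
      ¬ b.Holds S d s → Exec S d q s s' t m →
        Exec S d (.ite b p q) s s' (b.cost d s + 1 + t) m
  | whileTrue {b : Test} {p : Program} {s s' s'' : State} {t t' m m' : ℕ} :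
      b.Holds S d s → Exec S d p s s' t m → Exec S d (.while b p) s' s'' t' m' →
        Exec S d (.while b p) s s'' (b.cost d s + 1 + t + t') (max m m')
  | whileFalse {b : Test} {p : Program} {s : State} :
      ¬ b.Holds S d s → Exec S d (.while b p) s s (b.cost d s + 1) s.space

/-- The machine is deterministic: program and start determine the final memory content, the time
and the space. -/
theorem Exec.unique {S : ℝ} {n : ℕ} {d : Fin n → Fin n → ℝ} {p : Program}
    {s s₁ s₂ : State} {t₁ t₂ m₁ m₂ : ℕ}
    (h₁ : Exec S d p s s₁ t₁ m₁) (h₂ : Exec S d p s s₂ t₂ m₂) :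
    s₁ = s₂ ∧ t₁ = t₂ ∧ m₁ = m₂ := by
  induction h₁ generalizing s₂ t₂ m₂ with
  | skip => cases h₂; simp
  | setInt => cases h₂; simp
  | setWeight => cases h₂; simp
  | seq _ _ ih ih' =>
    cases h₂ with
    | seq a b =>
      obtain ⟨rfl, rfl, rfl⟩ := ih a
      obtain ⟨rfl, rfl, rfl⟩ := ih' b
      simp
  | iteTrue h _ ih =>
    cases h₂ with
    | iteTrue _ a => obtain ⟨rfl, rfl, rfl⟩ := ih a; simp
    | iteFalse h' => exact absurd h h'
  | iteFalse h _ ih =>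
    cases h₂ with
    | iteFalse _ a => obtain ⟨rfl, rfl, rfl⟩ := ih a; simp
    | iteTrue h' => exact absurd h' h
  | whileTrue h _ _ ih ih' =>
    cases h₂ with
    | whileTrue _ a b =>
      obtain ⟨rfl, rfl, rfl⟩ := ih a
      obtain ⟨rfl, rfl, rfl⟩ := ih' b
      simp
    | whileFalse h' => exact absurd h h'
  | whileFalse h =>
    cases h₂ with
    | whileFalse => simp
    | whileTrue h' => exact absurd h' h

/-- The initial memory content for `n` cities: cell `0` of integer array `0` holds `n`, all other
cells are zero. -/
noncomputable def State.initial (n : ℕ) : State where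
  ints := Finsupp.single (0, 0) n
  weights := 0

/-- The output: the real value of cell `0` of weight array `0`. -/
noncomputable def State.output (s : State) : ℝ := (s.weights (0, 0)).1

/-- The program `p`, with real constant `S`, halts on every instance with `n` cities and real
distances, outputs the minimum length of a tour, and runs in time at most `time n` and space at
most `space n`. -/
def SolvesTSP (S : ℝ) (p : Program) (time space : ℕ → ℝ≥0∞) : Prop :=
  ∀ (n : ℕ), 0 < n → ∀ d : Fin n → Fin n → ℝ, ∃ (s : State) (t m : ℕ),
    Exec S d p (State.initial n) s t m ∧
      IsLeast (Set.range (tourLength d)) s.output ∧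
      (t : ℝ≥0∞) ≤ time n ∧ (m : ℝ≥0∞) ≤ space n

end TSP

/-! The program is the dynamic program of Held and Karp for paths from city 0, restricted to a
family of sets of cities and repeated for several families. A round finds every tour whose chain of
prefixes lies in its family, in space about the size of the family. If the families together contain
the chains of all tours, the best entry is the optimum. Every entry that is present is the length of
an actual path (`Sound`), so an unsuitable family never produces a wrong value.

The families are products. The cities are cut into k blocks of a size m that grows only like log log
n. For a single block there is a collection of L lists of s subsets, such that the sublevel sets of
every ordering of the block, ties allowed, form a subsequence of some list. A round fixes one list
per block and runs through the s^k unions of one set per block, in the order of numbers in base s.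
Along a tour no position within a block decreases and one of them increases, so the enumeration
meets the prefixes of the tour in the right order (`IsCoverCode.exists_follows`). All L^k rounds
take time (s L)^k and space s^k up to subexponential factors, because the table is cleared after
each round except for the full set.

The length s is S^m up to a polynomial factor in m. That L can be about P_S^m is a covering
argument. Take a set system F on n₀ points with |F| ≤ S^n₀ and n₀! ≤ C(F) η^n₀, and m / n₀ + 1
copies of it, each relabelled by a random permutation. For a fixed ordering, at least C(F)
permutations per copy bring its sublevel sets into F (`numMaximalChains_le`). So about m² η^(m + n₀)
random products serve all m^m orderings with positive probability (`exists_cover`,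
`pow_mul_sub_pow_lt`, `exists_lists`). Writing down a family m + 1 times in a row turns each of its
chains into a subsequence (`exists_isCoverCode`).

The program knows neither F nor P_S. It reads numbers in base 2^m as collections of lists and tries
1, 2, 3, … until one of them covers. The least such number has no more digits than the collection
from the covering argument (`numLists_le_of_setSystem`), so a single program does as well as every η
> P_S. The search is affordable since m is so small that everything but the tables is 2^o(n)
(`log_overhead_isLittleO`). -/

namespace TSP

/-! ## Step counts, and their relation to time and space -/

/-- Coefficient of the bound on the binary length of the value of an expression. -/
def IntExpr.lengthCoeff : IntExpr → ℕ
  | .lit c => c.size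
  | .get _ _ => 1
  | .op _ a b => a.lengthCoeff + b.lengthCoeff + 1

/-- Coefficient of the bound on the cost of an expression. -/
def IntExpr.costCoeff : IntExpr → ℕ
  | .lit c => 1 + c.size
  | .get _ i => i.costCoeff + 2 + i.lengthCoeff
  | .op _ a b => a.costCoeff + b.costCoeff + 1 + a.lengthCoeff + b.lengthCoeff

/-- Coefficient of the bound on the number of summands. -/
def WeightExpr.lengthCoeff : WeightExpr → ℕ
  | .zero => 0
  | .dist _ _ => 1
  | .get _ _ => 1
  | .add a b => a.lengthCoeff + b.lengthCoeff

/-- Coefficient of the bound on the cost of a weight expression. -/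
def WeightExpr.costCoeff : WeightExpr → ℕ
  | .zero => 1
  | .dist x y => x.costCoeff + y.costCoeff + 2 + x.lengthCoeff + y.lengthCoeff
  | .get _ i => i.costCoeff + 2 + i.lengthCoeff
  | .add a b => a.costCoeff + b.costCoeff + 1 + a.lengthCoeff + b.lengthCoeff

/-- Coefficient of the bound on the cost of a test. -/
def Test.costCoeff : Test → ℕ
  | .eq a b => a.costCoeff + b.costCoeff + 1 + a.lengthCoeff + b.lengthCoeff
  | .le a b => a.costCoeff + b.costCoeff + 1 + a.lengthCoeff + b.lengthCoeff
  | .leWeight a b => a.costCoeff + b.costCoeff + 1 + a.lengthCoeff + b.lengthCoeff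
  | .leConst a b => a.costCoeff + b.costCoeff + 1 + a.lengthCoeff + b.lengthCoeff
  | .not p => p.costCoeff + 1
  | .and p q => p.costCoeff + q.costCoeff + 1

/-- Coefficient of the bound on the cost of a single step of a program. -/
def Program.costCoeff : Program → ℕ
  | .skip => 1
  | .setInt _ i e => i.costCoeff + e.costCoeff + 1 + i.lengthCoeff + e.lengthCoeff
  | .setWeight _ i e => i.costCoeff + e.costCoeff + 1 + i.lengthCoeff + e.lengthCoeff
  | .seq p q => p.costCoeff + q.costCoeff
  | .ite b p q => b.costCoeff + 1 + p.costCoeff + q.costCoeff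
  | .while b p => b.costCoeff + 1 + p.costCoeff

/-- All contents of cells have length at most `B`. -/
structure State.Bounded (B : ℕ) (s : State) : Prop where
  one_le : 1 ≤ B
  ints : ∀ a, (s.ints a).size ≤ B
  weights : ∀ a, (s.weights a).2 ≤ B

lemma size_mul_le (a b : ℕ) : (a * b).size ≤ a.size + b.size := by
  rw [Nat.size_le, pow_add]
  exact Nat.mul_lt_mul'' (Nat.lt_size_self a) (Nat.lt_size_self b)

lemma size_add_le (a b : ℕ) : (a + b).size ≤ a.size + b.size + 1 := by
  rw [Nat.size_le, pow_succ, mul_two]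
  exact Nat.add_lt_add
    ((Nat.lt_size_self a).trans_le (Nat.pow_le_pow_right (by norm_num) (by omega)))
    ((Nat.lt_size_self b).trans_le (Nat.pow_le_pow_right (by norm_num) (by omega)))

lemma Op.size_apply_le (o : Op) (a b : ℕ) : (o.apply a b).size ≤ a.size + b.size + 1 := by
  cases o
  · exact size_add_le a b
  · exact (Nat.size_le_size (Nat.sub_le a b)).trans (by omega)
  · exact (size_mul_le a b).trans (by omega)
  · exact (Nat.size_le_size (Nat.div_le_self a b)).trans (by omega)
  · exact (Nat.size_le_size (Nat.mod_le a b)).trans (by omega)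

lemma IntExpr.size_eval_le {B : ℕ} {s : State} (h : s.Bounded B) (e : IntExpr) :
    (e.eval s).size ≤ e.lengthCoeff * B := by
  induction e with
  | lit c => exact Nat.le_mul_of_pos_right _ h.one_le
  | get k i _ => simpa [eval, lengthCoeff] using h.ints _
  | op o a b ha hb =>
    refine (o.size_apply_le _ _).trans ?_
    have := h.one_le
    simp only [lengthCoeff]
    nlinarith

lemma IntExpr.cost_le {B : ℕ} {s : State} (h : s.Bounded B) (e : IntExpr) :
    e.cost s ≤ e.costCoeff * B := by
  have h1 := h.one_le
  induction e with
  | lit c => exact Nat.le_mul_of_pos_right _ h.one_le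
  | get k i hi =>
    have h2 := i.size_eval_le h
    have h3 := h.ints (k, i.eval s)
    simp only [cost, costCoeff]
    nlinarith
  | op o a b ha hb =>
    have h2 := a.size_eval_le h
    have h3 := b.size_eval_le h
    simp only [cost, costCoeff]
    nlinarith

variable {S : ℝ} {n : ℕ} {d : Fin n → Fin n → ℝ}

lemma WeightExpr.length_eval_le {B : ℕ} {s : State} (h : s.Bounded B) (e : WeightExpr) :
    (e.eval d s).2 ≤ e.lengthCoeff * B := by
  have h1 := h.one_le
  induction e with
  | zero => simp [eval]
  | dist x y =>
    simp only [eval, lengthCoeff]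
    split_ifs
    · simpa using h1
    · simp
  | get k i => simpa [eval, lengthCoeff] using h.weights _
  | add a b ha hb =>
    simp only [eval, lengthCoeff, Prod.snd_add]
    nlinarith

lemma WeightExpr.cost_le {B : ℕ} {s : State} (h : s.Bounded B) (e : WeightExpr) :
    e.cost d s ≤ e.costCoeff * B := by
  have h1 := h.one_le
  induction e with
  | zero => simpa [cost, costCoeff] using h1
  | dist x y =>
    have h2 := x.size_eval_le h
    have h3 := y.size_eval_le h
    have h4 := x.cost_le h
    have h5 := y.cost_le h
    simp only [cost, costCoeff]
    nlinarith
  | get k i =>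
    have h2 := i.size_eval_le h
    have h3 := h.weights (k, i.eval s)
    have h4 := i.cost_le h
    simp only [cost, costCoeff]
    nlinarith
  | add a b ha hb =>
    have h2 := a.length_eval_le (d := d) h
    have h3 := b.length_eval_le (d := d) h
    simp only [cost, costCoeff]
    nlinarith

lemma Test.cost_le {B : ℕ} {s : State} (h : s.Bounded B) (e : Test) :
    e.cost d s ≤ e.costCoeff * B := by
  have h1 := h.one_le
  induction e with
  | eq a b | le a b | leConst a b =>
    have h2 := a.size_eval_le h
    have h3 := b.size_eval_le h
    have h4 := a.cost_le h
    have h5 := b.cost_le h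
    simp only [cost, costCoeff]
    nlinarith
  | leWeight a b =>
    have h2 := a.length_eval_le (d := d) h
    have h3 := b.length_eval_le (d := d) h
    have h4 := a.cost_le (d := d) h
    have h5 := b.cost_le (d := d) h
    simp only [cost, costCoeff]
    nlinarith
  | not p hp =>
    simp only [cost, costCoeff]
    nlinarith
  | and p q hp hq =>
    simp only [cost, costCoeff]
    nlinarith

/-- `Runs S d G p s s' N`: the program `p` started in `s` halts in `s'` after `N` steps, and all
memory contents on the way satisfy `G`. -/
inductive Runs (S : ℝ) {n : ℕ} (d : Fin n → Fin n → ℝ) (G : State → Prop) :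
    Program → State → State → ℕ → Prop
  | skip (s : State) : G s → Runs S d G .skip s s 1
  | setInt (s : State) (k : ℕ) (i e : IntExpr) : G s → G (s.setInt k (i.eval s) (e.eval s)) →
      Runs S d G (.setInt k i e) s (s.setInt k (i.eval s) (e.eval s)) 1
  | setWeight (s : State) (k : ℕ) (i : IntExpr) (e : WeightExpr) : G s →
      G (s.setWeight k (i.eval s) (e.eval d s)) →
      Runs S d G (.setWeight k i e) s (s.setWeight k (i.eval s) (e.eval d s)) 1
  | seq {p q : Program} {s s' s'' : State} {t t' : ℕ} :
      Runs S d G p s s' t → Runs S d G q s' s'' t' → Runs S d G (.seq p q) s s'' (t + t')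
  | iteTrue {b : Test} {p q : Program} {s s' : State} {t : ℕ} :
      b.Holds S d s → Runs S d G p s s' t → Runs S d G (.ite b p q) s s' (1 + t)
  | iteFalse {b : Test} {p q : Program} {s s' : State} {t : ℕ} :
      ¬ b.Holds S d s → Runs S d G q s s' t → Runs S d G (.ite b p q) s s' (1 + t)
  | whileTrue {b : Test} {p : Program} {s s' s'' : State} {t t' : ℕ} :
      b.Holds S d s → Runs S d G p s s' t → Runs S d G (.while b p) s' s'' t' →
        Runs S d G (.while b p) s s'' (1 + t + t')
  | whileFalse {b : Test} {p : Program} {s : State} : G s →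
      ¬ b.Holds S d s → Runs S d G (.while b p) s s 1

lemma Runs.good {G : State → Prop} {p : Program} {s s' : State} {N : ℕ}
    (h : Runs S d G p s s' N) : G s := by
  induction h <;> assumption

lemma Runs.weaken {G G' : State → Prop} {p : Program} {s s' : State} {N : ℕ}
    (h : Runs S d G p s s' N) (hG : ∀ s, G s → G' s) : Runs S d G' p s s' N := by
  induction h with
  | skip s h => exact .skip s (hG _ h)
  | setInt s k i e h h' => exact .setInt s k i e (hG _ h) (hG _ h')
  | setWeight s k i e h h' => exact .setWeight s k i e (hG _ h) (hG _ h')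
  | seq _ _ ih ih' => exact .seq ih ih'
  | iteTrue h _ ih => exact .iteTrue h ih
  | iteFalse h _ ih => exact .iteFalse h ih
  | whileTrue h _ _ ih ih' => exact .whileTrue h ih ih'
  | whileFalse h h' => exact .whileFalse (hG _ h) h'

/-- Bounds on the lengths of the cells and on the space turn a step count into bounds on time and
space. -/
theorem Runs.exec {G : State → Prop} {p : Program} {s s' : State} {N B M : ℕ}
    (h : Runs S d G p s s' N) (hB : ∀ s, G s → s.Bounded B) (hM : ∀ s, G s → s.space ≤ M) :
    ∃ t m, Exec S d p s s' t m ∧ t ≤ N * (p.costCoeff * B) ∧ m ≤ M := by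
  induction h with
  | skip s h =>
    have := (hB s h).one_le
    exact ⟨_, _, .skip s, by simpa [Program.costCoeff] using this, hM s h⟩
  | setInt s k i e h h' =>
    refine ⟨_, _, .setInt s k i e, ?_, max_le (hM _ h) (hM _ h')⟩
    have h1 := i.cost_le (hB s h)
    have h2 := e.cost_le (hB s h)
    have h3 := i.size_eval_le (hB s h)
    have h4 := e.size_eval_le (hB s h)
    have h5 := (hB s h).one_le
    simp only [Program.costCoeff]
    nlinarith
  | setWeight s k i e h h' =>
    refine ⟨_, _, .setWeight s k i e, ?_, max_le (hM _ h) (hM _ h')⟩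
    have h1 := i.cost_le (hB s h)
    have h2 := e.cost_le (d := d) (hB s h)
    have h3 := i.size_eval_le (hB s h)
    have h4 := e.length_eval_le (d := d) (hB s h)
    have h5 := (hB s h).one_le
    simp only [Program.costCoeff]
    nlinarith
  | @seq p q s s' s'' t t' _ _ ih ih' =>
    obtain ⟨t₁, m₁, h₁, ht₁, hm₁⟩ := ih
    obtain ⟨t₂, m₂, h₂, ht₂, hm₂⟩ := ih'
    refine ⟨_, _, .seq h₁ h₂, ?_, max_le hm₁ hm₂⟩
    calc t₁ + t₂ ≤ t * (p.costCoeff * B) + t' * (q.costCoeff * B) := add_le_add ht₁ ht₂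
      _ ≤ t * ((p.costCoeff + q.costCoeff) * B) + t' * ((p.costCoeff + q.costCoeff) * B) := by
          gcongr <;> omega
      _ = _ := by simp only [Program.costCoeff]; ring
  | @iteTrue b p q s s' t hb hr ih =>
    obtain ⟨t₁, m₁, h₁, ht₁, hm₁⟩ := ih
    refine ⟨_, _, .iteTrue hb h₁, ?_, hm₁⟩
    have h2 := b.cost_le (d := d) (hB s hr.good)
    have h3 := (hB s hr.good).one_le
    calc b.cost d s + 1 + t₁ ≤ b.costCoeff * B + B + t * (p.costCoeff * B) := by omega
      _ = 1 * ((b.costCoeff + 1) * B) + t * (p.costCoeff * B) := by ring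
      _ ≤ 1 * ((b.costCoeff + 1 + p.costCoeff + q.costCoeff) * B) +
          t * ((b.costCoeff + 1 + p.costCoeff + q.costCoeff) * B) :=
          add_le_add (Nat.mul_le_mul_left _ (Nat.mul_le_mul_right _ (by omega)))
            (Nat.mul_le_mul_left _ (Nat.mul_le_mul_right _ (by omega)))
      _ = _ := by simp only [Program.costCoeff]; ring
  | @iteFalse b p q s s' t hb hr ih =>
    obtain ⟨t₁, m₁, h₁, ht₁, hm₁⟩ := ih
    refine ⟨_, _, .iteFalse hb h₁, ?_, hm₁⟩
    have h2 := b.cost_le (d := d) (hB s hr.good)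
    have h3 := (hB s hr.good).one_le
    calc b.cost d s + 1 + t₁ ≤ b.costCoeff * B + B + t * (q.costCoeff * B) := by omega
      _ = 1 * ((b.costCoeff + 1) * B) + t * (q.costCoeff * B) := by ring
      _ ≤ 1 * ((b.costCoeff + 1 + p.costCoeff + q.costCoeff) * B) +
          t * ((b.costCoeff + 1 + p.costCoeff + q.costCoeff) * B) :=
          add_le_add (Nat.mul_le_mul_left _ (Nat.mul_le_mul_right _ (by omega)))
            (Nat.mul_le_mul_left _ (Nat.mul_le_mul_right _ (by omega)))
      _ = _ := by simp only [Program.costCoeff]; ring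
  | @whileTrue b p s s' s'' t t' hb hr _ ih ih' =>
    obtain ⟨t₁, m₁, h₁, ht₁, hm₁⟩ := ih
    obtain ⟨t₂, m₂, h₂, ht₂, hm₂⟩ := ih'
    refine ⟨_, _, .whileTrue hb h₁ h₂, ?_, max_le hm₁ hm₂⟩
    have h2 := b.cost_le (d := d) (hB s hr.good)
    have h3 := (hB s hr.good).one_le
    simp only [Program.costCoeff] at ht₂ ⊢
    calc b.cost d s + 1 + t₁ + t₂ ≤ b.costCoeff * B + B + t * (p.costCoeff * B) +
          t' * ((b.costCoeff + 1 + p.costCoeff) * B) := by omega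
      _ = 1 * ((b.costCoeff + 1) * B) + t * (p.costCoeff * B) +
          t' * ((b.costCoeff + 1 + p.costCoeff) * B) := by ring
      _ ≤ 1 * ((b.costCoeff + 1 + p.costCoeff) * B) + t * ((b.costCoeff + 1 + p.costCoeff) * B) +
          t' * ((b.costCoeff + 1 + p.costCoeff) * B) :=
          add_le_add (add_le_add (Nat.mul_le_mul_left _ (Nat.mul_le_mul_right _ (by omega)))
            (Nat.mul_le_mul_left _ (Nat.mul_le_mul_right _ (by omega)))) le_rfl
      _ = _ := by ring
  | @whileFalse b p s h hb =>
    refine ⟨_, _, .whileFalse hb, ?_, hM s h⟩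
    have h2 := b.cost_le (d := d) (hB s h)
    have h3 := (hB s h).one_le
    simp only [Program.costCoeff]
    nlinarith

/-! ## Weakest preconditions -/

/-- The program `p` started in `s` halts after at most `N` steps in a state that satisfies `Q`, and
all memory contents on the way satisfy `G`. -/
def WP (S : ℝ) {n : ℕ} (d : Fin n → Fin n → ℝ) (G : State → Prop) (p : Program) (N : ℕ)
    (Q : State → Prop) (s : State) : Prop :=
  ∃ s' N', Runs S d G p s s' N' ∧ N' ≤ N ∧ Q s'

namespace WP

variable {G : State → Prop} {p q : Program} {N N' : ℕ} {Q Q' : State → Prop} {s : State}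

lemma mono (h : WP S d G p N Q s) (hN : N ≤ N') (hQ : ∀ s, Q s → Q' s) :
    WP S d G p N' Q' s := by
  obtain ⟨s', M, h1, h2, h3⟩ := h
  exact ⟨s', M, h1, h2.trans hN, hQ _ h3⟩

lemma weaken {G' : State → Prop} (h : WP S d G p N Q s) (hG : ∀ s, G s → G' s) :
    WP S d G' p N Q s := by
  obtain ⟨s', M, h1, h2, h3⟩ := h
  exact ⟨s', M, h1.weaken hG, h2, h3⟩

lemma skip (hG : G s) (hQ : Q s) : WP S d G .skip (N + 1) Q s :=
  ⟨s, 1, .skip s hG, by omega, hQ⟩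

lemma setInt {k : ℕ} {i e : IntExpr} (hG : G s) (hG' : G (s.setInt k (i.eval s) (e.eval s)))
    (hQ : Q (s.setInt k (i.eval s) (e.eval s))) : WP S d G (.setInt k i e) (N + 1) Q s :=
  ⟨_, 1, .setInt s k i e hG hG', by omega, hQ⟩

lemma setWeight {k : ℕ} {i : IntExpr} {e : WeightExpr} (a : ℕ) (w : ℝ × ℕ)
    (hi : i.eval s = a) (he : e.eval d s = w) (hG : G s) (hG' : G (s.setWeight k a w))
    (hQ : Q (s.setWeight k a w)) : WP S d G (.setWeight k i e) (N + 1) Q s := by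
  subst hi he
  exact ⟨_, 1, .setWeight s k i e hG hG', by omega, hQ⟩

lemma seq (N₁ N₂ : ℕ) (Q' : State → Prop) (hN : N₁ + N₂ ≤ N) (h : WP S d G p N₁ Q' s)
    (h' : ∀ s', Q' s' → WP S d G q N₂ Q s') : WP S d G (.seq p q) N Q s := by
  obtain ⟨s', M, h1, h2, h3⟩ := h
  obtain ⟨s'', M', h1', h2', h3'⟩ := h' s' h3
  exact ⟨s'', M + M', .seq h1 h1', (add_le_add h2 h2').trans hN, h3'⟩

lemma setInt_seq {k : ℕ} {i e : IntExpr} (a v : ℕ) (hi : i.eval s = a) (he : e.eval s = v)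
    (hG : G s) (hG' : G (s.setInt k a v)) (hp : WP S d G p N Q (s.setInt k a v)) :
    WP S d G (.seq (.setInt k i e) p) (N + 1) Q s := by
  subst hi he
  obtain ⟨s', M, h1, h2, h3⟩ := hp
  exact ⟨s', 1 + M, .seq (.setInt s k i e hG hG') h1, by omega, h3⟩

lemma setWeight_seq {k : ℕ} {i : IntExpr} {e : WeightExpr} (a : ℕ) (w : ℝ × ℕ)
    (hi : i.eval s = a) (he : e.eval d s = w) (hG : G s) (hG' : G (s.setWeight k a w))
    (hp : WP S d G p N Q (s.setWeight k a w)) :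
    WP S d G (.seq (.setWeight k i e) p) (N + 1) Q s := by
  subst hi he
  obtain ⟨s', M, h1, h2, h3⟩ := hp
  exact ⟨s', 1 + M, .seq (.setWeight s k i e hG hG') h1, by omega, h3⟩

lemma ite {b : Test} (h1 : b.Holds S d s → WP S d G p N Q s)
    (h2 : ¬ b.Holds S d s → WP S d G q N Q s) : WP S d G (.ite b p q) (N + 1) Q s := by
  by_cases hb : b.Holds S d s
  · obtain ⟨s', M, h3, h4, h5⟩ := h1 hb
    exact ⟨s', 1 + M, .iteTrue hb h3, by omega, h5⟩
  · obtain ⟨s', M, h3, h4, h5⟩ := h2 hb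
    exact ⟨s', 1 + M, .iteFalse hb h3, by omega, h5⟩

/-- A loop with invariant `I i` before the `i`-th of exactly `K` iterations. -/
lemma whileLoop {b : Test} (I : ℕ → State → Prop) (K N : ℕ)
    (hN : K * (N + 1) + 1 ≤ N') (h0 : I 0 s)
    (hbody : ∀ i < K, ∀ s, I i s → b.Holds S d s ∧ WP S d G p N (I (i + 1)) s)
    (hend : ∀ s, I K s → G s ∧ ¬ b.Holds S d s) (hQ : ∀ s, I K s → Q s) :
    WP S d G (.while b p) N' Q s := by
  suffices H : ∀ j i, i + j = K → ∀ s, I i s →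
      WP S d G (.while b p) (j * (N + 1) + 1) (I K) s from
    (H K 0 (zero_add K) s h0).mono hN hQ
  intro j
  induction j with
  | zero =>
    rintro i rfl s hs
    exact ⟨s, 1, .whileFalse (hend s hs).1 (hend s hs).2, by omega, hs⟩
  | succ j ih =>
    intro i hi s hs
    obtain ⟨hb, s', M, h1, h2, h3⟩ := hbody i (by omega) s hs
    obtain ⟨s'', M', h1', h2', h3'⟩ := ih (i + 1) (by omega) s' h3
    refine ⟨s'', 1 + M + M', .whileTrue hb h1 h1', ?_, h3'⟩
    rw [add_mul]
    omega

end WP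

end TSP

namespace TSP

/-! ## Scalar variables and the layout of the memory -/

/-- Integer array `k` used as a scalar variable. -/
def var (k : ℕ) : IntExpr := .get k (.lit 0)

/-- Assignment to a scalar variable. -/
def assign (k : ℕ) (e : IntExpr) : Program := .setInt k (.lit 0) e

/-- The strict comparison of integers. -/
def Test.lt (a b : IntExpr) : Test := .not (.le b a)

/-- The value of a scalar variable. -/
noncomputable def State.var (s : State) (k : ℕ) : ℕ := s.ints (k, 0)

/-- The memory content after an assignment to a scalar variable. -/
noncomputable def State.setVar (s : State) (k v : ℕ) : State := s.setInt k 0 v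

instance : Add IntExpr := ⟨.op .add⟩
instance : Sub IntExpr := ⟨.op .sub⟩
instance : Mul IntExpr := ⟨.op .mul⟩
instance : Div IntExpr := ⟨.op .div⟩
instance : Mod IntExpr := ⟨.op .mod⟩

/-- A numeral. -/
def num (c : ℕ) : IntExpr := .lit c

/-- Sequential composition. -/
infixr:67 " ;; " => Program.seq

section eval
variable (s : State) (a b : IntExpr)

@[simp] lemma eval_var (k : ℕ) : (var k).eval s = s.var k := rfl
@[simp] lemma eval_num (c : ℕ) : (num c).eval s = c := rfl
@[simp] lemma eval_add : (a + b).eval s = a.eval s + b.eval s := rfl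
@[simp] lemma eval_sub : (a - b).eval s = a.eval s - b.eval s := rfl
@[simp] lemma eval_mul : (a * b).eval s = a.eval s * b.eval s := rfl
@[simp] lemma eval_div : (a / b).eval s = a.eval s / b.eval s := rfl
@[simp] lemma eval_mod : (a % b).eval s = a.eval s % b.eval s := rfl

variable {S : ℝ} {n : ℕ} {d : Fin n → Fin n → ℝ} {s}

@[simp] lemma holds_lt : (Test.lt a b).Holds S d s ↔ a.eval s < b.eval s := by
  simp [Test.lt, Test.Holds]

@[simp] lemma holds_eq : (Test.eq a b).Holds S d s ↔ a.eval s = b.eval s := Iff.rfl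

@[simp] lemma holds_le : (Test.le a b).Holds S d s ↔ a.eval s ≤ b.eval s := Iff.rfl

@[simp] lemma holds_leConst :
    (Test.leConst a b).Holds S d s ↔ (a.eval s : ℝ) ≤ S * (b.eval s : ℝ) := Iff.rfl

@[simp] lemma holds_and (p q : Test) :
    (Test.and p q).Holds S d s ↔ p.Holds S d s ∧ q.Holds S d s := Iff.rfl

end eval

lemma State.ints_setInt (s : State) (k i v k' i' : ℕ) :
    (s.setInt k i v).ints (k', i') = if k' = k ∧ i' = i then v else s.ints (k', i') := by
  classical
  simp only [State.setInt, Finsupp.coe_update, Function.update_apply, Prod.mk.injEq]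

@[simp] lemma State.weights_setInt (s : State) (k i v : ℕ) :
    (s.setInt k i v).weights = s.weights := rfl

@[simp] lemma State.ints_setWeight (s : State) (k i : ℕ) (w : ℝ × ℕ) :
    (s.setWeight k i w).ints = s.ints := rfl

lemma State.weights_setWeight (s : State) (k i : ℕ) (w : ℝ × ℕ) (k' i' : ℕ) :
    (s.setWeight k i w).weights (k', i') =
      if k' = k ∧ i' = i then w else s.weights (k', i') := by
  classical
  simp only [State.setWeight, Finsupp.coe_update, Function.update_apply, Prod.mk.injEq]

@[simp] lemma State.var_setVar (s : State) (k v j : ℕ) :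
    (s.setVar k v).var j = if j = k then v else s.var j := by
  simp [State.var, State.setVar, State.ints_setInt]

/-- The layout of the memory: cells `0` of the first forty integer arrays, cells of integer array
`40` and of weight array `0` with indices in `R`. -/
structure Layout (B n : ℕ) (R : Finset ℕ) (s : State) : Prop where
  lt : ∀ a, s.ints a < 2 ^ B
  ints : ∀ k a, s.ints (k, a) ≠ 0 → (k < 40 ∧ a = 0) ∨ (k = 40 ∧ a ∈ R)
  weights : ∀ k a, s.weights (k, a) ≠ 0 → k = 0 ∧ a ∈ R
  count : ∀ a, (s.weights a).2 ≤ n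

lemma Layout.var_lt {B n : ℕ} {R : Finset ℕ} {s : State} (h : Layout B n R s) (k : ℕ) :
    s.var k < 2 ^ B := h.lt _

lemma Layout.setVar {B n : ℕ} {R : Finset ℕ} {s : State} (h : Layout B n R s) {k v : ℕ}
    (hk : k < 40) (hv : v < 2 ^ B) : Layout B n R (s.setVar k v) where
  lt := by
    rintro ⟨k', a⟩
    rw [State.setVar, State.ints_setInt]
    split_ifs
    exacts [hv, h.lt _]
  ints := by
    intro k' a
    rw [State.setVar, State.ints_setInt]
    split_ifs with h'
    · exact fun _ => .inl ⟨h'.1 ▸ hk, h'.2⟩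
    · exact h.ints k' a
  weights := h.weights
  count := h.count

lemma Layout.bounded {B n : ℕ} {R : Finset ℕ} {s : State} (h : Layout B n R s) (hB : 1 ≤ B) :
    s.Bounded (B + n) where
  one_le := by omega
  ints a := (Nat.size_le.2 (h.lt a)).trans (by omega)
  weights a := (h.count a).trans (by omega)

/-- The nonzero cells are at most forty scalars and, for each index in `R`, one test and one weight.
As the bound is linear in the size of `R`, the space is governed by the table of a single round. -/
lemma Layout.space_le {B n A : ℕ} {R : Finset ℕ} {s : State} (h : Layout B n R s)
    (hA : ∀ a ∈ R, a < 2 ^ A) : s.space ≤ (40 + 2 * R.card) * (1 + A + B + n) := by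
  classical
  have hA' : ∀ a ∈ R, a.size ≤ A := fun a ha => Nat.size_le.2 (hA a ha)
  have h1 : (s.ints.sum fun a v => 1 + a.2.size + v.size) ≤
      (40 + R.card) * (1 + A + B + n) := by
    have hsub : s.ints.support ⊆ Finset.range 40 ×ˢ {0} ∪ {40} ×ˢ R := by
      rintro ⟨k, a⟩ hka
      have := h.ints k a (by simpa using hka)
      simp only [Finset.mem_union, Finset.mem_product, Finset.mem_range, Finset.mem_singleton]
      exact this
    have hcard : s.ints.support.card ≤ 40 + R.card := by
      refine (Finset.card_le_card hsub).trans ((Finset.card_union_le _ _).trans ?_)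
      simp
    calc (s.ints.sum fun a v => 1 + a.2.size + v.size)
        ≤ s.ints.support.card • (1 + A + B + n) := by
          refine Finset.sum_le_card_nsmul _ _ _ ?_
          rintro ⟨k, a⟩ hka
          have h2 := Nat.size_le.2 (h.lt (k, a))
          rcases h.ints k a (by simpa using hka) with ⟨_, rfl⟩ | ⟨_, ha⟩
          · simp; omega
          · have := hA' a ha
            dsimp only
            omega
      _ ≤ _ := by rw [smul_eq_mul]; gcongr
  have h2 : (s.weights.sum fun a w => 1 + a.2.size + w.2) ≤ R.card * (1 + A + B + n) := by
    have hsub : s.weights.support ⊆ {0} ×ˢ R := by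
      rintro ⟨k, a⟩ hka
      have := h.weights k a (by simpa using hka)
      simp only [Finset.mem_product, Finset.mem_singleton]
      exact this
    have hcard : s.weights.support.card ≤ R.card := by
      refine (Finset.card_le_card hsub).trans ?_
      simp
    calc (s.weights.sum fun a w => 1 + a.2.size + w.2)
        ≤ s.weights.support.card • (1 + A + B + n) := by
          refine Finset.sum_le_card_nsmul _ _ _ ?_
          rintro ⟨k, a⟩ hka
          have h2 := h.count (k, a)
          have := hA' a (h.weights k a (by simpa using hka)).2
          dsimp only
          omega
      _ ≤ _ := by rw [smul_eq_mul]; gcongr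
  unfold State.space
  nlinarith

lemma Layout.mono {B n : ℕ} {R R' : Finset ℕ} {s : State} (h : Layout B n R s) (hR : R ⊆ R') :
    Layout B n R' s where
  lt := h.lt
  ints k a hka := (h.ints k a hka).imp_right fun h' => ⟨h'.1, hR h'.2⟩
  weights k a hka := ⟨(h.weights k a hka).1, hR (h.weights k a hka).2⟩
  count := h.count

/-- Only the integer arrays in `l` may differ between the two memory contents. -/
structure Frame (l : List ℕ) (s s' : State) : Prop where
  weights : s'.weights = s.weights
  ints : ∀ k ∉ l, ∀ a, s'.ints (k, a) = s.ints (k, a)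

lemma Frame.refl (l : List ℕ) (s : State) : Frame l s s := ⟨rfl, fun _ _ _ => rfl⟩

lemma Frame.trans {l : List ℕ} {s s' s'' : State} (h : Frame l s s') (h' : Frame l s' s'') :
    Frame l s s'' :=
  ⟨h'.weights.trans h.weights, fun k hk a => (h'.ints k hk a).trans (h.ints k hk a)⟩

lemma Frame.mono {l l' : List ℕ} {s s' : State} (h : Frame l s s') (hl : l ⊆ l') :
    Frame l' s s' := ⟨h.weights, fun k hk a => h.ints k (fun hk' => hk (hl hk')) a⟩

lemma Frame.setVar {l : List ℕ} {s s' : State} (h : Frame l s s') {k v : ℕ} (hk : k ∈ l) :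
    Frame l s (s'.setVar k v) where
  weights := h.weights
  ints k' hk' a := by
    rw [State.setVar, State.ints_setInt, if_neg, h.ints k' hk' a]
    rintro ⟨rfl, -⟩
    exact hk' hk

@[simp] lemma frame_setVar {l : List ℕ} {s s' : State} {k v : ℕ} (hk : k ∈ l) :
    Frame l s (s'.setVar k v) ↔ Frame l s s' := by
  refine ⟨fun h => ⟨h.weights, fun k' hk' a => ?_⟩, fun h => h.setVar hk⟩
  have := h.ints k' hk' a
  rwa [State.setVar, State.ints_setInt, if_neg] at this
  rintro ⟨rfl, -⟩
  exact hk' hk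

attribute [simp] Frame.refl

lemma Frame.var {l : List ℕ} {s s' : State} (h : Frame l s s') {k : ℕ} (hk : k ∉ l) :
    s'.var k = s.var k := h.ints k hk 0

/-- Of the integer arrays only those in `l` may differ between the two memory contents. -/
def IntFrame (l : List ℕ) (s s' : State) : Prop :=
  ∀ k ∉ l, ∀ a, s'.ints (k, a) = s.ints (k, a)

@[simp] lemma IntFrame.refl (l : List ℕ) (s : State) : IntFrame l s s := fun _ _ _ => rfl

lemma IntFrame.trans {l : List ℕ} {s s' s'' : State} (h : IntFrame l s s')
    (h' : IntFrame l s' s'') : IntFrame l s s'' :=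
  fun k hk a => (h' k hk a).trans (h k hk a)

lemma IntFrame.var {l : List ℕ} {s s' : State} (h : IntFrame l s s') {k : ℕ} (hk : k ∉ l) :
    s'.var k = s.var k := h k hk 0

lemma IntFrame.mono {l l' : List ℕ} {s s' : State} (h : IntFrame l s s') (hl : l ⊆ l') :
    IntFrame l' s s' := fun k hk a => h k (fun hk' => hk (hl hk')) a

lemma Frame.intFrame {l l' : List ℕ} {s s' : State} (h : Frame l s s') (hl : l ⊆ l') :
    IntFrame l' s s' := (h.mono hl).ints

@[simp] lemma intFrame_setInt {l : List ℕ} {s s' : State} {k i v : ℕ} (hk : k ∈ l) :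
    IntFrame l s (s'.setInt k i v) ↔ IntFrame l s s' := by
  refine forall₂_congr fun k' hk' => forall_congr' fun a => ?_
  rw [State.ints_setInt, if_neg]
  rintro ⟨rfl, -⟩
  exact hk' hk

@[simp] lemma intFrame_setVar {l : List ℕ} {s s' : State} {k v : ℕ} (hk : k ∈ l) :
    IntFrame l s (s'.setVar k v) ↔ IntFrame l s s' := intFrame_setInt hk

@[simp] lemma intFrame_setWeight {l : List ℕ} {s s' : State} {k i : ℕ} {w : ℝ × ℕ} :
    IntFrame l s (s'.setWeight k i w) ↔ IntFrame l s s' := Iff.rfl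

namespace WP

variable {S : ℝ} {n : ℕ} {d : Fin n → Fin n → ℝ} {B n' : ℕ} {R : Finset ℕ} {p q : Program}
  {N N' : ℕ} {Q : State → Prop} {s : State}

lemma assign {k : ℕ} {e : IntExpr} (h : Layout B n' R s) (v : ℕ) (he : e.eval s = v)
    (hk : k < 40) (hv : v < 2 ^ B) (hQ : Layout B n' R (s.setVar k v) → Q (s.setVar k v)) :
    WP S d (Layout B n' R) (TSP.assign k e) (N + 1) Q s := by
  subst he
  exact .setInt h (h.setVar hk hv) (hQ (h.setVar hk hv))

lemma assign_seq {k : ℕ} {e : IntExpr} (h : Layout B n' R s) (v : ℕ) (he : e.eval s = v)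
    (hk : k < 40) (hv : v < 2 ^ B)
    (hQ : Layout B n' R (s.setVar k v) → WP S d (Layout B n' R) p N Q (s.setVar k v)) :
    WP S d (Layout B n' R) (.seq (TSP.assign k e) p) (N + 1) Q s :=
  .seq 1 N (fun s' => s' = s.setVar k v ∧ Layout B n' R s') (by omega)
    (.assign h v he hk hv fun h => ⟨rfl, h⟩) (by rintro _ ⟨rfl, h⟩; exact hQ h)

end WP

end TSP

namespace TSP

/-! ## The search for a cover code -/

/-- The bit mask of `{e < m | digit e of p in base m is less than i}`. -/
def sublevelCode (m p i : ℕ) : ℕ := ∑ e ∈ Finset.range m, if p / m ^ e % m < i then 2 ^ e else 0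

/-- The number of sets `sublevelCode m p 0, sublevelCode m p 1, …` that are found greedily, in this
order, among the base `M` digits of `c` up to digit `t`, starting anew at the multiples of `s`. -/
def greedy (m s M c p : ℕ) : ℕ → ℕ
  | 0 => 0
  | t + 1 =>
    let i := if t % s = 0 then 0 else greedy m s M c p t
    if c / M ^ t % M = sublevelCode m p i then i + 1 else i

/-- The number of base `M` digits. -/
def numDigits (M c : ℕ) : ℕ := Nat.log M c + 1

/-- The digits of `c` in base `M`, in groups of `s`, contain all chains of sublevel sets. -/
def IsCoverCode (m s M c : ℕ) : Prop :=
  0 < c ∧ ∀ p < m ^ m, ∃ t < numDigits M c, greedy m s M c p (t + 1) = m + 1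

/-- Computes `sublevelCode` in variable `14`. -/
def sublevelProg : Program :=
  assign 14 (num 0) ;; assign 15 (num 0) ;; assign 16 (num 1) ;; assign 17 (var 8) ;;
  .while (.lt (var 15) (var 1))
    (.ite (.lt (var 17 % var 1) (var 13)) (assign 14 (var 14 + var 16)) .skip ;;
     assign 17 (var 17 / var 1) ;; assign 16 (var 16 * num 2) ;; assign 15 (var 15 + num 1))

/-- Decides in variable `10` whether the chain number `8` is contained in the code. -/
def scanProg : Program :=
  assign 10 (num 0) ;; assign 11 (var 6) ;; assign 12 (num 0) ;; assign 13 (num 0) ;;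
  .while (.lt (num 0) (var 11))
    (.ite (.eq (var 12 % var 3) (num 0)) (assign 13 (num 0)) .skip ;;
     sublevelProg ;;
     .ite (.eq (var 11 % var 4) (var 14)) (assign 13 (var 13 + num 1)) .skip ;;
     .ite (.eq (var 13) (var 1 + num 1)) (assign 10 (num 1)) .skip ;;
     assign 11 (var 11 / var 4) ;; assign 12 (var 12 + num 1))

/-- Decides in variable `7` whether variable `6` is a cover code. -/
def checkProg : Program :=
  assign 7 (num 1) ;; assign 8 (num 0) ;;
  .while (.lt (var 8) (var 9))
    (scanProg ;; .ite (.eq (var 10) (num 0)) (assign 7 (num 0)) .skip ;;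
     assign 8 (var 8 + num 1))

/-- Computes the least cover code in variable `6`. -/
def searchProg : Program :=
  assign 6 (num 0) ;; assign 7 (num 0) ;;
  .while (.eq (var 7) (num 0)) (assign 6 (var 6 + num 1) ;; checkProg)

/-! ### Correctness and step count of the search -/

variable {S : ℝ} {n : ℕ} {d : Fin n → Fin n → ℝ} {B n' : ℕ} {R : Finset ℕ}

lemma sum_ite_two_pow_lt (m : ℕ) (P : ℕ → Prop) [DecidablePred P] :
    (∑ e ∈ Finset.range m, if P e then 2 ^ e else 0) < 2 ^ m := by
  induction m with
  | zero => simp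
  | succ m ih =>
    rw [Finset.sum_range_succ, pow_succ]
    split_ifs <;> omega

lemma wp_sublevelProg {s : State} (h : Layout B n' R s) (hB : s.var 1 < B) :
    WP S d (Layout B n' R) sublevelProg (6 * s.var 1 + 5)
      (fun s' => Layout B n' R s' ∧ Frame [14, 15, 16, 17] s s' ∧
        s'.var 14 = sublevelCode (s.var 1) (s.var 8) (s.var 13)) s := by
  have hB2 : 2 ^ s.var 1 < 2 ^ B := Nat.pow_lt_pow_right (by norm_num) hB
  have hlt : ∀ j, j ≤ s.var 1 → j < 2 ^ B := fun j hj => hj.trans_lt (h.var_lt 1)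
  have hpow : ∀ j, j ≤ s.var 1 → 2 ^ j < 2 ^ B := fun j hj =>
    Nat.pow_lt_pow_right (by norm_num) (by omega)
  refine .assign_seq h 0 rfl (by simp) (by positivity) fun h => ?_
  refine .assign_seq h 0 rfl (by simp) (by positivity) fun h => ?_
  refine .assign_seq h 1 rfl (by simp) (hpow 0 (by simp)) fun h => ?_
  refine .assign_seq h (s.var 8) (by simp) (by simp) (by simpa using h.var_lt 8) fun h => ?_
  refine .whileLoop (fun j s' => Layout B n' R s' ∧ Frame [14, 15, 16, 17] s s' ∧
    s'.var 14 = (∑ e ∈ Finset.range j, if s.var 8 / s.var 1 ^ e % s.var 1 < s.var 13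
      then 2 ^ e else 0) ∧ s'.var 15 = j ∧ s'.var 16 = 2 ^ j ∧ s'.var 17 = s.var 8 / s.var 1 ^ j)
      (s.var 1) 5 (by omega) ⟨h, by simp⟩ ?_ ?_ ?_
  · rintro j hj s' ⟨h, hF, h14, h15, h16, h17⟩
    have h1 := hF.var (k := 1) (by simp)
    have h13 := hF.var (k := 13) (by simp)
    have hlt' := sum_ite_two_pow_lt (j + 1) fun e => s.var 8 / s.var 1 ^ e % s.var 1 < s.var 13
    refine ⟨by simp [h15, h1, hj], .seq 2 3 (fun s' => Layout B n' R s' ∧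
      Frame [14, 15, 16, 17] s s' ∧ s'.var 14 = (∑ e ∈ Finset.range (j + 1),
        if s.var 8 / s.var 1 ^ e % s.var 1 < s.var 13 then 2 ^ e else 0) ∧ s'.var 15 = j ∧
        s'.var 16 = 2 ^ j ∧ s'.var 17 = s.var 8 / s.var 1 ^ j) le_rfl (.ite ?_ ?_) ?_⟩
    · intro hb
      simp only [holds_lt, eval_mod, eval_var, h17, h1, h13] at hb
      refine .assign h _ rfl (by simp) ?_ fun h => ?_
      · rw [Finset.sum_range_succ, if_pos hb] at hlt'
        simpa [h14, h16] using hlt'.trans (hpow _ hj)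
      · exact ⟨h, by simp [hF, h14, h15, h16, h17, Finset.sum_range_succ, hb]⟩
    · intro hb
      simp only [holds_lt, eval_mod, eval_var, h17, h1, h13] at hb
      exact .skip h ⟨h, hF, by simp [h14, Finset.sum_range_succ, hb], h15, h16, h17⟩
    · rintro s' ⟨h, hF, h14, h15, h16, h17⟩
      have h1 := hF.var (k := 1) (by simp)
      refine .assign_seq h (s.var 8 / s.var 1 ^ (j + 1))
        (by simp [h17, h1, Nat.div_div_eq_div_mul, pow_succ]) (by simp)
        ((Nat.div_le_self _ _).trans_lt (hF.var (k := 8) (by simp) ▸ h.var_lt 8)) fun h => ?_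
      refine .assign_seq h (2 ^ (j + 1)) (by simp [h16, pow_succ]) (by simp) (hpow _ hj) fun h => ?_
      refine .assign h (j + 1) (by simp [h15]) (by simp) (hlt _ hj) fun h => ?_
      exact ⟨h, by simp [hF, h14]⟩
  · rintro s' ⟨h, hF, h14, h15, h16, h17⟩
    simp [h, h15, hF.var (k := 1)]
  · rintro s' ⟨h, hF, h14, -⟩
    exact ⟨h, hF, h14⟩

lemma greedy_le (m s M c p t : ℕ) : greedy m s M c p t ≤ t := by
  induction t with
  | zero => simp [greedy]
  | succ t ih =>
    simp only [greedy]
    split_ifs <;> omega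

/-- This is the test of the scanning loop: digits remain as long as the quotient is not zero. -/
lemma lt_numDigits_iff {M c t : ℕ} (hM : 1 < M) (hc : 0 < c) : t < numDigits M c ↔ 0 < c / M ^ t := by
  rw [numDigits, Nat.lt_succ_iff, Nat.le_log_iff_pow_le hM hc.ne', Nat.div_pos_iff]
  have : 0 < M ^ t := by positivity
  tauto

/-- Variable `11` holds the code divided by a power of the base, so its remainder is the current
digit, and variable `13` follows `greedy`. The final value of the counter `12` is recorded because
`sizesProg` computes the number of lists from it. -/
lemma wp_scanProg {s : State} (h : Layout B n' R s) (hB : s.var 1 < B) (hM : 1 < s.var 4)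
    (hc : 0 < s.var 6) (hD : numDigits (s.var 4) (s.var 6) < 2 ^ B) :
    WP S d (Layout B n' R) scanProg
      (numDigits (s.var 4) (s.var 6) * (6 * s.var 1 + 14) + 5)
      (fun s' => Layout B n' R s' ∧ Frame [10, 11, 12, 13, 14, 15, 16, 17] s s' ∧
        (s'.var 10 = 0 ↔ ¬ ∃ t < numDigits (s.var 4) (s.var 6),
          greedy (s.var 1) (s.var 3) (s.var 4) (s.var 6) (s.var 8) (t + 1) = s.var 1 + 1) ∧
        s'.var 12 = numDigits (s.var 4) (s.var 6)) s := by
  set D := numDigits (s.var 4) (s.var 6) with hDdef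
  set g := greedy (s.var 1) (s.var 3) (s.var 4) (s.var 6) (s.var 8) with hg
  have hlt : ∀ j, j ≤ D → j < 2 ^ B := fun j hj => hj.trans_lt hD
  refine .assign_seq h 0 rfl (by simp) (by positivity) fun h => ?_
  refine .assign_seq h (s.var 6) (by simp) (by simp) (by simpa using h.var_lt 6) fun h => ?_
  refine .assign_seq h 0 rfl (by simp) (by positivity) fun h => ?_
  refine .assign_seq h 0 rfl (by simp) (by positivity) fun h => ?_
  refine .whileLoop (fun t s' => Layout B n' R s' ∧ Frame [10, 11, 12, 13, 14, 15, 16, 17] s s' ∧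
    (s'.var 10 = 0 ↔ ¬ ∃ t' < t, g (t' + 1) = s.var 1 + 1) ∧ s'.var 11 = s.var 6 / s.var 4 ^ t ∧
    s'.var 12 = t ∧ s'.var 13 = g t) D (6 * s.var 1 + 13) (by rfl)
    ⟨h, by simp [hg, greedy]⟩ ?_ ?_ ?_
  · rintro t ht s' ⟨h, hF, h10, h11, h12, h13⟩
    refine ⟨by simpa [h11] using (lt_numDigits_iff hM hc).1 ht, ?_⟩
    refine .seq 2 (6 * s.var 1 + 11) (fun s' => Layout B n' R s' ∧
      Frame [10, 11, 12, 13, 14, 15, 16, 17] s s' ∧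
      (s'.var 10 = 0 ↔ ¬ ∃ t' < t, g (t' + 1) = s.var 1 + 1) ∧
      s'.var 11 = s.var 6 / s.var 4 ^ t ∧ s'.var 12 = t ∧
      s'.var 13 = if t % s.var 3 = 0 then 0 else g t) (by omega) (.ite ?_ ?_) ?_
    · intro hb
      simp only [holds_eq, eval_mod, eval_var, h12, hF.var (k := 3) (by simp), eval_num] at hb
      refine .assign h 0 rfl (by simp) (by positivity) fun h => ?_
      exact ⟨h, by simp [hF, h10, h11, h12, hb]⟩
    · intro hb
      simp only [holds_eq, eval_mod, eval_var, h12, hF.var (k := 3) (by simp), eval_num] at hb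
      exact .skip h ⟨h, hF, h10, h11, h12, by simp [h13, hb]⟩
    clear! s'
    rintro s' ⟨h, hF, h10, h11, h12, h13⟩
    have h1 := hF.var (k := 1) (by simp)
    refine .seq (6 * s.var 1 + 5) 6 _ le_rfl (h1 ▸ wp_sublevelProg h (h1.symm ▸ hB)) ?_
    rintro s'' ⟨h', hF', h14⟩
    rw [hF.var (k := 8) (by simp), h13] at h14
    rw [← hF'.var (k := 10) (by simp)] at h10
    rw [← hF'.var (k := 11) (by simp)] at h11
    rw [← hF'.var (k := 12) (by simp)] at h12
    rw [← hF'.var (k := 13) (by simp)] at h13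
    replace hF := hF.trans (hF'.mono (by simp))
    clear! s'
    have hgt : g (t + 1) = if s.var 6 / s.var 4 ^ t % s.var 4 =
        sublevelCode (s.var 1) (s.var 8) (if t % s.var 3 = 0 then 0 else g t) then
        (if t % s.var 3 = 0 then 0 else g t) + 1 else (if t % s.var 3 = 0 then 0 else g t) := by
      rw [hg, greedy]
    refine .seq 2 4 (fun s' => Layout B n' R s' ∧
      Frame [10, 11, 12, 13, 14, 15, 16, 17] s s' ∧
      (s'.var 10 = 0 ↔ ¬ ∃ t' < t, g (t' + 1) = s.var 1 + 1) ∧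
      s'.var 11 = s.var 6 / s.var 4 ^ t ∧ s'.var 12 = t ∧
      s'.var 13 = g (t + 1)) (by omega) (.ite ?_ ?_) ?_
    · intro hb
      simp only [holds_eq, eval_mod, eval_var, h11, h14, hF.var (k := 4) (by simp)] at hb
      rw [if_pos hb] at hgt
      refine .assign h' (g (t + 1)) (by simp [h13, hgt]) (by simp)
        (hlt _ ((greedy_le _ _ _ _ _ _).trans ht)) fun h => ?_
      exact ⟨h, by simp [hF, h10, h11, h12]⟩
    · intro hb
      simp only [holds_eq, eval_mod, eval_var, h11, h14, hF.var (k := 4) (by simp)] at hb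
      rw [if_neg hb] at hgt
      exact .skip h' ⟨h', hF, h10, h11, h12, by rw [h13, hgt]⟩
    clear! s''
    rintro s' ⟨h, hF, h10, h11, h12, h13⟩
    refine .seq 2 2 (fun s' => Layout B n' R s' ∧
      Frame [10, 11, 12, 13, 14, 15, 16, 17] s s' ∧
      (s'.var 10 = 0 ↔ ¬ ∃ t' < t + 1, g (t' + 1) = s.var 1 + 1) ∧
      s'.var 11 = s.var 6 / s.var 4 ^ t ∧ s'.var 12 = t ∧
      s'.var 13 = g (t + 1)) (by omega) (.ite ?_ ?_) ?_
    · intro hb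
      simp only [holds_eq, eval_add, eval_num, eval_var, h13, hF.var (k := 1) (by simp)] at hb
      refine .assign h 1 rfl (by simp) (Nat.one_lt_two_pow (by omega)) fun h => ?_
      refine ⟨h, by simp [hF], ?_, by simp [h11], by simp [h12], by simp [h13]⟩
      simp only [State.var_setVar, if_true, one_ne_zero, false_iff, not_not]
      exact ⟨t, by omega, hb⟩
    · intro hb
      simp only [holds_eq, eval_add, eval_num, eval_var, h13, hF.var (k := 1) (by simp)] at hb
      refine .skip h ⟨h, hF, ?_, h11, h12, h13⟩
      rw [h10, not_iff_not]
      constructor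
      · rintro ⟨t', ht', h'⟩
        exact ⟨t', by omega, h'⟩
      · rintro ⟨t', ht', h'⟩
        refine ⟨t', lt_of_le_of_ne (by omega) ?_, h'⟩
        rintro rfl
        exact hb h'
    clear! s'
    rintro s' ⟨h, hF, h10, h11, h12, h13⟩
    have h4 := hF.var (k := 4) (by simp)
    refine .assign_seq h (s.var 6 / s.var 4 ^ (t + 1))
      (by simp [h11, h4, Nat.div_div_eq_div_mul, pow_succ]) (by simp)
      ((Nat.div_le_self _ _).trans_lt (hF.var (k := 6) (by simp) ▸ h.var_lt 6)) fun h => ?_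
    refine .assign h (t + 1) (by simp [h12]) (by simp) (hlt _ ht) fun h => ?_
    exact ⟨h, by simp [hF, h10, h13]⟩
  · rintro s' ⟨h, hF, h10, h11, h12, h13⟩
    refine ⟨h, ?_⟩
    simpa [h11] using (lt_numDigits_iff (t := D) hM hc).not.1 (lt_irrefl _)
  · rintro s' ⟨h, hF, h10, h11, h12, h13⟩
    exact ⟨h, hF, h10, h12⟩

lemma wp_checkProg {s : State} (h : Layout B n' R s) (hB : s.var 1 < B) (hM : 1 < s.var 4)
    (hc : 0 < s.var 6) (hD : numDigits (s.var 4) (s.var 6) < 2 ^ B) (hm : 0 < s.var 9)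
    (hm' : s.var 9 = s.var 1 ^ s.var 1) :
    WP S d (Layout B n' R) checkProg
      (s.var 9 * (numDigits (s.var 4) (s.var 6) * (6 * s.var 1 + 14) + 9) + 3)
      (fun s' => Layout B n' R s' ∧ Frame [7, 8, 10, 11, 12, 13, 14, 15, 16, 17] s s' ∧
        (s'.var 7 = 0 ↔ ¬ IsCoverCode (s.var 1) (s.var 3) (s.var 4) (s.var 6)) ∧
        s'.var 12 = numDigits (s.var 4) (s.var 6)) s := by
  set D := numDigits (s.var 4) (s.var 6) with hDdef
  set g := greedy (s.var 1) (s.var 3) (s.var 4) (s.var 6) with hg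
  refine .assign_seq h 1 rfl (by simp) (Nat.one_lt_two_pow (by omega)) fun h => ?_
  refine .assign_seq h 0 rfl (by simp) (by positivity) fun h => ?_
  refine .whileLoop (fun p s' => Layout B n' R s' ∧
    Frame [7, 8, 10, 11, 12, 13, 14, 15, 16, 17] s s' ∧
    (s'.var 7 = 0 ↔ ¬ ∀ p' < p, ∃ t < D, g p' (t + 1) = s.var 1 + 1) ∧
    s'.var 8 = p ∧ (0 < p → s'.var 12 = D)) (s.var 9) (D * (6 * s.var 1 + 14) + 8) (by rfl)
    ⟨h, by simp⟩ ?_ ?_ ?_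
  · rintro p hp s' ⟨h, hF, h7, h8, -⟩
    have h1 := hF.var (k := 1) (by simp)
    have h3 := hF.var (k := 3) (by simp)
    have h4 := hF.var (k := 4) (by simp)
    have h6 := hF.var (k := 6) (by simp)
    have h9 := hF.var (k := 9) (by simp)
    refine ⟨by simp [h8, h9, hp], ?_⟩
    have hscan := wp_scanProg (S := S) (d := d) h (by rwa [h1]) (by rwa [h4]) (by rwa [h6])
      (by rwa [h4, h6])
    rw [h1, h3, h4, h6, h8] at hscan
    refine .seq (D * (6 * s.var 1 + 14) + 5) 3 _ (by omega) hscan ?_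
    rintro s'' ⟨h', hF', h10, h12⟩
    rw [← hF'.var (k := 7) (by simp)] at h7
    rw [← hF'.var (k := 8) (by simp)] at h8
    replace hF := hF.trans (hF'.mono (by simp))
    clear! s'
    refine .seq 2 1 (fun s' => Layout B n' R s' ∧
      Frame [7, 8, 10, 11, 12, 13, 14, 15, 16, 17] s s' ∧
      (s'.var 7 = 0 ↔ ¬ ∀ p' < p + 1, ∃ t < D, g p' (t + 1) = s.var 1 + 1) ∧
      s'.var 8 = p ∧ s'.var 12 = D) (by omega) (.ite ?_ ?_) ?_
    · intro hb
      simp only [holds_eq, eval_var, eval_num] at hb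
      refine .assign h' 0 rfl (by simp) (by positivity) fun h => ?_
      refine ⟨h, by simp [hF], ?_, by simp [h8], by simp [h12, hDdef]⟩
      simp only [State.var_setVar, if_true, true_iff]
      exact fun H => h10.1 hb (H p (by omega))
    · intro hb
      simp only [holds_eq, eval_var, eval_num] at hb
      refine .skip h' ⟨h', hF, ?_, h8, h12⟩
      rw [h7, not_iff_not]
      constructor
      · intro H p' hp'
        rcases Nat.lt_succ_iff_lt_or_eq.1 hp' with hp' | rfl
        · exact H p' hp'
        · by_contra H'
          exact hb (h10.2 H')
      · exact fun H p' hp' => H p' (by omega)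
    clear! s''
    rintro s' ⟨h, hF, h7, h8, h12⟩
    refine .assign h (p + 1) (by simp [h8]) (by simp)
      ((Nat.succ_le_of_lt hp).trans_lt (hF.var (k := 9) (by simp) ▸ h.var_lt 9)) fun h => ?_
    exact ⟨h, by simp [hF, h7, h12]⟩
  · rintro s' ⟨h, hF, h7, h8, h12⟩
    simp [h, h8, hF.var (k := 9)]
  · rintro s' ⟨h, hF, h7, h8, h12⟩
    -- There is at least one ordering, so at least one scan has set variable `12`.
    refine ⟨h, hF, ?_, h12 hm⟩
    rw [h7, IsCoverCode, ← hm']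
    simp [hc, hg, hDdef]

/-- Codes are tried in increasing order, so there are exactly `c` checks, and none costs more than
the bound for `c`, since the number of digits is monotone. -/
lemma wp_searchProg {s : State} {c : ℕ} (h : Layout B n' R s) (hB : s.var 1 < B)
    (hM : 1 < s.var 4) (hcB : c < 2 ^ B) (hD : numDigits (s.var 4) c < 2 ^ B) (hm : 0 < s.var 9)
    (hm' : s.var 9 = s.var 1 ^ s.var 1)
    (hc : IsCoverCode (s.var 1) (s.var 3) (s.var 4) c)
    (hc' : ∀ c' < c, ¬ IsCoverCode (s.var 1) (s.var 3) (s.var 4) c') :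
    WP S d (Layout B n' R) searchProg
      (c * (s.var 9 * (numDigits (s.var 4) c * (6 * s.var 1 + 14) + 9) + 5) + 3)
      (fun s' => Layout B n' R s' ∧ Frame [6, 7, 8, 10, 11, 12, 13, 14, 15, 16, 17] s s' ∧
        s'.var 6 = c ∧ s'.var 12 = numDigits (s.var 4) c) s := by
  have hDmono : ∀ c' ≤ c, numDigits (s.var 4) c' ≤ numDigits (s.var 4) c := fun c' h =>
    Nat.succ_le_succ (Nat.log_mono_right h)
  refine .assign_seq h 0 rfl (by simp) (by positivity) fun h => ?_
  refine .assign_seq h 0 rfl (by simp) (by positivity) fun h => ?_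
  -- Zero is not a cover code by definition, so the initial flag is correct. Before the first check
  -- variable `12` is unspecified, hence the condition `0 < i`.
  refine .whileLoop (fun i s' => Layout B n' R s' ∧
    Frame [6, 7, 8, 10, 11, 12, 13, 14, 15, 16, 17] s s' ∧
    (s'.var 7 = 0 ↔ ¬ IsCoverCode (s.var 1) (s.var 3) (s.var 4) i) ∧
    s'.var 6 = i ∧ (0 < i → s'.var 12 = numDigits (s.var 4) i)) c
    (s.var 9 * (numDigits (s.var 4) c * (6 * s.var 1 + 14) + 9) + 4) (by rfl)
    ⟨h, by simp [IsCoverCode]⟩ ?_ ?_ ?_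
  · rintro i hi s' ⟨h, hF, h7, h6, -⟩
    refine ⟨by simpa [h7] using hc' i hi, ?_⟩
    refine .assign_seq h (i + 1) (by simp [h6]) (by simp)
      (lt_of_le_of_lt (Nat.succ_le_of_lt hi) hcB) fun h => ?_
    have hF : Frame [6, 7, 8, 10, 11, 12, 13, 14, 15, 16, 17] s (s'.setVar 6 (i + 1)) := by
      simp [hF]
    have h6 : (s'.setVar 6 (i + 1)).var 6 = i + 1 := by simp
    generalize s'.setVar 6 (i + 1) = s' at *
    have h1 := hF.var (k := 1) (by simp)
    have h3 := hF.var (k := 3) (by simp)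
    have h4 := hF.var (k := 4) (by simp)
    have h9 := hF.var (k := 9) (by simp)
    have hcheck := wp_checkProg (S := S) (d := d) h (by rwa [h1]) (by rwa [h4])
      (by rw [h6]; omega) (by rw [h4, h6]; exact (hDmono _ hi).trans_lt hD) (by rwa [h9])
      (by rwa [h1, h9])
    rw [h1, h3, h4, h6, h9] at hcheck
    refine hcheck.mono ?_ ?_
    · have := hDmono _ hi
      gcongr
    · rintro s'' ⟨h', hF', h7, h12⟩
      exact ⟨h', hF.trans (hF'.mono (by simp)), h7, (hF'.var (by simp)).trans h6, fun _ => h12⟩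
  · rintro s' ⟨h, hF, h7, h6, h12⟩
    simp [h, h7, hc]
  · rintro s' ⟨h, hF, h7, h6, h12⟩
    exact ⟨h, hF, h6, h12 hc.1⟩

end TSP

namespace TSP

/-! ## Block size, list length, and unions of blocks -/

/-- An integer upper approximation of `S ^ m`. -/
noncomputable def sizeSeq (S : ℝ) : ℕ → ℕ
  | 0 => 1
  | m + 1 => ⌊S * sizeSeq S m⌋₊ + 1

/-- The number of cities from which on blocks are larger than `m`. -/
def limitSeq : ℕ → ℕ
  | 0 => 1
  | m + 1 => limitSeq m * limitSeq m + 1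

/-- The union of the sets with numbers `x` in the lists with numbers `y`, one for each block. -/
def blockUnion (M c s L k x y : ℕ) : ℕ :=
  ∑ j ∈ Finset.range k, M ^ j * (c / M ^ (y / L ^ j % L * s + x / s ^ j % s) % M)

/-- Computes the block size in variable `1`, the length of lists in variable `3`, the base of the
code in variable `4`, and the number of orderings in variable `9`. -/
def paramProg : Program :=
  assign 1 (num 0) ;; assign 2 (num 1) ;; assign 3 (num 1) ;; assign 4 (num 1) ;;
  .while (.le (var 2) (var 0))
    (assign 5 (var 3) ;; .while (.leConst (var 5) (var 3)) (assign 5 (var 5 + num 1)) ;;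
     assign 3 (var 5) ;; assign 2 (var 2 * var 2 + num 1) ;; assign 4 (var 4 * num 2) ;;
     assign 1 (var 1 + num 1)) ;;
  assign 3 (var 3 * ((var 1 + num 1) * (var 1 + num 1))) ;;
  assign 9 (num 1) ;; assign 15 (num 0) ;;
  .while (.lt (var 15) (var 1)) (assign 9 (var 9 * var 1) ;; assign 15 (var 15 + num 1))

/-- Computes the number of blocks in variable `18`, the number of lists in variable `19`, the powers
of the length and of the number of lists in variables `20` and `21`, and the power of `2` in
variable `22`. -/
def sizesProg : Program :=
  assign 18 (var 0 / var 1 + num 1) ;; assign 19 (var 12 / var 3 + num 1) ;;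
  assign 20 (num 1) ;; assign 21 (num 1) ;; assign 25 (num 0) ;;
  .while (.lt (var 25) (var 18))
    (assign 20 (var 20 * var 3) ;; assign 21 (var 21 * var 19) ;; assign 25 (var 25 + num 1)) ;;
  assign 22 (num 1) ;; assign 29 (num 0) ;;
  .while (.lt (var 29) (var 0)) (assign 22 (var 22 * num 2) ;; assign 29 (var 29 + num 1))

/-- Computes `blockUnion` in variable `14`. -/
def unionProg : Program :=
  assign 14 (num 0) ;; assign 16 (num 1) ;; assign 26 (var 24) ;; assign 27 (var 23) ;;
  assign 25 (num 0) ;;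
  .while (.lt (var 25) (var 18))
    (assign 12 (var 27 % var 19 * var 3 + var 26 % var 3) ;; assign 11 (var 6) ;;
     assign 28 (num 0) ;;
     .while (.lt (var 28) (var 12)) (assign 11 (var 11 / var 4) ;; assign 28 (var 28 + num 1)) ;;
     assign 14 (var 14 + var 16 * (var 11 % var 4)) ;; assign 16 (var 16 * var 4) ;;
     assign 26 (var 26 / var 3) ;; assign 27 (var 27 / var 19) ;; assign 25 (var 25 + num 1))

/-! ### Correctness and step counts of the parameter computations -/

variable {S : ℝ} {n : ℕ} {d : Fin n → Fin n → ℝ} {B n' : ℕ} {R : Finset ℕ}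

lemma sizeSeq_le_floor (hS : 1 ≤ S) (m : ℕ) : sizeSeq S m ≤ ⌊S * sizeSeq S m⌋₊ :=
  Nat.le_floor (le_mul_of_one_le_left (Nat.cast_nonneg _) hS)

lemma sizeSeq_mono (hS : 1 ≤ S) : StrictMono (sizeSeq S) :=
  strictMono_nat_of_lt_succ fun m => Nat.lt_succ_of_le (sizeSeq_le_floor hS m)

lemma limitSeq_mono : StrictMono limitSeq :=
  strictMono_nat_of_lt_succ fun m => by
    rw [limitSeq]
    nlinarith [sq_nonneg (limitSeq m)]

/-- The block size comes from comparing n with `limitSeq`, without logarithms. As the constant S is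
available in tests only, the next term of `sizeSeq` is found by counting up from the previous term
until S times that term is exceeded. -/
lemma wp_paramProg {s : State} {m : ℕ} (h : Layout B n' R s) (hS : 1 ≤ S) (hm : 0 < m)
    (hB : m < B) (hm₁ : ∀ i < m, limitSeq i ≤ s.var 0) (hm₂ : s.var 0 < limitSeq m)
    (hq : limitSeq m < 2 ^ B) (hs : sizeSeq S m * ((m + 1) * (m + 1)) < 2 ^ B)
    (hP : m ^ m < 2 ^ B) :
    WP S d (Layout B n' R) paramProg (m * (2 * sizeSeq S m + 10) + 9)
      (fun s' => Layout B n' R s' ∧ Frame [1, 2, 3, 4, 5, 9, 15] s s' ∧ s'.var 1 = m ∧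
        s'.var 3 = sizeSeq S m * ((m + 1) * (m + 1)) ∧ s'.var 4 = 2 ^ m ∧ s'.var 9 = m ^ m) s := by
  have h1B : 1 < 2 ^ B := Nat.one_lt_two_pow (by omega)
  have hlt : ∀ j, j ≤ m → j < 2 ^ B := fun j hj => (hj.trans_lt hB).trans B.lt_two_pow_self
  have hs' : sizeSeq S m < 2 ^ B := lt_of_le_of_lt (Nat.le_mul_of_pos_right _ (by positivity)) hs
  refine .assign_seq h 0 rfl (by simp) (by positivity) fun h => ?_
  refine .assign_seq h 1 rfl (by simp) h1B fun h => ?_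
  refine .assign_seq h 1 rfl (by simp) h1B fun h => ?_
  refine .assign_seq h 1 rfl (by simp) h1B fun h => ?_
  refine .seq (m * (2 * sizeSeq S m + 7) + 1) (m * 3 + 4) (fun s' => Layout B n' R s' ∧
    Frame [1, 2, 3, 4, 5, 9, 15] s s' ∧ s'.var 1 = m ∧ s'.var 2 = limitSeq m ∧
    s'.var 3 = sizeSeq S m ∧ s'.var 4 = 2 ^ m) (by linarith) ?_ ?_
  · refine .whileLoop (fun i s' => Layout B n' R s' ∧ Frame [1, 2, 3, 4, 5, 9, 15] s s' ∧
      s'.var 1 = i ∧ s'.var 2 = limitSeq i ∧ s'.var 3 = sizeSeq S i ∧ s'.var 4 = 2 ^ i)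
      m (2 * sizeSeq S m + 6) le_rfl ⟨h, by simp [limitSeq, sizeSeq]⟩ ?_ ?_ fun _ hs => hs
    · rintro i hi s' ⟨h, hF, h1, h2, h3, h4⟩
      refine ⟨by simpa [h2, hF.var (k := 0)] using hm₁ i hi, ?_⟩
      have hsi : sizeSeq S (i + 1) ≤ sizeSeq S m := (sizeSeq_mono hS).monotone hi
      have hfl : ∀ a, a ≤ ⌊S * sizeSeq S i⌋₊ ↔ (a : ℝ) ≤ S * sizeSeq S i := fun a =>
        Nat.le_floor_iff (by positivity)
      have hle := sizeSeq_le_floor hS i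
      refine .assign_seq h (sizeSeq S i) (by simp [h3]) (by simp)
        (((sizeSeq_mono hS).monotone hi.le).trans_lt hs') fun h => ?_
      refine .seq (2 * sizeSeq S m + 1) 4 (fun s' => Layout B n' R s' ∧
        Frame [1, 2, 3, 4, 5, 9, 15] s s' ∧ s'.var 1 = i ∧ s'.var 2 = limitSeq i ∧
        s'.var 3 = sizeSeq S i ∧ s'.var 4 = 2 ^ i ∧ s'.var 5 = sizeSeq S (i + 1)) le_rfl ?_ ?_
      · refine .whileLoop (fun a s' => Layout B n' R s' ∧
          Frame [1, 2, 3, 4, 5, 9, 15] s s' ∧ s'.var 1 = i ∧ s'.var 2 = limitSeq i ∧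
          s'.var 3 = sizeSeq S i ∧ s'.var 4 = 2 ^ i ∧ s'.var 5 = sizeSeq S i + a)
          (sizeSeq S (i + 1) - sizeSeq S i) 1 (by omega) ⟨h, by simp [hF, h1, h2, h3, h4]⟩ ?_ ?_ ?_
        · rintro a ha s' ⟨h, hF, h1, h2, h3, h4, h5⟩
          rw [sizeSeq] at ha
          refine ⟨?_, .assign h (sizeSeq S i + (a + 1)) (by simp [h5, add_assoc]) (by simp)
            (lt_of_le_of_lt ?_ (hsi.trans_lt hs')) fun h => ⟨h, by simp [hF, h1, h2, h3, h4]⟩⟩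
          · simp only [holds_leConst, eval_var, h5, h3]
            exact (hfl _).1 (by omega)
          · rw [sizeSeq]; omega
        · rintro s' ⟨h, hF, h1, h2, h3, h4, h5⟩
          refine ⟨h, ?_⟩
          simp only [holds_leConst, eval_var, h5, h3]
          rw [← hfl, sizeSeq]
          omega
        · rintro s' ⟨h, hF, h1, h2, h3, h4, h5⟩
          refine ⟨h, hF, h1, h2, h3, h4, ?_⟩
          rw [h5, sizeSeq]
          omega
      · clear! s'
        rintro s' ⟨h, hF, h1, h2, h3, h4, h5⟩
        refine .assign_seq h (sizeSeq S (i + 1)) (by simp [h5]) (by simp)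
          (hsi.trans_lt hs') fun h => ?_
        refine .assign_seq h (limitSeq (i + 1)) (by simp [h2, limitSeq]) (by simp)
          ((limitSeq_mono.monotone hi).trans_lt hq) fun h => ?_
        refine .assign_seq h (2 ^ (i + 1)) (by simp [h4, pow_succ]) (by simp)
          (Nat.pow_lt_pow_right (by norm_num) (by omega)) fun h => ?_
        refine .assign h (i + 1) (by simp [h1]) (by simp) (hlt _ hi) fun h => ?_
        exact ⟨h, by simp [hF]⟩
    · rintro s' ⟨h, hF, h1, h2, h3, h4⟩
      simpa [h, h2, hF.var (k := 0)] using hm₂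
  · rintro s' ⟨h, hF, h1, h2, h3, h4⟩
    refine .assign_seq h _ rfl (by simp) (by simpa [h1, h3] using hs) fun h => ?_
    refine .assign_seq h 1 rfl (by simp) h1B fun h => ?_
    refine .assign_seq h 0 rfl (by simp) (by positivity) fun h => ?_
    refine .whileLoop (fun i s' => Layout B n' R s' ∧ Frame [1, 2, 3, 4, 5, 9, 15] s s' ∧
      s'.var 1 = m ∧ s'.var 3 = sizeSeq S m * ((m + 1) * (m + 1)) ∧ s'.var 4 = 2 ^ m ∧
      s'.var 9 = m ^ i ∧ s'.var 15 = i)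
      m 2 le_rfl ⟨h, by simp [hF, h1, h3, h4]⟩ ?_ ?_ ?_
    · clear! s'
      rintro i hi s' ⟨h, hF, h1, h3, h4, h9, h15⟩
      refine ⟨by simp [h1, h15, hi], ?_⟩
      refine .assign_seq h (m ^ (i + 1)) (by simp [h9, h1, pow_succ]) (by simp)
        ((Nat.pow_le_pow_right hm hi).trans_lt hP) fun h => ?_
      refine .assign h (i + 1) (by simp [h15]) (by simp) (hlt _ hi) fun h => ?_
      exact ⟨h, by simp [hF, h1, h3, h4]⟩
    · clear! s'
      rintro s' ⟨h, hF, h1, h3, h4, h9, h15⟩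
      simp [h, h1, h15]
    · clear! s'
      rintro s' ⟨h, hF, h1, h3, h4, h9, h15⟩
      exact ⟨h, hF, h1, h3, h4, h9⟩

lemma wp_sizesProg {s : State} {k L : ℕ} (h : Layout B n' R s) (hB : s.var 0 < B)
    (hk : k = s.var 0 / s.var 1 + 1) (hL : L = s.var 12 / s.var 3 + 1) (hs : 0 < s.var 3)
    (hkB : k < 2 ^ B) (hLB : L < 2 ^ B) (hX : s.var 3 ^ k < 2 ^ B) (hY : L ^ k < 2 ^ B) :
    WP S d (Layout B n' R) sizesProg (k * 4 + s.var 0 * 3 + 9)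
      (fun s' => Layout B n' R s' ∧ Frame [18, 19, 20, 21, 22, 25, 29] s s' ∧ s'.var 18 = k ∧
        s'.var 19 = L ∧ s'.var 20 = s.var 3 ^ k ∧ s'.var 21 = L ^ k ∧ s'.var 22 = 2 ^ s.var 0)
      s := by
  have h1B : 1 < 2 ^ B := Nat.one_lt_two_pow (by omega)
  refine .assign_seq h k (by simp [hk]) (by simp) hkB fun h => ?_
  refine .assign_seq h L (by simp [hL]) (by simp) hLB fun h => ?_
  refine .assign_seq h 1 rfl (by simp) h1B fun h => ?_
  refine .assign_seq h 1 rfl (by simp) h1B fun h => ?_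
  refine .assign_seq h 0 rfl (by simp) (by positivity) fun h => ?_
  refine .seq (k * 4 + 1) (s.var 0 * 3 + 3) (fun s' => Layout B n' R s' ∧
    Frame [18, 19, 20, 21, 22, 25, 29] s s' ∧ s'.var 18 = k ∧
    s'.var 19 = L ∧ s'.var 20 = s.var 3 ^ k ∧ s'.var 21 = L ^ k) (by omega) ?_ ?_
  · refine .whileLoop (fun i s' => Layout B n' R s' ∧
      Frame [18, 19, 20, 21, 22, 25, 29] s s' ∧ s'.var 18 = k ∧
      s'.var 19 = L ∧ s'.var 20 = s.var 3 ^ i ∧ s'.var 21 = L ^ i ∧ s'.var 25 = i) k 3 le_rfl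
      ⟨h, by simp⟩ ?_ ?_ ?_
    · rintro i hi s' ⟨h, hF, h18, h19, h20, h21, h25⟩
      refine ⟨by simp [h18, h25, hi], ?_⟩
      refine .assign_seq h (s.var 3 ^ (i + 1)) (by simp [h20, hF.var (k := 3), pow_succ]) (by simp)
        ((Nat.pow_le_pow_right hs hi).trans_lt hX) fun h => ?_
      refine .assign_seq h (L ^ (i + 1)) (by simp [h21, h19, pow_succ]) (by simp)
        ((Nat.pow_le_pow_right (hL ▸ Nat.succ_pos _) hi).trans_lt hY) fun h => ?_
      refine .assign h (i + 1) (by simp [h25]) (by simp)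
        ((Nat.succ_le_of_lt hi).trans_lt hkB) fun h => ?_
      exact ⟨h, by simp [hF, h18, h19]⟩
    · rintro s' ⟨h, hF, h18, h19, h20, h21, h25⟩
      simp [h, h18, h25]
    · rintro s' ⟨h, hF, h18, h19, h20, h21, h25⟩
      exact ⟨h, hF, h18, h19, h20, h21⟩
  · rintro s' ⟨h, hF, h18, h19, h20, h21⟩
    refine .assign_seq h 1 rfl (by simp) h1B fun h => ?_
    refine .assign_seq h 0 rfl (by simp) (by positivity) fun h => ?_
    refine .whileLoop (fun i s' => Layout B n' R s' ∧
      Frame [18, 19, 20, 21, 22, 25, 29] s s' ∧ s'.var 18 = k ∧ s'.var 19 = L ∧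
      s'.var 20 = s.var 3 ^ k ∧ s'.var 21 = L ^ k ∧ s'.var 22 = 2 ^ i ∧ s'.var 29 = i)
      (s.var 0) 2 le_rfl ⟨h, by simp [hF, h18, h19, h20, h21]⟩ ?_ ?_ ?_
    · clear! s'
      rintro i hi s' ⟨h, hF, h18, h19, h20, h21, h22, h29⟩
      refine ⟨by simp [h29, hF.var (k := 0), hi], ?_⟩
      refine .assign_seq h (2 ^ (i + 1)) (by simp [h22, pow_succ]) (by simp)
        (Nat.pow_lt_pow_right (by norm_num) (by omega)) fun h => ?_
      refine .assign h (i + 1) (by simp [h29]) (by simp)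
        ((show i + 1 < B by omega).trans B.lt_two_pow_self) fun h => ?_
      exact ⟨h, by simp [hF, h18, h19, h20, h21]⟩
    · clear! s'
      rintro s' ⟨h, hF, h18, h19, h20, h21, h22, h29⟩
      simp [h, h29, hF.var (k := 0)]
    · clear! s'
      rintro s' ⟨h, hF, h18, h19, h20, h21, h22, h29⟩
      exact ⟨h, hF, h18, h19, h20, h21, h22⟩

lemma blockUnion_lt {M : ℕ} (hM : 0 < M) (c s L k x y : ℕ) : blockUnion M c s L k x y < M ^ k := by
  induction k with
  | zero => simp [blockUnion]
  | succ k ih =>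
    rw [blockUnion] at ih ⊢
    rw [Finset.sum_range_succ, pow_succ]
    have := Nat.mod_lt (c / M ^ (y / L ^ k % L * s + x / s ^ k % s)) hM
    calc _ < M ^ k + M ^ k * (c / M ^ (y / L ^ k % L * s + x / s ^ k % s) % M) := by gcongr
      _ = M ^ k * (c / M ^ (y / L ^ k % L * s + x / s ^ k % s) % M + 1) := by ring
      _ ≤ M ^ k * M := by gcongr; omega

lemma mod_mul_add_mod_lt {L s : ℕ} (hL : 0 < L) (hs : 0 < s) (a b : ℕ) :
    a % L * s + b % s < L * s := by
  have h1 := Nat.mod_lt a hL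
  have h2 := Nat.mod_lt b hs
  nlinarith

/-- The digits of the two indices are peeled off by division. A digit of the code is reached by as
many divisions as its position says, which is less than the product of the number and the length of
the lists. -/
lemma wp_unionProg {s : State} (h : Layout B n' R s) (hM : 1 < s.var 4) (hs : 0 < s.var 3)
    (hL : 0 < s.var 19) (hMB : s.var 4 ^ s.var 18 < 2 ^ B) (hLB : s.var 19 * s.var 3 < 2 ^ B) :
    WP S d (Layout B n' R) unionProg (s.var 18 * (s.var 19 * s.var 3 * 3 + 10) + 6)
      (fun s' => Layout B n' R s' ∧ Frame [11, 12, 14, 16, 25, 26, 27, 28] s s' ∧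
        s'.var 14 = blockUnion (s.var 4) (s.var 6) (s.var 3) (s.var 19) (s.var 18) (s.var 24)
          (s.var 23)) s := by
  have hlt : ∀ j, j ≤ s.var 18 → j < 2 ^ B := fun j hj => hj.trans_lt (h.var_lt _)
  have hx := h.var_lt 24
  have hy := h.var_lt 23
  have hc := h.var_lt 6
  have h1B : 1 < 2 ^ B := (Nat.one_le_pow _ _ (by omega)).trans_lt hMB
  refine .assign_seq h 0 rfl (by simp) (by positivity) fun h => ?_
  refine .assign_seq h 1 rfl (by simp) h1B fun h => ?_
  refine .assign_seq h (s.var 24) (by simp) (by simp) hx fun h => ?_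
  refine .assign_seq h (s.var 23) (by simp) (by simp) hy fun h => ?_
  refine .assign_seq h 0 rfl (by simp) (by positivity) fun h => ?_
  refine .whileLoop (fun j s' => Layout B n' R s' ∧ Frame [11, 12, 14, 16, 25, 26, 27, 28] s s' ∧
    s'.var 14 = blockUnion (s.var 4) (s.var 6) (s.var 3) (s.var 19) j (s.var 24) (s.var 23) ∧
    s'.var 16 = s.var 4 ^ j ∧ s'.var 25 = j ∧ s'.var 26 = s.var 24 / s.var 3 ^ j ∧
    s'.var 27 = s.var 23 / s.var 19 ^ j) (s.var 18) (s.var 19 * s.var 3 * 3 + 9) (by rfl)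
    ⟨h, by simp [blockUnion]⟩ ?_ ?_ ?_
  · rintro j hj s' ⟨h, hF, h14, h16, h25, h26, h27⟩
    have hu := blockUnion_lt (by omega : 0 < s.var 4) (s.var 6) (s.var 3) (s.var 19) (j + 1)
      (s.var 24) (s.var 23)
    rw [blockUnion, Finset.sum_range_succ, ← blockUnion] at hu
    have hpow : s.var 4 ^ (j + 1) < 2 ^ B := (Nat.pow_le_pow_right (by omega) hj).trans_lt hMB
    set t := s.var 23 / s.var 19 ^ j % s.var 19 * s.var 3 + s.var 24 / s.var 3 ^ j % s.var 3 with ht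
    have htlt : t < s.var 19 * s.var 3 := mod_mul_add_mod_lt hL hs _ _
    refine ⟨by simp [h25, hF.var (k := 18), hj], ?_⟩
    refine .assign_seq h t (by simp [h26, h27, hF.var (k := 3), hF.var (k := 19), ht]) (by simp)
      (by omega) fun h => ?_
    refine .assign_seq h (s.var 6) (by simp [hF.var (k := 6)]) (by simp) hc fun h => ?_
    refine .assign_seq h 0 rfl (by simp) (by positivity) fun h => ?_
    refine .seq (s.var 19 * s.var 3 * 3 + 1) 5 (fun s' => Layout B n' R s' ∧
      Frame [11, 12, 14, 16, 25, 26, 27, 28] s s' ∧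
      s'.var 14 = blockUnion (s.var 4) (s.var 6) (s.var 3) (s.var 19) j (s.var 24) (s.var 23) ∧
      s'.var 16 = s.var 4 ^ j ∧ s'.var 25 = j ∧ s'.var 26 = s.var 24 / s.var 3 ^ j ∧
      s'.var 27 = s.var 23 / s.var 19 ^ j ∧ s'.var 11 = s.var 6 / s.var 4 ^ t) (by omega) ?_ ?_
    · refine .whileLoop (fun f s' => Layout B n' R s' ∧
        Frame [11, 12, 14, 16, 25, 26, 27, 28] s s' ∧
        s'.var 14 = blockUnion (s.var 4) (s.var 6) (s.var 3) (s.var 19) j (s.var 24) (s.var 23) ∧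
        s'.var 16 = s.var 4 ^ j ∧ s'.var 25 = j ∧ s'.var 26 = s.var 24 / s.var 3 ^ j ∧
        s'.var 27 = s.var 23 / s.var 19 ^ j ∧ s'.var 12 = t ∧ s'.var 11 = s.var 6 / s.var 4 ^ f ∧
        s'.var 28 = f) t 2 (by omega) ⟨h, by simp [hF, h14, h16, h25, h26, h27]⟩ ?_ ?_ ?_
      · clear! s'
        rintro f hf s' ⟨h, hF, h14, h16, h25, h26, h27, h12, h11, h28⟩
        refine ⟨by simp [h12, h28, hf], ?_⟩
        refine .assign_seq h (s.var 6 / s.var 4 ^ (f + 1))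
          (by simp [h11, hF.var (k := 4), Nat.div_div_eq_div_mul, pow_succ]) (by simp)
          ((Nat.div_le_self _ _).trans_lt hc) fun h => ?_
        refine .assign h (f + 1) (by simp [h28]) (by simp) (by omega) fun h => ?_
        exact ⟨h, by simp [hF, h14, h16, h25, h26, h27, h12]⟩
      · clear! s'
        rintro s' ⟨h, hF, h14, h16, h25, h26, h27, h12, h11, h28⟩
        simp [h, h12, h28]
      · clear! s'
        rintro s' ⟨h, hF, h14, h16, h25, h26, h27, h12, h11, h28⟩
        exact ⟨h, hF, h14, h16, h25, h26, h27, h11⟩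
    · clear! s'
      rintro s' ⟨h, hF, h14, h16, h25, h26, h27, h11⟩
      refine .assign_seq h (blockUnion (s.var 4) (s.var 6) (s.var 3) (s.var 19) (j + 1) (s.var 24)
        (s.var 23)) ?_ (by simp) ?_ fun h => ?_
      · simp [blockUnion, Finset.sum_range_succ, h14, h16, h11, hF.var (k := 4), ht]
      · rw [blockUnion, Finset.sum_range_succ, ← blockUnion]
        exact hu.trans hpow
      refine .assign_seq h (s.var 4 ^ (j + 1)) (by simp [h16, hF.var (k := 4), pow_succ]) (by simp)
        hpow fun h => ?_
      refine .assign_seq h (s.var 24 / s.var 3 ^ (j + 1))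
        (by simp [h26, hF.var (k := 3), Nat.div_div_eq_div_mul, pow_succ]) (by simp)
        ((Nat.div_le_self _ _).trans_lt hx) fun h => ?_
      refine .assign_seq h (s.var 23 / s.var 19 ^ (j + 1))
        (by simp [h27, hF.var (k := 19), Nat.div_div_eq_div_mul, pow_succ]) (by simp)
        ((Nat.div_le_self _ _).trans_lt hy) fun h => ?_
      refine .assign h (j + 1) (by simp [h25]) (by simp) (hlt _ hj) fun h => ?_
      exact ⟨h, by simp [hF]⟩
  · rintro s' ⟨h, hF, h14, h16, h25, h26, h27⟩
    simp [h, h25, hF.var (k := 18)]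
  · rintro s' ⟨h, hF, h14, h16, h25, h26, h27⟩
    exact ⟨h, hF, h14⟩

end TSP

namespace TSP

/-! ## Dynamic programming over a product of lists of sets -/

/-- The test entry for a set and a city, given by the expressions for the bit mask and the city. -/
def presentAt (A v : IntExpr) : IntExpr := .get 40 (A * var 0 + v)

/-- The table entry for a set and a city. -/
def entryAt (A v : IntExpr) : WeightExpr := .get 0 (A * var 0 + v)

/-- Extends the paths through the set `32` that end in the city `31` by the city `29`. -/
def relaxEntryProg : Program :=
  .ite (.eq (presentAt (var 32) (var 31)) (num 1))
    (.ite (.and (.eq (presentAt (var 14) (var 29)) (num 1))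
        (.leWeight (entryAt (var 14) (var 29))
          (.add (entryAt (var 32) (var 31)) (.dist (var 31) (var 29)))))
      .skip
      (.setInt 40 (var 14 * var 0 + var 29) (num 1) ;;
       .setWeight 0 (var 14 * var 0 + var 29)
        (.add (entryAt (var 32) (var 31)) (.dist (var 31) (var 29)))))
    .skip

/-- Computes the table entries for the set `14` and all its cities. -/
def relaxSetProg : Program :=
  assign 29 (num 0) ;; assign 30 (num 1) ;;
  .while (.lt (var 29) (var 0))
    (.ite (.eq (var 14 / var 30 % num 2) (num 1))
      (assign 32 (var 14 - var 30) ;; assign 31 (num 0) ;;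
       .while (.lt (var 31) (var 0)) (relaxEntryProg ;; assign 31 (var 31 + num 1)))
      .skip ;;
     assign 29 (var 29 + num 1) ;; assign 30 (var 30 * num 2))

/-- Clears the table entries for the set `14`, unless it contains all cities. -/
def clearSetProg : Program :=
  .ite (.eq (var 14 + num 1) (var 22)) .skip
    (assign 29 (num 0) ;;
     .while (.lt (var 29) (var 0))
      (.setInt 40 (var 14 * var 0 + var 29) (num 0) ;;
       .setWeight 0 (var 14 * var 0 + var 29) .zero ;;
       assign 29 (var 29 + num 1)))

/-- One round of the dynamic program. -/
def roundProg : Program :=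
  .setInt 40 (num 0) (num 1) ;; .setWeight 0 (num 0) .zero ;;
  assign 24 (num 0) ;;
  .while (.lt (var 24) (var 20)) (unionProg ;; relaxSetProg ;; assign 24 (var 24 + num 1)) ;;
  assign 24 (num 0) ;;
  .while (.lt (var 24) (var 20)) (unionProg ;; clearSetProg ;; assign 24 (var 24 + num 1)) ;;
  assign 23 (var 23 + num 1)

/-- Runs the dynamic program for all choices of lists. -/
def dpProg : Program :=
  assign 23 (num 0) ;;
  .while (.lt (var 23) (var 21)) roundProg ;;
  .setWeight 0 (num 0) (entryAt (var 22 - num 1) (num 0))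

/-! ### Bit masks, soundness of the table, and relaxation -/

variable {S : ℝ} {n : ℕ} {d : Fin n → Fin n → ℝ} {B : ℕ} {R : Finset ℕ}

lemma sum_two_pow_lt {I : Finset ℕ} {m : ℕ} (h : ∀ e ∈ I, e < m) : ∑ e ∈ I, 2 ^ e < 2 ^ m := by
  have := sum_ite_two_pow_lt m (· ∈ I)
  rwa [← Finset.sum_filter, Finset.filter_mem_eq_inter,
    Finset.inter_eq_right.2 fun e he => Finset.mem_range.2 (h e he)] at this

/-- Elements above v contribute a multiple of 2^(v + 1) and those below v sum to less than 2^v, so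
only the summand of v decides. -/
lemma sum_two_pow_div_mod {I : Finset ℕ} (v : ℕ) :
    (∑ e ∈ I, 2 ^ e) / 2 ^ v % 2 = 1 ↔ v ∈ I := by
  have hlow : ∑ e ∈ I.filter (· < v), 2 ^ e < 2 ^ v := sum_two_pow_lt (by simp)
  have hhigh : 2 ^ (v + 1) ∣ ∑ e ∈ I.filter (v < ·), 2 ^ e :=
    Finset.dvd_sum fun e he => pow_dvd_pow 2 (Finset.mem_filter.1 he).2
  obtain ⟨q, hq⟩ := hhigh
  have hsplit : ∑ e ∈ I, 2 ^ e = ∑ e ∈ I.filter (· < v), 2 ^ e + 2 ^ v * (if v ∈ I then 1 else 0) +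
      2 ^ v * (2 * q) := by
    have h1 : 2 ^ v * (2 * q) = ∑ e ∈ I.filter (v < ·), 2 ^ e := by rw [hq]; ring
    have h2 : 2 ^ v * (if v ∈ I then 1 else 0) = ∑ e ∈ I.filter (v = ·), 2 ^ e := by
      rw [Finset.filter_eq]
      split_ifs <;> simp
    rw [h1, h2, Finset.sum_filter, Finset.sum_filter, Finset.sum_filter, ← Finset.sum_add_distrib,
      ← Finset.sum_add_distrib]
    refine Finset.sum_congr rfl fun e _ => ?_
    rcases lt_trichotomy e v with h | rfl | h
    · simp [h, h.ne', h.not_gt]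
    · simp
    · simp [h, h.ne, h.not_gt]
  rw [hsplit, add_assoc, ← mul_add, Nat.add_mul_div_left _ _ (by positivity),
    Nat.div_eq_of_lt hlow]
  split_ifs with h <;> simp [h]

/-- If bit v of A is one, subtracting 2^v clears it without a borrow. -/
lemma sum_two_pow_sub {I : Finset ℕ} {A v : ℕ} (hA : A / 2 ^ v % 2 = 1)
    (hI : ∑ e ∈ I, 2 ^ e = A - 2 ^ v) : v ∉ I ∧ 2 ^ v ≤ A := by
  have h1 : 0 < A / 2 ^ v := Nat.pos_of_ne_zero fun h => by simp [h] at hA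
  have h2 : 2 ^ v ≤ A := (Nat.div_pos_iff.1 h1).2
  refine ⟨?_, h2⟩
  rw [← sum_two_pow_div_mod, hI]
  have h3 := Nat.sub_mul_div A (2 ^ v) 1
  rw [mul_one] at h3
  omega

/-- `w` is the length of a path from city `0` through the set of cities with bit mask `A`, whose last
city is `v`, together with its number of steps. City `0` may be visited again once. -/
def IsPath (d : Fin n → Fin n → ℝ) (A v : ℕ) (w : ℝ × ℕ) : Prop :=
  ∃ a : ℕ → Fin n, (a 0 : ℕ) = 0 ∧ Set.InjOn a (Finset.Icc 1 w.2) ∧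
    ∑ i ∈ Finset.Icc 1 w.2, 2 ^ (a i : ℕ) = A ∧ (a w.2 : ℕ) = v ∧
    w.1 = ∑ i ∈ Finset.range w.2, d (a i) (a (i + 1))

lemma IsPath.length_le {A v : ℕ} {w : ℝ × ℕ} (h : IsPath d A v w) : w.2 ≤ n := by
  obtain ⟨a, -, ha, -⟩ := h
  have := Finset.card_le_card_of_injOn (s := Finset.Icc 1 w.2) (t := Finset.univ) a (by simp) ha
  simpa using this

lemma isPath_zero (hn : 0 < n) : IsPath d 0 0 0 :=
  ⟨fun _ => ⟨0, hn⟩, rfl, by simp, by simp, rfl, by simp⟩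

/-- By the bit condition v belongs to A and not to the set of the shorter path, so the cities from
step 1 on stay distinct. The start is exempt from injectivity, which permits the return to city 0.
-/
lemma IsPath.extend {A u : ℕ} {w : ℝ × ℕ} {v : Fin n} (hA : A / 2 ^ (v : ℕ) % 2 = 1)
    (h : IsPath d (A - 2 ^ (v : ℕ)) u w) (hu : u < n) :
    IsPath d A v (w + (d ⟨u, hu⟩ v, 1)) := by
  classical
  obtain ⟨a, h0, hinj, hsum, hlast, hlen⟩ := h
  have hsum' : ∑ e ∈ (Finset.Icc 1 w.2).image fun i => (a i : ℕ), 2 ^ e = A - 2 ^ (v : ℕ) := by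
    rw [Finset.sum_image (fun i hi j hj hij => hinj hi hj (Fin.ext hij)), hsum]
  obtain ⟨hv, hle⟩ := sum_two_pow_sub hA hsum'
  have hne : ∀ i ∈ Finset.Icc 1 w.2, a i ≠ v := fun i hi h =>
    hv (Finset.mem_image.2 ⟨i, hi, by rw [h]⟩)
  have hupd : ∀ i ≤ w.2, Function.update a (w.2 + 1) v i = a i := fun i hi =>
    Function.update_of_ne (by omega) _ _
  have hIcc : Finset.Icc 1 (w.2 + 1) = insert (w.2 + 1) (Finset.Icc 1 w.2) := by
    ext i; simp only [Finset.mem_Icc, Finset.mem_insert]; omega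
  refine ⟨Function.update a (w.2 + 1) v, ?_, ?_, ?_, ?_, ?_⟩
  · rw [hupd 0 (by omega), h0]
  · change Set.InjOn _ (↑(Finset.Icc 1 (w.2 + 1)) : Set ℕ)
    rw [hIcc, Finset.coe_insert, Set.injOn_insert (by simp)]
    constructor
    · intro i hi j hj hij
      rw [hupd i (Finset.mem_Icc.1 hi).2, hupd j (Finset.mem_Icc.1 hj).2] at hij
      exact hinj hi hj hij
    · rintro ⟨i, hi, h⟩
      rw [hupd i (Finset.mem_Icc.1 hi).2, Function.update_self] at h
      exact hne i hi h
  · change ∑ i ∈ Finset.Icc 1 (w.2 + 1), _ = A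
    rw [hIcc, Finset.sum_insert (by simp), Function.update_self,
      Finset.sum_congr rfl fun i hi => by rw [hupd i (Finset.mem_Icc.1 hi).2], hsum]
    omega
  · simp
  · change w.1 + d ⟨u, hu⟩ v = ∑ i ∈ Finset.range (w.2 + 1), _
    rw [Finset.sum_range_succ, hlen, Function.update_self, hupd w.2 le_rfl]
    have : a w.2 = ⟨u, hu⟩ := Fin.ext hlast
    rw [this]
    congr 1
    refine Finset.sum_congr rfl fun i hi => ?_
    have hi := Finset.mem_range.1 hi
    rw [hupd i hi.le, hupd (i + 1) hi]

/-- All table entries are lengths of paths, and the tests are `0` or `1`. -/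
def Sound (d : Fin n → Fin n → ℝ) (s : State) : Prop :=
  ∀ A v, v < n → s.ints (40, A * n + v) = 0 ∨
    s.ints (40, A * n + v) = 1 ∧ IsPath d A v (s.weights (0, A * n + v))

/-- The table entry at `a` is present and at most `x`. -/
def Has (s : State) (a : ℕ) (x : ℝ) : Prop := s.ints (40, a) = 1 ∧ (s.weights (0, a)).1 ≤ x

lemma Has.congr {s s' : State} {a : ℕ} {x : ℝ} (h : Has s a x) (h1 : s'.ints (40, a) = s.ints (40, a))
    (h2 : s'.weights (0, a) = s.weights (0, a)) : Has s' a x := by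
  rwa [Has, h1, h2]

lemma Sound.congr {s s' : State} (h : Sound d s) (h1 : ∀ a, s'.ints (40, a) = s.ints (40, a))
    (h2 : s'.weights = s.weights) : Sound d s' := by
  simpa only [Sound, h1, h2] using h

lemma mul_add_inj {A A' v v' : ℕ} (hv : v < n) (hv' : v' < n) :
    A * n + v = A' * n + v' ↔ A = A' ∧ v = v' := by
  refine ⟨fun h => ?_, by rintro ⟨rfl, rfl⟩; rfl⟩
  have hn : 0 < n := by omega
  have h1 := congrArg (· / n) h
  have h2 := congrArg (· % n) h
  simp only [Nat.mul_comm _ n, Nat.mul_add_div hn, Nat.div_eq_of_lt hv, Nat.div_eq_of_lt hv',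
    Nat.mul_add_mod, Nat.mod_eq_of_lt hv, Nat.mod_eq_of_lt hv'] at h1 h2
  exact ⟨by simpa using h1, h2⟩

lemma Sound.set {s : State} {A v : ℕ} {w : ℝ × ℕ} {b : ℕ} (h : Sound d s) (hv : v < n)
    (hb : b = 0 ∨ b = 1 ∧ IsPath d A v w) :
    Sound d ((s.setInt 40 (A * n + v) b).setWeight 0 (A * n + v) w) := by
  intro A' v' hv'
  rw [State.ints_setWeight, State.ints_setInt, State.weights_setWeight, State.weights_setInt]
  simp only [true_and, mul_add_inj hv' hv]
  split_ifs with h'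
  · obtain ⟨rfl, rfl⟩ := h'
    exact hb
  · exact h A' v' hv'

lemma Layout.setInt {n' : ℕ} {s : State} (h : Layout B n' R s) {a v : ℕ} (ha : a ∈ R)
    (hv : v < 2 ^ B) : Layout B n' R (s.setInt 40 a v) where
  lt := by
    rintro ⟨k', a⟩
    rw [State.ints_setInt]
    split_ifs
    exacts [hv, h.lt _]
  ints := by
    intro k' a
    rw [State.ints_setInt]
    split_ifs with h'
    · exact fun _ => .inr ⟨h'.1, h'.2 ▸ ha⟩
    · exact h.ints k' a
  weights := h.weights
  count := h.count

lemma Layout.setWeight {n' : ℕ} {s : State} (h : Layout B n' R s) {a : ℕ} {w : ℝ × ℕ}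
    (ha : a ∈ R) (hw : w.2 ≤ n') : Layout B n' R (s.setWeight 0 a w) where
  lt := h.lt
  ints := h.ints
  weights := by
    intro k' a
    rw [State.weights_setWeight]
    split_ifs with h'
    · exact fun _ => ⟨h'.1, h'.2 ▸ ha⟩
    · exact h.weights k' a
  count := by
    rintro ⟨k', a⟩
    rw [State.weights_setWeight]
    split_ifs
    exacts [hw, h.count _]

@[simp] lemma State.var_setInt (s : State) (a v k : ℕ) (hk : k ≠ 40) :
    (s.setInt 40 a v).var k = s.var k := by
  rw [State.var, State.ints_setInt, if_neg (by tauto), State.var]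

@[simp] lemma State.var_setWeight (s : State) (a : ℕ) (w : ℝ × ℕ) (k : ℕ) :
    (s.setWeight 0 a w).var k = s.var k := rfl

/-- The dynamic program needs three things: entries stay lengths of paths, entries neither vanish
nor grow, and the target is at most the predecessor plus the distance, whether or not it is
overwritten. -/
lemma wp_relaxEntryProg {s : State} (h : Layout B n R s) (hs : Sound d s) (h0 : s.var 0 = n)
    (hu : s.var 31 < n) (hv : s.var 29 < n) (hA : s.var 14 / 2 ^ s.var 29 % 2 = 1)
    (hA' : s.var 32 = s.var 14 - 2 ^ s.var 29) (hR : s.var 14 * n + s.var 29 ∈ R) :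
    WP S d (Layout B n R) relaxEntryProg 4
      (fun s' => Layout B n R s' ∧ Sound d s' ∧ IntFrame [40] s s' ∧
        (∀ a x, Has s a x → Has s' a x) ∧
        ∀ x, Has s (s.var 32 * n + s.var 31) x →
          Has s' (s.var 14 * n + s.var 29) (x + d ⟨s.var 31, hu⟩ ⟨s.var 29, hv⟩)) s := by
  -- For `B = 0` variable `0`, and thus n, would vanish. Positivity is needed to store the value 1.
  have hB : 0 < B := by
    rcases Nat.eq_zero_or_pos B with rfl | hB
    · have := h.var_lt 0
      simp at this
      omega
    · exact hB
  have eP : ∀ A v : IntExpr, (presentAt A v).eval s = s.ints (40, A.eval s * n + v.eval s) :=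
    fun A v => by rw [← h0]; rfl
  have eE : ∀ A v : IntExpr, (entryAt A v).eval d s = s.weights (0, A.eval s * n + v.eval s) :=
    fun A v => by
      change s.weights (0, A.eval s * s.var 0 + v.eval s) = _
      rw [h0]
  have eD : (WeightExpr.dist (var 31) (var 29)).eval d s =
      (d ⟨s.var 31, hu⟩ ⟨s.var 29, hv⟩, 1) := by
    exact dif_pos (⟨hu, hv⟩ : s.var 31 < n ∧ s.var 29 < n)
  refine .ite ?_ ?_
  · intro hb
    simp only [holds_eq, eP, eval_var, eval_num] at hb
    have hpath : IsPath d (s.var 32) (s.var 31) (s.weights (0, s.var 32 * n + s.var 31)) := by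
      rcases hs (s.var 32) (s.var 31) hu with h' | h'
      · omega
      · exact h'.2
    rw [hA'] at hpath
    have hnew := IsPath.extend (v := ⟨s.var 29, hv⟩) hA hpath hu
    rw [← hA'] at hnew
    refine .ite ?_ ?_
    · rintro ⟨hb1, hb2⟩
      simp only [holds_eq, eP, eval_var, eval_num] at hb1
      simp only [Test.Holds, WeightExpr.eval.eq_4, eE, eD, eval_var, Prod.fst_add] at hb2
      refine .skip h ⟨h, hs, by simp, fun a x hx => hx, fun x hx => ⟨hb1, hb2.trans ?_⟩⟩
      have := hx.2
      linarith
    · intro hb'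
      have hb' : ¬ (s.ints (40, s.var 14 * n + s.var 29) = 1 ∧
          (s.weights (0, s.var 14 * n + s.var 29)).1 ≤
          (s.weights (0, s.var 32 * n + s.var 31)).1 + d ⟨s.var 31, hu⟩ ⟨s.var 29, hv⟩) := by
        simpa only [holds_and, holds_eq, eP, eval_var, eval_num, Test.Holds, WeightExpr.eval.eq_4,
          eE, eD, Prod.fst_add] using hb'
      have h1 := h.setInt hR (Nat.one_lt_two_pow hB.ne')
      refine .setInt_seq (s.var 14 * n + s.var 29) 1 (by simp [h0]) rfl h h1 ?_
      have hw : (WeightExpr.add (entryAt (var 32) (var 31)) (.dist (var 31) (var 29))).eval d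
          (s.setInt 40 (s.var 14 * n + s.var 29) 1) =
          s.weights (0, s.var 32 * n + s.var 31) + (d ⟨s.var 31, hu⟩ ⟨s.var 29, hv⟩, 1) := by
        have e1 : ∀ k, k ≠ 40 → _ := State.var_setInt s (s.var 14 * n + s.var 29) 1
        rw [WeightExpr.eval.eq_4, ← eD, ← eval_var s 32, ← eval_var s 31, ← eE]
        simp only [WeightExpr.eval, entryAt, eval_add, eval_mul, eval_var, State.weights_setInt,
          e1 0 (by simp), e1 29 (by simp), e1 31 (by simp), e1 32 (by simp)]
        rfl
      refine .setWeight (s.var 14 * n + s.var 29) _ (by simp [h0]) hw h1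
        (h1.setWeight hR hnew.length_le) ⟨h1.setWeight hR hnew.length_le, hs.set hv (.inr ⟨rfl, hnew⟩),
          by simp, fun a x hx => ?_, fun x hx => ⟨?_, ?_⟩⟩
      · rw [Has, State.ints_setWeight, State.ints_setInt, State.weights_setWeight,
          State.weights_setInt]
        simp only [true_and]
        split_ifs with ha
        · subst ha
          refine ⟨rfl, ?_⟩
          have := hx.2
          -- A present entry is overwritten only by a smaller value.
          have h2 := not_le.1 fun h' => hb' ⟨hx.1, h'⟩
          simp only [Prod.fst_add]
          linarith
        · exact hx
      · simp [State.ints_setInt]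
      · have := hx.2
        simp only [State.weights_setWeight, and_self, if_true, Prod.fst_add]
        linarith
  · intro hb
    simp only [holds_eq, eP, eval_var, eval_num] at hb
    exact .skip h ⟨h, hs, by simp, fun a x hx => hx, fun x hx => absurd hx.1 hb⟩

/-- The predecessors are those present before the call. Since entries only improve during the loops,
they are still usable when their turn comes. -/
lemma wp_relaxSetProg {s : State} (h : Layout B n R s) (hs : Sound d s) (h0 : s.var 0 = n)
    (hB : n < B) (hR : ∀ v < n, s.var 14 * n + v ∈ R) :
    WP S d (Layout B n R) relaxSetProg (n * (n * 6 + 7) + 3)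
      (fun s' => Layout B n R s' ∧ Sound d s' ∧ IntFrame [29, 30, 31, 32, 40] s s' ∧
        (∀ a x, Has s a x → Has s' a x) ∧
        ∀ u v : Fin n, s.var 14 / 2 ^ (v : ℕ) % 2 = 1 → ∀ x,
          Has s ((s.var 14 - 2 ^ (v : ℕ)) * n + u) x → Has s' (s.var 14 * n + v) (x + d u v)) s := by
  have hlt : ∀ j, j ≤ n → j < 2 ^ B := fun j hj => (hj.trans_lt hB).trans B.lt_two_pow_self
  have hpow : ∀ j, j ≤ n → 2 ^ j < 2 ^ B := fun j hj =>
    Nat.pow_lt_pow_right (by norm_num) (by omega)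
  have hA := h.var_lt 14
  have hcongr : ∀ s' k v, k ≠ 40 → Sound d s' → Sound d (s'.setVar k v) := fun s' k v hk hs' =>
    hs'.congr (fun a => by rw [State.setVar, State.ints_setInt, if_neg (by tauto)]) rfl
  have hHas : ∀ s' k v a x, k ≠ 40 → Has s' a x → Has (s'.setVar k v) a x :=
    fun s' k v a x hk hs' => hs'.congr
      (by rw [State.setVar, State.ints_setInt, if_neg (by tauto)]) rfl
  refine .assign_seq h 0 rfl (by simp) (by positivity) fun h => ?_
  refine .assign_seq h 1 rfl (by simp) (hpow 0 (by simp)) fun h => ?_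
  refine .whileLoop (fun v s' => Layout B n R s' ∧ Sound d s' ∧
    IntFrame [29, 30, 31, 32, 40] s s' ∧ s'.var 29 = v ∧ s'.var 30 = 2 ^ v ∧
    (∀ a x, Has s a x → Has s' a x) ∧
    ∀ u v' : Fin n, v' < v → s.var 14 / 2 ^ (v' : ℕ) % 2 = 1 → ∀ x,
      Has s ((s.var 14 - 2 ^ (v' : ℕ)) * n + u) x → Has s' (s.var 14 * n + v') (x + d u v'))
    n (n * 6 + 6) le_rfl ?_ ?_ ?_ ?_
  · exact ⟨h, hcongr _ _ _ (by simp) (hcongr _ _ _ (by simp) hs), by simp, by simp, by simp,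
      fun a x hx => hHas _ _ _ _ _ (by simp) (hHas _ _ _ _ _ (by simp) hx), by simp⟩
  · rintro v hv s' ⟨h, hs', hF, h29, h30, hmono, hnew⟩
    have e0 : s'.var 0 = n := (hF.var (by simp)).trans h0
    have e14 := hF.var (k := 14) (by simp)
    refine ⟨by simp [h29, e0, hv], ?_⟩
    refine .seq (n * 6 + 4) 2 (fun s' => Layout B n R s' ∧ Sound d s' ∧
      IntFrame [29, 30, 31, 32, 40] s s' ∧ s'.var 29 = v ∧ s'.var 30 = 2 ^ v ∧
      (∀ a x, Has s a x → Has s' a x) ∧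
      ∀ u v' : Fin n, v' < v + 1 → s.var 14 / 2 ^ (v' : ℕ) % 2 = 1 → ∀ x,
        Has s ((s.var 14 - 2 ^ (v' : ℕ)) * n + u) x → Has s' (s.var 14 * n + v') (x + d u v'))
      le_rfl (.ite ?_ ?_) ?_
    · intro hb
      simp only [holds_eq, eval_mod, eval_div, eval_var, eval_num, e14, h30] at hb
      refine .assign_seq h (s.var 14 - 2 ^ v) (by simp [e14, h30]) (by simp)
        ((Nat.sub_le _ _).trans_lt hA) fun h => ?_
      refine .assign_seq h 0 rfl (by simp) (by positivity) fun h => ?_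
      refine .whileLoop (fun u s' => Layout B n R s' ∧ Sound d s' ∧
        IntFrame [29, 30, 31, 32, 40] s s' ∧ s'.var 29 = v ∧ s'.var 30 = 2 ^ v ∧
        s'.var 32 = s.var 14 - 2 ^ v ∧ s'.var 31 = u ∧
        (∀ a x, Has s a x → Has s' a x) ∧
        (∀ u v' : Fin n, v' < v → s.var 14 / 2 ^ (v' : ℕ) % 2 = 1 → ∀ x,
          Has s ((s.var 14 - 2 ^ (v' : ℕ)) * n + u) x → Has s' (s.var 14 * n + v') (x + d u v')) ∧
        (∀ u' : Fin n, u' < u → ∀ x, Has s ((s.var 14 - 2 ^ v) * n + u') x →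
          Has s' (s.var 14 * n + v) (x + d u' ⟨v, hv⟩)))
        n 5 (by omega) ?_ ?_ ?_ ?_
      · exact ⟨h, hcongr _ _ _ (by simp) (hcongr _ _ _ (by simp) hs'), by simp [hF], by simp [h29],
          by simp [h30], by simp, by simp,
          fun a x hx => hHas _ _ _ _ _ (by simp) (hHas _ _ _ _ _ (by simp) (hmono a x hx)),
          fun u v' hv' hbit x hx => hHas _ _ _ _ _ (by simp)
            (hHas _ _ _ _ _ (by simp) (hnew u v' hv' hbit x hx)), by simp⟩
      · clear! s'
        rintro u hu s' ⟨h, hs', hF, h29, h30, h32, h31, hmono, hnew, hnew'⟩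
        have e0 : s'.var 0 = n := (hF.var (by simp)).trans h0
        have e14 := hF.var (k := 14) (by simp)
        refine ⟨by simp [h31, e0, hu], ?_⟩
        have hentry := wp_relaxEntryProg (S := S) h hs' e0 (by rwa [h31]) (by rwa [h29])
          (by rwa [e14, h29]) (by rw [h32, e14, h29]) (by rw [e14, h29]; exact hR v hv)
        refine .seq 4 1 _ le_rfl hentry ?_
        rintro s'' ⟨h', hs'', hF', hmono', hnew''⟩
        simp only [h29, h31, h32, e14] at hnew''
        refine .assign h' (u + 1) (by simp [hF'.var (k := 31), h31]) (by simp) (hlt _ hu)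
          fun h => ⟨h, hcongr _ _ _ (by simp) hs'', ?_, ?_, ?_, ?_, ?_, ?_, ?_, ?_⟩
        · simp only [List.mem_cons, Nat.reduceEqDiff, true_or, or_true, intFrame_setVar]
          exact hF.trans fun k hk a => hF' k (by aesop) a
        · simp [hF'.var (k := 29), h29]
        · simp [hF'.var (k := 30), h30]
        · simp [hF'.var (k := 32), h32]
        · simp
        · exact fun a x hx => hHas _ _ _ _ _ (by simp) (hmono' a x (hmono a x hx))
        · exact fun u v' hv' hbit x hx => hHas _ _ _ _ _ (by simp)
            (hmono' _ _ (hnew u v' hv' hbit x hx))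
        · intro u' hu' x hx
          refine hHas _ _ _ _ _ (by simp) ?_
          rcases Nat.lt_succ_iff_lt_or_eq.1 hu' with hu' | rfl
          · exact hmono' _ _ (hnew' u' hu' x hx)
          · exact hnew'' x (hmono _ x hx)
      · clear! s'
        rintro s' ⟨h, hs', hF, h29, h30, h32, h31, hmono, hnew, hnew'⟩
        have e0 : s'.var 0 = n := (hF.var (by simp)).trans h0
        simp [h, h31, e0]
      · clear! s'
        rintro s' ⟨h, hs', hF, h29, h30, h32, h31, hmono, hnew, hnew'⟩
        refine ⟨h, hs', hF, h29, h30, hmono, fun u v' hv' hbit x hx => ?_⟩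
        rcases Nat.lt_succ_iff_lt_or_eq.1 hv' with hv' | rfl
        · exact hnew u v' hv' hbit x hx
        · exact hnew' u u.2 x hx
    · intro hb
      simp only [holds_eq, eval_mod, eval_div, eval_var, eval_num, e14, h30] at hb
      refine .skip h ⟨h, hs', hF, h29, h30, hmono, fun u v' hv' hbit x hx => ?_⟩
      rcases Nat.lt_succ_iff_lt_or_eq.1 hv' with hv' | rfl
      · exact hnew u v' hv' hbit x hx
      · exact absurd hbit hb
    · clear! s'
      rintro s' ⟨h, hs', hF, h29, h30, hmono, hnew⟩
      refine .assign_seq h (v + 1) (by simp [h29]) (by simp) (hlt _ hv) fun h => ?_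
      refine .assign h (2 ^ (v + 1)) (by simp [h30, pow_succ]) (by simp) (hpow _ hv) fun h => ?_
      exact ⟨h, hcongr _ _ _ (by simp) (hcongr _ _ _ (by simp) hs'), by simp [hF], by simp,
        by simp, fun a x hx => hHas _ _ _ _ _ (by simp) (hHas _ _ _ _ _ (by simp) (hmono a x hx)),
        fun u v' hv' hbit x hx => hHas _ _ _ _ _ (by simp)
          (hHas _ _ _ _ _ (by simp) (hnew u v' hv' hbit x hx))⟩
  · rintro s' ⟨h, hs', hF, h29, h30, hmono, hnew⟩
    have e0 : s'.var 0 = n := (hF.var (by simp)).trans h0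
    simp [h, h29, e0]
  · rintro s' ⟨h, hs', hF, h29, h30, hmono, hnew⟩
    exact ⟨h, hs', hF, hmono, fun u v => hnew u v v.2⟩

end TSP

namespace TSP

/-! ### Clearing of sets, and the two passes of a round -/

variable {S : ℝ} {n : ℕ} {d : Fin n → Fin n → ℝ} {B : ℕ} {R : Finset ℕ}

lemma Sound.setVar {s : State} (h : Sound d s) {k v : ℕ} (hk : k ≠ 40) : Sound d (s.setVar k v) :=
  h.congr (fun a => by rw [State.setVar, State.ints_setInt, if_neg (by tauto)]) rfl

lemma State.table_setVar (s : State) {k v : ℕ} (hk : k ≠ 40) (a : ℕ) :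
    (s.setVar k v).ints (40, a) = s.ints (40, a) := by
  rw [State.setVar, State.ints_setInt, if_neg (by tauto)]

lemma Has.setVar {s : State} {a : ℕ} {x : ℝ} (h : Has s a x) {k v : ℕ} (hk : k ≠ 40) :
    Has (s.setVar k v) a x :=
  h.congr (s.table_setVar hk a) rfl

lemma Has.frame {l : List ℕ} {s s' : State} {a : ℕ} {x : ℝ} (h : Has s a x) (hF : Frame l s s')
    (hl : 40 ∉ l) : Has s' a x :=
  h.congr (hF.ints 40 hl a) (by rw [hF.weights])

lemma Sound.frame {l : List ℕ} {s s' : State} (h : Sound d s) (hF : Frame l s s')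
    (hl : 40 ∉ l) : Sound d s' :=
  h.congr (hF.ints 40 hl) hF.weights

/-- The table cell at `a` is empty. -/
def Clear (s : State) (a : ℕ) : Prop := s.ints (40, a) = 0 ∧ s.weights (0, a) = 0

/-- The table cells at `a` of two memory contents agree. -/
def SameCell (s s' : State) (a : ℕ) : Prop :=
  s'.ints (40, a) = s.ints (40, a) ∧ s'.weights (0, a) = s.weights (0, a)

lemma SameCell.trans {s s' s'' : State} {a : ℕ} (h : SameCell s s' a) (h' : SameCell s' s'' a) :
    SameCell s s'' a := ⟨h'.1.trans h.1, h'.2.trans h.2⟩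

lemma Clear.same {s s' : State} {a : ℕ} (h : Clear s a) (h' : SameCell s s' a) : Clear s' a :=
  ⟨h'.1.trans h.1, h'.2.trans h.2⟩

lemma Frame.sameCell {l : List ℕ} {s s' : State} (hF : Frame l s s') (hl : 40 ∉ l) (a : ℕ) :
    SameCell s s' a := ⟨hF.ints 40 hl a, by rw [hF.weights]⟩

lemma sameCell_setVar (s : State) {k v : ℕ} (hk : k ≠ 40) (a : ℕ) : SameCell s (s.setVar k v) a :=
  ⟨s.table_setVar hk a, rfl⟩

/-- The full set is spared because its cells carry the best tour from round to round. That every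
cell is unchanged or empty keeps the work of earlier clearings. -/
lemma wp_clearSetProg {s : State} (h : Layout B n R s) (hs : Sound d s) (h0 : s.var 0 = n)
    (h22 : s.var 22 = 2 ^ n) (hB : n < B) (hR : ∀ v < n, s.var 14 * n + v ∈ R) :
    WP S d (Layout B n R) clearSetProg (n * 4 + 3)
      (fun s' => Layout B n R s' ∧ Sound d s' ∧ IntFrame [29, 40] s s' ∧
        (∀ a, SameCell s s' a ∨ Clear s' a) ∧
        (∀ v < n, SameCell s s' ((2 ^ n - 1) * n + v)) ∧
        (s.var 14 + 1 ≠ 2 ^ n → ∀ v < n, Clear s' (s.var 14 * n + v))) s := by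
  refine .ite ?_ ?_
  · intro hb
    simp only [holds_eq, eval_add, eval_var, eval_num, h22] at hb
    exact .skip h ⟨h, hs, by simp, fun a => .inl ⟨rfl, rfl⟩, fun v _ => ⟨rfl, rfl⟩,
      fun h => absurd hb h⟩
  · intro hb
    simp only [holds_eq, eval_add, eval_var, eval_num, h22] at hb
    refine .assign_seq h 0 rfl (by simp) (by positivity) fun h => ?_
    refine .whileLoop (fun v s' => Layout B n R s' ∧ Sound d s' ∧ IntFrame [29, 40] s s' ∧
      s'.var 29 = v ∧ (∀ a, SameCell s s' a ∨ Clear s' a) ∧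
      (∀ v < n, SameCell s s' ((2 ^ n - 1) * n + v)) ∧ (∀ v' < v, Clear s' (s.var 14 * n + v')))
      n 3 le_rfl ?_ ?_ ?_ ?_
    · exact ⟨h, hs.setVar (by simp), by simp, by simp, fun a => .inl (sameCell_setVar s (by simp) a),
        fun v _ => sameCell_setVar s (by simp) _, by simp⟩
    · rintro v hv s' ⟨h, hs', hF, h29, hsame, hfull, hclear⟩
      have e0 : s'.var 0 = n := (hF.var (by simp)).trans h0
      have e14 := hF.var (k := 14) (by simp)
      refine ⟨by simp [h29, e0, hv], ?_⟩
      have h1 := h.setInt (hR v hv) (v := 0) (by positivity)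
      have h2 := h1.setWeight (hR v hv) (w := 0) (by simp)
      refine .setInt_seq (s.var 14 * n + v) 0 (by simp [h29, e14, e0]) rfl h h1 ?_
      refine .setWeight_seq (s.var 14 * n + v) 0 (by simp [h29, e14, e0]) rfl h1 h2 ?_
      have hsound := hs'.set (A := s.var 14) (w := 0) (b := 0) hv (.inl rfl)
      have hcell : ∀ a, if a = s.var 14 * n + v then
          Clear ((s'.setInt 40 (s.var 14 * n + v) 0).setWeight 0 (s.var 14 * n + v) 0) a else
          SameCell s' ((s'.setInt 40 (s.var 14 * n + v) 0).setWeight 0 (s.var 14 * n + v) 0) a := by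
        intro a
        split_ifs with ha
        · subst ha
          exact ⟨by simp [State.ints_setInt], by simp [State.weights_setWeight]⟩
        · exact ⟨by simp [State.ints_setInt, ha], by simp [State.weights_setWeight, ha]⟩
      have hF2 : IntFrame [29, 40] s
          ((s'.setInt 40 (s.var 14 * n + v) 0).setWeight 0 (s.var 14 * n + v) 0) := by
        simp [hF]
      have h29' : ((s'.setInt 40 (s.var 14 * n + v) 0).setWeight 0 (s.var 14 * n + v) 0).var 29 =
          v := by simp [h29]
      generalize (s'.setInt 40 (s.var 14 * n + v) 0).setWeight 0 (s.var 14 * n + v) 0 = t at *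
      refine .assign h2 (v + 1) (by simp [h29']) (by simp)
        ((show v + 1 < B by omega).trans B.lt_two_pow_self)
        fun h => ⟨h, hsound.setVar (by simp), by simp [hF2], by simp, ?_, ?_, ?_⟩
      · intro a
        have := hcell a
        split_ifs at this with ha
        · exact .inr (this.same (sameCell_setVar t (by simp) a))
        · have h3 := this.trans (sameCell_setVar t (k := 29) (v := v + 1) (by simp) a)
          exact (hsame a).imp (·.trans h3) (·.same h3)
      · intro v' hv'
        have := hcell ((2 ^ n - 1) * n + v')
        rw [if_neg] at this
        · exact ((hfull v' hv').trans this).trans (sameCell_setVar t (by simp) _)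
        -- Different sets have different addresses, and in this branch the cleared set is not the
        -- full one.
        · rw [mul_add_inj hv' hv]
          have := Nat.one_le_two_pow (n := n)
          omega
      · intro v' hv'
        have := hcell (s.var 14 * n + v')
        split_ifs at this with ha
        · exact this.same (sameCell_setVar t (by simp) _)
        · have h3 := this.trans (sameCell_setVar t (k := 29) (v := v + 1) (by simp) _)
          refine (hclear v' (lt_of_le_of_ne (by omega) ?_)).same h3
          rintro rfl
          exact ha rfl
    · rintro s' ⟨h, hs', hF, h29, hsame, hfull, hclear⟩
      have e0 : s'.var 0 = n := (hF.var (by simp)).trans h0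
      simp [h, h29, e0]
    · rintro s' ⟨h, hs', hF, h29, hsame, hfull, hclear⟩
      exact ⟨h, hs', hF, hsame, hfull, fun _ => hclear⟩

/-- The sets with numbers `pos 1 < pos 2 < ⋯` in the enumeration `U` are the sets of the first cities
of the tour `a`. -/
structure Follows (U : ℕ → ℕ) (a : ℕ → Fin n) (pos : ℕ → ℕ) : Prop where
  zero : (a 0 : ℕ) = 0
  inj : Set.InjOn a (Set.Icc 1 n)
  mono : StrictMonoOn pos (Set.Icc 1 n)
  eq : ∀ i, 1 ≤ i → i ≤ n → U (pos i) = ∑ j ∈ Finset.Icc 1 i, 2 ^ (a j : ℕ)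

lemma sum_Icc_succ (f : ℕ → ℕ) (i : ℕ) :
    ∑ j ∈ Finset.Icc 1 (i + 1), f j = ∑ j ∈ Finset.Icc 1 i, f j + f (i + 1) :=
  Finset.sum_Icc_succ_top (by omega) f

lemma Follows.bit {U : ℕ → ℕ} {a : ℕ → Fin n} {pos : ℕ → ℕ} (h : Follows U a pos) {i : ℕ}
    (hi : i + 1 ≤ n) : U (pos (i + 1)) / 2 ^ (a (i + 1) : ℕ) % 2 = 1 := by
  rw [h.eq (i + 1) (by omega) hi, ← Finset.sum_image (s := Finset.Icc 1 (i + 1))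
    (g := fun j => (a j : ℕ)) (f := fun e => 2 ^ e), sum_two_pow_div_mod]
  · exact Finset.mem_image.2 ⟨i + 1, by simp, rfl⟩
  · intro j hj k hk hjk
    simp only [Finset.coe_Icc, Set.mem_Icc] at hj hk
    exact h.inj ⟨hj.1, by omega⟩ ⟨hk.1, by omega⟩ (Fin.ext hjk)

/-- The scalar variables that hold the parameters of the dynamic program. -/
structure Ready (B n : ℕ) (s : State) : Prop where
  n_lt : n < B
  v0 : s.var 0 = n
  v22 : s.var 22 = 2 ^ n
  base : 1 < s.var 4
  len : 0 < s.var 3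
  num : 0 < s.var 19
  pow_lt : s.var 4 ^ s.var 18 < 2 ^ B
  mul_lt : s.var 19 * s.var 3 < 2 ^ B

lemma Ready.frame {l : List ℕ} {s s' : State} (h : Ready B n s) (hF : IntFrame l s s')
    (hl : 0 ∉ l ∧ 22 ∉ l ∧ 4 ∉ l ∧ 3 ∉ l ∧ 19 ∉ l ∧ 18 ∉ l) : Ready B n s' := by
  obtain ⟨h1, h2, h3, h4, h5, h6, h7, h8⟩ := h
  obtain ⟨l0, l22, l4, l3, l19, l18⟩ := hl
  constructor <;> simpa only [hF.var l0, hF.var l22, hF.var l4, hF.var l3, hF.var l19, hF.var l18]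

/-- The enumeration of unions of blocks for the choice `y` of lists. -/
noncomputable def unionAt (s : State) (y x : ℕ) : ℕ :=
  blockUnion (s.var 4) (s.var 6) (s.var 3) (s.var 19) (s.var 18) x y

lemma unionAt_frame {l : List ℕ} {s s' : State} (hF : IntFrame l s s')
    (hl : 4 ∉ l ∧ 6 ∉ l ∧ 3 ∉ l ∧ 19 ∉ l ∧ 18 ∉ l) : unionAt s' = unionAt s := by
  obtain ⟨l4, l6, l3, l19, l18⟩ := hl
  funext y x
  simp only [unionAt, hF.var l4, hF.var l6, hF.var l3, hF.var l19, hF.var l18]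

/-- A bound on the number of steps of `unionProg`. -/
noncomputable def unionSteps (s : State) : ℕ :=
  s.var 18 * (s.var 19 * s.var 3 * 3 + 10) + 6

lemma unionSteps_frame {l : List ℕ} {s s' : State} (hF : IntFrame l s s')
    (hl : 3 ∉ l ∧ 19 ∉ l ∧ 18 ∉ l) : unionSteps s' = unionSteps s := by
  obtain ⟨l3, l19, l18⟩ := hl
  simp only [unionSteps, hF.var l3, hF.var l19, hF.var l18]

/-- Induction on the number of processed sets. When the prefix of length i + 1 comes up, that of
length i has a smaller position and an entry already, which is then extended. Sets off the chain and
repeated sets do no harm, because entries only improve. -/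
lemma wp_relaxAll {s : State} {y : ℕ} (h : Layout B n R s) (hs : Sound d s) (hr : Ready B n s)
    (h23 : s.var 23 = y) (h24 : s.var 24 = 0)
    (hR : ∀ x < s.var 20, ∀ v < n, unionAt s y x * n + v ∈ R) (h0 : Has s 0 0) :
    WP S d (Layout B n R)
      (.while (.lt (var 24) (var 20)) (unionProg ;; relaxSetProg ;; assign 24 (var 24 + num 1)))
      (s.var 20 * (unionSteps s + (n * (n * 6 + 7) + 5)) + 1)
      (fun s' => Layout B n R s' ∧ Sound d s' ∧
        IntFrame [11, 12, 14, 16, 24, 25, 26, 27, 28, 29, 30, 31, 32, 40] s s' ∧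
        (∀ a x, Has s a x → Has s' a x) ∧
        ∀ a pos, Follows (unionAt s y) a pos → ∀ i ≤ n, (∀ j, 1 ≤ j → j ≤ i → pos j < s.var 20) →
          Has s' ((∑ j ∈ Finset.Icc 1 i, 2 ^ (a j : ℕ)) * n + a i)
            (∑ j ∈ Finset.range i, d (a j) (a (j + 1)))) s := by
  refine .whileLoop (fun x s' => Layout B n R s' ∧ Sound d s' ∧
    IntFrame [11, 12, 14, 16, 24, 25, 26, 27, 28, 29, 30, 31, 32, 40] s s' ∧ s'.var 24 = x ∧
    (∀ a x, Has s a x → Has s' a x) ∧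
    ∀ a pos, Follows (unionAt s y) a pos → ∀ i ≤ n, (∀ j, 1 ≤ j → j ≤ i → pos j < x) →
      Has s' ((∑ j ∈ Finset.Icc 1 i, 2 ^ (a j : ℕ)) * n + a i)
        (∑ j ∈ Finset.range i, d (a j) (a (j + 1)))) (s.var 20)
    (unionSteps s + (n * (n * 6 + 7) + 4)) le_rfl ?_ ?_ ?_ ?_
  · refine ⟨h, hs, by simp, h24, fun a x hx => hx, fun a pos hf i hi hpos => ?_⟩
    rcases Nat.eq_zero_or_pos i with rfl | hi'
    · simpa [hf.zero] using h0
    · exact absurd (hpos i hi' le_rfl) (by simp)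
  · rintro x hx s' ⟨h, hs', hF, h24, hmono, hnew⟩
    have hr' := hr.frame hF (by simp)
    refine ⟨by simp [h24, hF.var (k := 20), hx], ?_⟩
    have hunion := wp_unionProg (S := S) (d := d) h hr'.base hr'.len hr'.num hr'.pow_lt hr'.mul_lt
    rw [← unionSteps, unionSteps_frame hF (by simp), ← unionAt, unionAt_frame hF (by simp), h24,
      hF.var (k := 23) (by simp), h23] at hunion
    refine .seq (unionSteps s) (n * (n * 6 + 7) + 4) _ le_rfl hunion ?_
    rintro s'' ⟨h', hF', h14⟩
    have hr'' := hr'.frame hF'.ints (by simp)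
    have hrelax := wp_relaxSetProg (S := S) h' (hs'.frame hF' (by simp)) hr''.v0 hr.n_lt
      (by rw [h14]; exact hR x hx)
    rw [h14] at hrelax
    refine .seq (n * (n * 6 + 7) + 3) 1 _ le_rfl hrelax ?_
    rintro s₃ ⟨h₃, hs₃, hF₃, hmono₃, hnew₃⟩
    refine .assign h₃ (x + 1)
      (by simp [hF₃.var (k := 24), hF'.var (k := 24), h24]) (by simp)
      ((Nat.succ_le_of_lt hx).trans_lt (hF.var (k := 20) (by simp) ▸ h.var_lt 20))
      fun h => ⟨h, hs₃.setVar (by simp), ?_, by simp, ?_, ?_⟩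
    · simp only [List.mem_cons, Nat.reduceEqDiff, true_or, or_true, intFrame_setVar]
      exact (hF.trans (hF'.intFrame (by simp))).trans (hF₃.mono (by simp))
    · exact fun a x hx => (hmono₃ a x ((hmono a x hx).frame hF' (by simp))).setVar (by simp)
    · intro a pos hf i hi hpos
      refine Has.setVar ?_ (by simp)
      by_cases hlast : ∀ j, 1 ≤ j → j ≤ i → pos j < x
      · exact hmono₃ _ _ ((hnew a pos hf i hi hlast).frame hF' (by simp))
      push Not at hlast
      obtain ⟨j, hj1, hji, hjx⟩ := hlast
      -- Positions increase along the tour, so only the last prefix can be the set just processed.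
      obtain rfl : j = i := by
        by_contra hne
        have h1 := hf.mono ⟨hj1, hji.trans hi⟩ ⟨hj1.trans hji, hi⟩ (lt_of_le_of_ne hji hne)
        have h2 := hpos i (hj1.trans hji) le_rfl
        omega
      have hjx' : pos j = x := by have := hpos j hj1 le_rfl; omega
      obtain ⟨i, rfl⟩ : ∃ i, j = i + 1 := ⟨j - 1, by omega⟩
      have hprev := (hnew a pos hf i (by omega) fun j' h1 h2 => by
        have := hf.mono ⟨h1, by omega⟩ ⟨hj1, hi⟩ (show j' < i + 1 by omega)
        omega).frame hF' (by simp)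
      have hbit := hf.bit hi
      have heq := hf.eq (i + 1) hj1 hi
      rw [sum_Icc_succ] at heq
      have := hnew₃ (a i) (a (i + 1)) (by rwa [hjx'] at hbit)
        (∑ j ∈ Finset.range i, d (a j) (a (j + 1)))
        (by rw [← hjx', heq, Nat.add_sub_cancel]; exact hprev)
      rwa [Finset.sum_range_succ, sum_Icc_succ, ← heq, hjx']
  · rintro s' ⟨h, hs', hF, h24, hmono, hnew⟩
    simp [h, h24, hF.var (k := 20)]
  · rintro s' ⟨h, hs', hF, h24, hmono, hnew⟩
    exact ⟨h, hs', hF, hmono, hnew⟩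

/-- The sets are enumerated a second time instead of being stored, and clearing one set never
refills a cell of another. -/
lemma wp_clearAll {s : State} {y : ℕ} (h : Layout B n R s) (hs : Sound d s) (hr : Ready B n s)
    (h23 : s.var 23 = y) (h24 : s.var 24 = 0)
    (hR : ∀ x < s.var 20, ∀ v < n, unionAt s y x * n + v ∈ R) :
    WP S d (Layout B n R)
      (.while (.lt (var 24) (var 20)) (unionProg ;; clearSetProg ;; assign 24 (var 24 + num 1)))
      (s.var 20 * (unionSteps s + (n * 4 + 5)) + 1)
      (fun s' => Layout B n R s' ∧ Sound d s' ∧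
        IntFrame [11, 12, 14, 16, 24, 25, 26, 27, 28, 29, 30, 31, 32, 40] s s' ∧
        (∀ v < n, SameCell s s' ((2 ^ n - 1) * n + v)) ∧
        (∀ x < s.var 20, unionAt s y x + 1 ≠ 2 ^ n → ∀ v < n, Clear s' (unionAt s y x * n + v)))
      s := by
  refine .whileLoop (fun x s' => Layout B n R s' ∧ Sound d s' ∧
    IntFrame [11, 12, 14, 16, 24, 25, 26, 27, 28, 29, 30, 31, 32, 40] s s' ∧ s'.var 24 = x ∧
    (∀ v < n, SameCell s s' ((2 ^ n - 1) * n + v)) ∧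
    (∀ x' < x, unionAt s y x' + 1 ≠ 2 ^ n → ∀ v < n, Clear s' (unionAt s y x' * n + v)))
    (s.var 20) (unionSteps s + (n * 4 + 4)) le_rfl ?_ ?_ ?_ ?_
  · exact ⟨h, hs, by simp, h24, fun v _ => ⟨rfl, rfl⟩, by simp⟩
  · rintro x hx s' ⟨h, hs', hF, h24, hfull, hclear⟩
    have hr' := hr.frame hF (by simp)
    refine ⟨by simp [h24, hF.var (k := 20), hx], ?_⟩
    have hunion := wp_unionProg (S := S) (d := d) h hr'.base hr'.len hr'.num hr'.pow_lt hr'.mul_lt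
    rw [← unionSteps, unionSteps_frame hF (by simp), ← unionAt, unionAt_frame hF (by simp), h24,
      hF.var (k := 23) (by simp), h23] at hunion
    refine .seq (unionSteps s) (n * 4 + 4) _ le_rfl hunion ?_
    rintro s'' ⟨h', hF', h14⟩
    have hr'' := hr'.frame hF'.ints (by simp)
    have hclr := wp_clearSetProg (S := S) h' (hs'.frame hF' (by simp)) hr''.v0 hr''.v22 hr.n_lt
      (by rw [h14]; exact hR x hx)
    rw [h14] at hclr
    refine .seq (n * 4 + 3) 1 _ le_rfl hclr ?_
    rintro s₃ ⟨h₃, hs₃, hF₃, hsame₃, hfull₃, hclear₃⟩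
    refine .assign h₃ (x + 1)
      (by simp [hF₃.var (k := 24), hF'.var (k := 24), h24]) (by simp)
      ((Nat.succ_le_of_lt hx).trans_lt (hF.var (k := 20) (by simp) ▸ h.var_lt 20))
      fun h => ⟨h, hs₃.setVar (by simp), ?_, by simp, ?_, ?_⟩
    · simp only [List.mem_cons, Nat.reduceEqDiff, true_or, or_true, intFrame_setVar]
      exact (hF.trans (hF'.intFrame (by simp))).trans (hF₃.mono (by simp))
    · exact fun v hv => (((hfull v hv).trans (hF'.sameCell (by simp) _)).trans
        (hfull₃ v hv)).trans (sameCell_setVar _ (by simp) _)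
    · intro x' hx' hne v hv
      refine Clear.same ?_ (sameCell_setVar _ (by simp) _)
      rcases Nat.lt_succ_iff_lt_or_eq.1 hx' with hx' | rfl
      · have h1 := (hclear x' hx' hne v hv).same (hF'.sameCell (by simp) _)
        exact (hsame₃ _).elim h1.same id
      · exact hclear₃ hne v hv
  · rintro s' ⟨h, hs', hF, h24, hfull, hclear⟩
    simp [h, h24, hF.var (k := 20)]
  · rintro s' ⟨h, hs', hF, h24, hfull, hclear⟩
    exact ⟨h, hs', hF, hfull, hclear⟩

end TSP

namespace TSP

/-! ### One round and all rounds of the dynamic program -/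

variable {S : ℝ} {n : ℕ} {d : Fin n → Fin n → ℝ} {B : ℕ} {R : Finset ℕ}

/-- The cells that are kept between two rounds of the dynamic program. -/
def keptCells (n : ℕ) : Finset ℕ :=
  insert 0 ((Finset.range n).image fun v => (2 ^ n - 1) * n + v)

/-- The cells that are used in round `y` of the dynamic program. -/
noncomputable def roundCells (n : ℕ) (s : State) (y : ℕ) : Finset ℕ :=
  keptCells n ∪ (Finset.range (s.var 20) ×ˢ Finset.range n).image fun p => unionAt s y p.1 * n + p.2

/-- The memory layout during the dynamic program. -/
def DPLayout (B n X : ℕ) (s : State) : Prop :=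
  ∃ R : Finset ℕ, Layout B n R s ∧ R.card ≤ X * n + n + 1 ∧ ∀ a ∈ R, a < 2 ^ B * (n + 1)

lemma mul_add_lt_of_lt {A v : ℕ} (hA : A < 2 ^ B) (hv : v < n) : A * n + v < 2 ^ B * (n + 1) := by
  nlinarith

lemma card_keptCells_le (n : ℕ) : (keptCells n).card ≤ n + 1 :=
  (Finset.card_insert_le _ _).trans (by simpa using Finset.card_image_le (s := Finset.range n))

lemma lt_of_mem_keptCells {a : ℕ} (hB : n < B) (ha : a ∈ keptCells n) : a < 2 ^ B * (n + 1) := by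
  simp only [keptCells, Finset.mem_insert, Finset.mem_image, Finset.mem_range] at ha
  rcases ha with rfl | ⟨v, hv, rfl⟩
  · positivity
  · exact mul_add_lt_of_lt ((Nat.sub_le _ _).trans_lt (Nat.pow_lt_pow_right (by norm_num) hB)) hv

lemma Layout.dpLayout_kept {X : ℕ} {s : State} (h : Layout B n (keptCells n) s) (hB : n < B) :
    DPLayout B n X s :=
  ⟨_, h, (card_keptCells_le n).trans (by omega), fun _ => lt_of_mem_keptCells hB⟩

lemma Layout.dpLayout_round {s s₀ : State} {y : ℕ} (h : Layout B n (roundCells n s₀ y) s)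
    (hr : Ready B n s₀) : DPLayout B n (s₀.var 20) s := by
  refine ⟨_, h, ?_, fun a ha => ?_⟩
  · refine (Finset.card_union_le _ _).trans ?_
    have h1 := card_keptCells_le n
    have h2 := Finset.card_image_le (s := Finset.range (s₀.var 20) ×ˢ Finset.range n)
      (f := fun p => unionAt s₀ y p.1 * n + p.2)
    simp only [Finset.card_product, Finset.card_range] at h2
    omega
  · rcases Finset.mem_union.1 ha with ha | ha
    · exact lt_of_mem_keptCells hr.n_lt ha
    · simp only [Finset.mem_image, Finset.mem_product, Finset.mem_range, Prod.exists] at ha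
      obtain ⟨x, v, ⟨-, hv⟩, rfl⟩ := ha
      exact mul_add_lt_of_lt ((blockUnion_lt (by have := hr.base; omega) _ _ _ _ _ _).trans
        hr.pow_lt) hv

/-- If all cells outside of `R'` are clear, then the layout is that of `R'`. -/
lemma Layout.restrict {R R' : Finset ℕ} {s : State} (h : Layout B n R s)
    (hc : ∀ a ∈ R, a ∉ R' → Clear s a) : Layout B n R' s where
  lt := h.lt
  ints k a hka := (h.ints k a hka).imp_right fun h' => by
    refine ⟨h'.1, by_contra fun ha => hka ?_⟩
    rw [h'.1]
    exact (hc a h'.2 ha).1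
  weights k a hka := by
    have h' := h.weights k a hka
    refine ⟨h'.1, by_contra fun ha => hka ?_⟩
    rw [h'.1]
    exact (hc a h'.2 ha).2
  count := h.count

/-- The variables that are changed in one round. -/
def roundVars : List ℕ := [11, 12, 14, 16, 23, 24, 25, 26, 27, 28, 29, 30, 31, 32, 40]

/-- Between rounds the table is empty outside of cell 0 and the full set, so the space is that of
one enumeration and not of the union of all. The base entry is written anew in each round, as the
clearing pass may have removed it. -/
lemma wp_roundProg {s : State} {y : ℕ} (hn : 0 < n) (h : Layout B n (keptCells n) s)
    (hs : Sound d s) (hr : Ready B n s) (h23 : s.var 23 = y) (hy : y + 1 < 2 ^ B) :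
    WP S d (Layout B n (roundCells n s y)) roundProg
      (2 * (s.var 20 * (unionSteps s + (n * (n * 6 + 7) + 5)) + 1) + 5)
      (fun s' => Layout B n (keptCells n) s' ∧ Sound d s' ∧ IntFrame roundVars s s' ∧
        s'.var 23 = y + 1 ∧ (∀ x, Has s ((2 ^ n - 1) * n) x → Has s' ((2 ^ n - 1) * n) x) ∧
        ∀ a pos, Follows (unionAt s y) a pos → (∀ i, 1 ≤ i → i ≤ n → pos i < s.var 20) →
          (a n : ℕ) = 0 → ∑ j ∈ Finset.Icc 1 n, 2 ^ (a j : ℕ) = 2 ^ n - 1 →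
          Has s' ((2 ^ n - 1) * n) (∑ j ∈ Finset.range n, d (a j) (a (j + 1)))) s := by
  have hn1 := hr.n_lt
  have hfull : 1 ≤ 2 ^ n - 1 := by
    have := Nat.pow_le_pow_right (show 0 < 2 by norm_num) hn
    omega
  -- Writing the base entry at address 0 must not destroy the best tour found so far.
  have hfull0 : (2 ^ n - 1) * n ≠ 0 := (Nat.mul_pos (by omega) hn).ne'
  replace h : Layout B n (roundCells n s y) s := h.mono Finset.subset_union_left
  have h0R : 0 ∈ roundCells n s y := Finset.mem_union_left _ (Finset.mem_insert_self _ _)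
  have hR : ∀ x < s.var 20, ∀ v < n, unionAt s y x * n + v ∈ roundCells n s y := fun x hx v hv =>
    Finset.mem_union_right _ (Finset.mem_image.2 ⟨(x, v), by simp [hx, hv], rfl⟩)
  have h1 := h.setInt h0R (v := 1) (Nat.one_lt_two_pow (by omega))
  have h2 := h1.setWeight h0R (w := 0) (by simp)
  refine .setInt_seq 0 1 rfl rfl h h1 ?_
  refine .setWeight_seq 0 0 rfl rfl h1 h2 ?_
  have hs2 : Sound d ((s.setInt 40 0 1).setWeight 0 0 0) := by
    simpa using hs.set (A := 0) (v := 0) (w := 0) (b := 1) hn (.inr ⟨rfl, isPath_zero hn⟩)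
  have hbase : Has ((s.setInt 40 0 1).setWeight 0 0 0) 0 0 :=
    ⟨by simp [State.ints_setInt], by simp [State.weights_setWeight]⟩
  have hmono : ∀ x, Has s ((2 ^ n - 1) * n) x →
      Has ((s.setInt 40 0 1).setWeight 0 0 0) ((2 ^ n - 1) * n) x := fun x hx =>
    hx.congr (by simp [State.ints_setInt, -mul_eq_zero, hfull0])
      (by simp [State.weights_setWeight, -mul_eq_zero, hfull0])
  have hF : IntFrame [11, 12, 14, 16, 24, 25, 26, 27, 28, 29, 30, 31, 32, 40] s
      ((s.setInt 40 0 1).setWeight 0 0 0) := by simp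
  generalize (s.setInt 40 0 1).setWeight 0 0 0 = s₁ at *
  refine .assign_seq h2 0 rfl (by simp) (by positivity) fun h => ?_
  replace hbase := hbase.setVar (k := 24) (v := 0) (by simp)
  replace hmono := fun x hx => (hmono x hx).setVar (k := 24) (v := 0) (by simp)
  replace hs2 := hs2.setVar (k := 24) (v := 0) (by simp)
  replace hF : IntFrame [11, 12, 14, 16, 24, 25, 26, 27, 28, 29, 30, 31, 32, 40] s
    (s₁.setVar 24 0) := by simp [hF]
  have h24 : (s₁.setVar 24 0).var 24 = 0 := by simp
  generalize s₁.setVar 24 0 = s₂ at *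
  have hr2 := hr.frame hF (by simp)
  have hrelax := wp_relaxAll (S := S) h hs2 hr2 (y := y) (by rw [hF.var (by simp), h23]) h24
    (by rw [unionAt_frame hF (by simp), hF.var (by simp)]; exact hR) hbase
  rw [hF.var (k := 20) (by simp), unionSteps_frame hF (by simp), unionAt_frame hF (by simp)]
    at hrelax
  refine .seq _ (s.var 20 * (unionSteps s + (n * (n * 6 + 7) + 5)) + 1 + 2) _ (by linarith)
    hrelax ?_
  rintro s₃ ⟨h3, hs3, hF3, hmono3, hnew⟩
  replace hF3 := hF.trans hF3
  refine .assign_seq h3 0 rfl (by simp) (by positivity) fun h4 => ?_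
  have hs4 := hs3.setVar (k := 24) (v := 0) (by simp)
  have hF4 : IntFrame [11, 12, 14, 16, 24, 25, 26, 27, 28, 29, 30, 31, 32, 40] s
    (s₃.setVar 24 0) := by simp [hF3]
  have h24 : (s₃.setVar 24 0).var 24 = 0 := by simp
  have hmono4 := fun a x hx => (hmono3 a x hx).setVar (k := 24) (v := 0) (by simp)
  have hnew4 := fun a pos hf hpos => (hnew a pos hf n le_rfl hpos).setVar (k := 24) (v := 0)
    (by simp)
  generalize s₃.setVar 24 0 = s₄ at *
  have hr4 := hr.frame hF4 (by simp)
  have hclear := wp_clearAll (S := S) h4 hs4 hr4 (y := y) (by rw [hF4.var (by simp), h23]) h24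
    (by rw [unionAt_frame hF4 (by simp), hF4.var (by simp)]; exact hR)
  rw [hF4.var (k := 20) (by simp), unionSteps_frame hF4 (by simp), unionAt_frame hF4 (by simp)]
    at hclear
  refine .seq _ 1 _ ?_ hclear ?_
  · have : s.var 20 * (unionSteps s + (n * 4 + 5)) ≤
        s.var 20 * (unionSteps s + (n * (n * 6 + 7) + 5)) := by
      gcongr
      nlinarith
    omega
  rintro s₅ ⟨h5, hs5, hF5, hsame, hclr⟩
  replace hF5 := hF4.trans hF5
  have hsame0 : SameCell s₄ s₅ ((2 ^ n - 1) * n) := hsame 0 hn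
  refine .assign h5 (y + 1) (by simp [hF5.var (k := 23), h23]) (by simp) hy fun h => ⟨?_, ?_, ?_, ?_,
    ?_, ?_⟩
  · refine h.restrict fun a ha ha' => ?_
    refine Clear.same (s := s₅) ?_ (sameCell_setVar _ (by simp) _)
    rcases Finset.mem_union.1 ha with ha | ha
    · exact absurd ha ha'
    · simp only [Finset.mem_image, Finset.mem_product, Finset.mem_range, Prod.exists] at ha
      obtain ⟨x, v, ⟨hx, hv⟩, rfl⟩ := ha
      -- A cell of this round that is not kept cannot belong to the full set, so it has been
      -- cleared.
      refine hclr x hx (fun heq => ha' ?_) v hv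
      refine Finset.mem_insert_of_mem (Finset.mem_image.2 ⟨v, by simpa using hv, ?_⟩)
      rw [← heq, Nat.add_sub_cancel]
  · exact hs5.setVar (by simp)
  · simp only [roundVars, List.mem_cons, Nat.reduceEqDiff, true_or, or_true, intFrame_setVar]
    exact hF5.mono (by simp)
  · simp
  · exact fun x hx => ((hmono4 _ _ (hmono x hx)).congr hsame0.1 hsame0.2).setVar (by simp)
  · intro a pos hf hpos hlast hsum
    have := hnew4 a pos hf hpos
    rw [hsum, hlast, add_zero] at this
    exact (this.congr hsame0.1 hsame0.2).setVar (by simp)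

lemma sum_two_pow_Icc {a : ℕ → Fin n} (hinj : Set.InjOn a (Set.Icc 1 n)) :
    ∑ j ∈ Finset.Icc 1 n, 2 ^ (a j : ℕ) = 2 ^ n - 1 := by
  have h1 : (Finset.Icc 1 n).image a = Finset.univ := by
    rw [← Finset.card_eq_iff_eq_univ, Finset.card_image_of_injOn (by simpa using hinj)]
    simp
  rw [← Finset.sum_image (f := fun e : Fin n => 2 ^ (e : ℕ)) (by simpa using hinj), h1,
    Fin.sum_univ_eq_sum_range (fun e => 2 ^ e), Nat.geomSum_eq le_rfl]
  simp

/-- By `hcover` every closed tour through city 0 is found in some round, so the last entry is at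
most its length; by soundness that entry is the length of a path. Here `htour` shows that the entry
is present, since an absent one would read as weight zero. -/
lemma wp_dpProg {s : State} (hn : 0 < n) (h : Layout B n (keptCells n) s)
    (hs : Sound d s) (hr : Ready B n s)
    (hcover : ∀ a : ℕ → Fin n, (a 0 : ℕ) = 0 → Set.InjOn a (Set.Icc 1 n) →
      ∃ y < s.var 21, ∃ pos, Follows (unionAt s y) a pos ∧
        ∀ i, 1 ≤ i → i ≤ n → pos i < s.var 20)
    (htour : ∃ a : ℕ → Fin n, (a 0 : ℕ) = 0 ∧ Set.InjOn a (Set.Icc 1 n) ∧ (a n : ℕ) = 0) :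
    WP S d (DPLayout B n (s.var 20)) dpProg
      (s.var 21 * (2 * (s.var 20 * (unionSteps s + (n * (n * 6 + 7) + 5)) + 1) + 6) + 3)
      (fun s' => IsPath d (2 ^ n - 1) 0 (s'.weights (0, 0)) ∧
        ∀ a : ℕ → Fin n, (a 0 : ℕ) = 0 → Set.InjOn a (Set.Icc 1 n) → (a n : ℕ) = 0 →
          s'.output ≤ ∑ j ∈ Finset.range n, d (a j) (a (j + 1))) s := by
  have hY := h.var_lt 21
  have hX := h.var_lt 20
  refine .seq 1 (s.var 21 * (2 * (s.var 20 * (unionSteps s + (n * (n * 6 + 7) + 5)) + 1) + 6) + 2)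
    (fun s' => Layout B n (keptCells n) s' ∧ Sound d s' ∧ IntFrame roundVars s s' ∧
      s'.var 23 = 0) (by omega) ((WP.assign h 0 rfl (by simp) (by positivity) fun h =>
    ⟨h, hs.setVar (by simp), by simp [roundVars], by simp⟩).weaken fun _ h =>
      h.dpLayout_kept hr.n_lt) ?_
  rintro s₁ ⟨h1, hs1, hF1, h23⟩
  refine .seq (s.var 21 * (2 * (s.var 20 * (unionSteps s + (n * (n * 6 + 7) + 5)) + 1) + 6) + 1) 1
    (fun s' => Layout B n (keptCells n) s' ∧ Sound d s' ∧ IntFrame roundVars s s' ∧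
      ∀ a pos y, y < s.var 21 → Follows (unionAt s y) a pos →
        (∀ i, 1 ≤ i → i ≤ n → pos i < s.var 20) → (a n : ℕ) = 0 →
        Has s' ((2 ^ n - 1) * n) (∑ j ∈ Finset.range n, d (a j) (a (j + 1)))) (by omega) ?_ ?_
  · refine .whileLoop (fun y s' => Layout B n (keptCells n) s' ∧ Sound d s' ∧
      IntFrame roundVars s s' ∧ s'.var 23 = y ∧
      ∀ a pos y', y' < y → Follows (unionAt s y') a pos →
        (∀ i, 1 ≤ i → i ≤ n → pos i < s.var 20) → (a n : ℕ) = 0 →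
        Has s' ((2 ^ n - 1) * n) (∑ j ∈ Finset.range n, d (a j) (a (j + 1)))) (s.var 21)
      (2 * (s.var 20 * (unionSteps s + (n * (n * 6 + 7) + 5)) + 1) + 5) le_rfl ?_ ?_ ?_ ?_
    · exact ⟨h1, hs1, hF1, h23, by simp⟩
    · clear! s₁
      rintro y hy s' ⟨h, hs', hF, h23, hhas⟩
      have hr' := hr.frame hF (by simp [roundVars])
      refine ⟨by simp [h23, hF.var (k := 21), roundVars, hy], ?_⟩
      have hround := wp_roundProg (S := S) hn h hs' hr' h23
        ((Nat.succ_le_of_lt hy).trans_lt hY)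
      rw [hF.var (k := 20) (by simp [roundVars]), unionSteps_frame hF (by simp [roundVars]),
        unionAt_frame hF (by simp [roundVars])] at hround
      refine (hround.weaken fun t ht => ?_).mono le_rfl ?_
      · have := ht.dpLayout_round hr'
        rwa [hF.var (k := 20) (by simp [roundVars])] at this
      · rintro t ⟨ht, hst, hFt, h23t, hmono, hnew⟩
        refine ⟨ht, hst, hF.trans hFt, h23t, fun a pos y' hy' hf hpos hlast => ?_⟩
        rcases Nat.lt_succ_iff_lt_or_eq.1 hy' with hy' | rfl
        · exact hmono _ (hhas a pos y' hy' hf hpos hlast)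
        · exact hnew a pos hf hpos hlast (sum_two_pow_Icc hf.inj)
    · clear! s₁
      rintro s' ⟨h, hs', hF, h23, hhas⟩
      exact ⟨h.dpLayout_kept hr.n_lt, by simp [h23, hF.var (k := 21), roundVars]⟩
    · clear! s₁
      rintro s' ⟨h, hs', hF, h23, hhas⟩
      exact ⟨h, hs', hF, hhas⟩
  · clear! s₁
    rintro s' ⟨h, hs', hF, hhas⟩
    have hr' := hr.frame hF (by simp [roundVars])
    have hhas' : ∀ a : ℕ → Fin n, (a 0 : ℕ) = 0 → Set.InjOn a (Set.Icc 1 n) → (a n : ℕ) = 0 →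
        Has s' ((2 ^ n - 1) * n) (∑ j ∈ Finset.range n, d (a j) (a (j + 1))) := by
      intro a h0 hinj hlast
      obtain ⟨y, hy, pos, hf, hpos⟩ := hcover a h0 hinj
      exact hhas a pos y hy hf hpos hlast
    have hval : (entryAt (var 22 - num 1) (num 0)).eval d s' =
        s'.weights (0, (2 ^ n - 1) * n) := by
      change s'.weights (0, (s'.var 22 - 1) * s'.var 0 + 0) = _
      rw [hr'.v22, hr'.v0, add_zero]
    refine .setWeight 0 _ rfl hval (h.dpLayout_kept hr.n_lt)
      ((h.setWeight (Finset.mem_insert_self _ _) (h.count _)).dpLayout_kept hr.n_lt) ⟨?_, ?_⟩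
    · obtain ⟨a, h0, hinj, hlast⟩ := htour
      have h1 := (hhas' a h0 hinj hlast).1
      have h2 := hs' (2 ^ n - 1) 0 hn
      rw [add_zero, h1] at h2
      simpa [State.weights_setWeight] using h2
    · intro a h0 hinj hlast
      simpa [State.output, State.weights_setWeight] using (hhas' a h0 hinj hlast).2

end TSP

namespace TSP

/-! ## Cover codes contain the chains of all tours -/

/-- The matched positions are kept as offsets within the current group. A match at digit t appends
the offset `t % s`, which exceeds all earlier ones; at the start of a group the record is emptied.
-/
lemma greedy_spec {m s M c p : ℕ} (t : ℕ) :
    ∃ j : ℕ → ℕ, (∀ i < greedy m s M c p (t + 1), j i ≤ t % s ∧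
      c / M ^ (t / s * s + j i) % M = sublevelCode m p i) ∧
      StrictMonoOn j (Set.Iio (greedy m s M c p (t + 1))) := by
  have key : ∀ t g (j : ℕ → ℕ), (∀ i < g, j i < t % s ∧
      c / M ^ (t / s * s + j i) % M = sublevelCode m p i) → StrictMonoOn j (Set.Iio g) →
      ∃ j : ℕ → ℕ, (∀ i < (if c / M ^ t % M = sublevelCode m p g then g + 1 else g), j i ≤ t % s ∧
      c / M ^ (t / s * s + j i) % M = sublevelCode m p i) ∧
      StrictMonoOn j (Set.Iio (if c / M ^ t % M = sublevelCode m p g then g + 1 else g)) := by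
    intro t g j hj hmono
    split_ifs with h
    · refine ⟨Function.update j g (t % s), fun i hi => ?_, fun i hi i' hi' hii' => ?_⟩
      · rcases Nat.lt_succ_iff_lt_or_eq.1 hi with hi | rfl
        · rw [Function.update_of_ne hi.ne]
          exact ⟨(hj i hi).1.le, (hj i hi).2⟩
        · rw [Function.update_self, Nat.div_add_mod']
          exact ⟨le_rfl, h⟩
      · have hig : i < g := by simp only [Set.mem_Iio] at hi'; omega
        rw [Function.update_of_ne hig.ne]
        rcases Nat.lt_succ_iff_lt_or_eq.1 hi' with hi' | rfl
        · rw [Function.update_of_ne hi'.ne]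
          exact hmono hig hi' hii'
        · rw [Function.update_self]
          exact (hj i hig).1
    · exact ⟨j, fun i hi => ⟨(hj i hi).1.le, (hj i hi).2⟩, hmono⟩
  have hstep : ∀ t, greedy m s M c p (t + 1) =
      if c / M ^ t % M = sublevelCode m p (if t % s = 0 then 0 else greedy m s M c p t) then
        (if t % s = 0 then 0 else greedy m s M c p t) + 1
      else if t % s = 0 then 0 else greedy m s M c p t := fun t => by rw [greedy]
  induction t with
  | zero =>
    rw [hstep, Nat.zero_mod, if_pos rfl]
    exact key 0 0 id (by simp) fun i hi => absurd hi (Nat.not_lt_zero i)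
  | succ t ih =>
    rw [hstep]
    by_cases h0 : (t + 1) % s = 0
    · rw [if_pos h0]
      exact key _ 0 id (by simp) fun i hi => absurd hi (Nat.not_lt_zero i)
    · rw [if_neg h0]
      obtain ⟨j, hj, hmono⟩ := ih
      have hdiv : (t + 1) / s = t / s := by
        rw [Nat.succ_div, if_neg (by rwa [Nat.dvd_iff_mod_eq_zero])]; simp
      have hmod : (t + 1) % s = t % s + 1 := by
        have h1 := Nat.div_add_mod (t + 1) s
        have h2 := Nat.div_add_mod t s
        rw [hdiv] at h1
        omega
      refine key _ _ j (fun i hi => ?_) hmono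
      rw [hdiv, hmod]
      exact ⟨Nat.lt_succ_of_le (hj i hi).1, (hj i hi).2⟩

lemma IsCoverCode.exists_list {m s M c p : ℕ} (h : IsCoverCode m s M c) (hs : 0 < s)
    (hp : p < m ^ m) :
    ∃ l < numDigits M c / s + 1, ∃ j : ℕ → ℕ, StrictMonoOn j (Set.Iic m) ∧
      ∀ i ≤ m, j i < s ∧ c / M ^ (l * s + j i) % M = sublevelCode m p i := by
  obtain ⟨t, ht, hg⟩ := h.2 p hp
  obtain ⟨j, hj, hmono⟩ := greedy_spec (m := m) (s := s) (M := M) (c := c) (p := p) t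
  rw [hg] at hj hmono
  -- The last group may be incomplete, hence the `+ 1` in the number of lists.
  refine ⟨t / s, Nat.lt_succ_of_le (Nat.div_le_div_right ht.le), j, fun i hi i' hi' => ?_,
    fun i hi => ?_⟩
  · exact hmono (Nat.lt_succ_of_le hi) (Nat.lt_succ_of_le hi')
  · have := hj i (Nat.lt_succ_of_le hi)
    exact ⟨this.1.trans_lt (Nat.mod_lt _ hs), this.2⟩

lemma digitSum_lt {b k : ℕ} {f : ℕ → ℕ} (hf : ∀ j < k, f j < b) :
    ∑ j ∈ Finset.range k, f j * b ^ j < b ^ k := by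
  induction k with
  | zero => simp
  | succ k ih =>
    rw [Finset.sum_range_succ, pow_succ]
    have h1 := ih fun j hj => hf j (by omega)
    have h2 : f k + 1 ≤ b := hf k (by omega)
    nlinarith [Nat.mul_le_mul_right (b ^ k) h2]

lemma digitSum_div_mod {b k : ℕ} {f : ℕ → ℕ} (hf : ∀ j < k, f j < b) {i : ℕ} (hi : i < k) :
    (∑ j ∈ Finset.range k, f j * b ^ j) / b ^ i % b = f i := by
  have hb : 0 < b := (Nat.zero_le _).trans_lt (hf i hi)
  induction k with
  | zero => omega
  | succ k ih =>
    rw [Finset.sum_range_succ]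
    rcases Nat.lt_succ_iff_lt_or_eq.1 hi with hi' | rfl
    · have : f k * b ^ k = b ^ i * (b * (f k * b ^ (k - i - 1))) := by
        have : b ^ k = b ^ i * b * b ^ (k - i - 1) := by
          rw [← pow_succ, ← pow_add]; congr 1; omega
        rw [this]; ring
      rw [this, Nat.add_mul_div_left _ _ (by positivity), Nat.add_mul_mod_self_left]
      exact ih (fun j hj => hf j (by omega)) hi'
    · rw [Nat.add_mul_div_right _ _ (by positivity),
        Nat.div_eq_of_lt (digitSum_lt fun j hj => hf j (by omega)), zero_add,
        Nat.mod_eq_of_lt (hf _ hi)]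

/-- A number whose sublevel sets are those of `τ` on `{0, …, m - 1}`. -/
lemma exists_sublevelCode_eq (m : ℕ) (τ : ℕ → ℕ) :
    ∃ p < m ^ m, ∀ i, sublevelCode m p ((Finset.range m).filter (τ · ≤ i)).card =
      ∑ e ∈ Finset.range m, if τ e ≤ i then 2 ^ e else 0 := by
  have hrank : ∀ e < m, ((Finset.range m).filter (τ · < τ e)).card < m := fun e he => by
    have : (Finset.range m).filter (τ · < τ e) ⊂ Finset.range m := by
      rw [Finset.ssubset_iff_of_subset (Finset.filter_subset _ _)]
      exact ⟨e, by simpa using he, by simp⟩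
    simpa using Finset.card_lt_card this
  -- Digit e of the witness is the number of elements with smaller τ. It is below m, and below the
  -- number of elements with τ at most i exactly if τ e is at most i.
  refine ⟨∑ e ∈ Finset.range m, ((Finset.range m).filter (τ · < τ e)).card * m ^ e,
    digitSum_lt hrank, fun i => Finset.sum_congr rfl fun e he => ?_⟩
  have he := Finset.mem_range.1 he
  rw [digitSum_div_mod hrank he]
  refine if_congr ?_ rfl rfl
  constructor
  · contrapose!
    intro h
    refine Finset.card_le_card fun e' he' => ?_
    simp only [Finset.mem_filter] at he' ⊢
    exact ⟨he'.1, he'.2.trans_lt h⟩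
  · intro h
    refine Finset.card_lt_card ?_
    rw [Finset.ssubset_iff_of_subset]
    · exact ⟨e, by simp [he, h], by simp⟩
    · intro e' he'
      simp only [Finset.mem_filter] at he' ⊢
      exact ⟨he'.1, he'.2.le.trans h⟩

lemma sum_range_mul_eq (f : ℕ → ℕ) (m k : ℕ) :
    ∑ x ∈ Finset.range (m * k), f x =
      ∑ j ∈ Finset.range k, ∑ e ∈ Finset.range m, f (m * j + e) := by
  induction k with
  | zero => simp
  | succ k ih => rw [Nat.mul_succ, Finset.sum_range_add, ih, Finset.sum_range_succ]

variable {n : ℕ}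

/-- Each block sees the tour as an ordering of its elements by time of arrival, and the code has a
list for this ordering. The chosen lists are the base L digits of `y`, and the positions in these
lists are the base s digits of `pos i`. -/
lemma IsCoverCode.exists_follows {m s c L k : ℕ} (h : IsCoverCode m s (2 ^ m) c) (hm : 0 < m)
    (hs : 0 < s) (hL : L = numDigits (2 ^ m) c / s + 1) (hk : k = n / m + 1) {a : ℕ → Fin n}
    (h0 : (a 0 : ℕ) = 0) (hinj : Set.InjOn a (Set.Icc 1 n)) :
    ∃ y < L ^ k, ∃ pos, Follows (fun x => blockUnion (2 ^ m) c s L k x y) a pos ∧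
      ∀ i, 1 ≤ i → i ≤ n → pos i < s ^ k := by
  classical
  let V : ℕ → Finset ℕ := fun i => (Finset.Icc 1 i).image fun j => (a j : ℕ)
  have hVmono : ∀ i i', i ≤ i' → V i ⊆ V i' := fun i i' h =>
    Finset.image_subset_image (Finset.Icc_subset_Icc_right h)
  -- The time of arrival. Numbers from n on, which pad the last block, never arrive and all get n +
  -- 1; this is why orderings with ties are needed.
  let τ : ℕ → ℕ := fun e => ((Finset.range (n + 1)).filter fun i => e ∉ V i).card
  have hτ : ∀ i ≤ n, ∀ e, τ e ≤ i ↔ e ∈ V i := by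
    intro i hi e
    constructor
    · contrapose!
      intro he
      have : Finset.range (i + 1) ⊆ (Finset.range (n + 1)).filter fun i => e ∉ V i := by
        intro i' hi'
        simp only [Finset.mem_range, Finset.mem_filter] at hi' ⊢
        exact ⟨by omega, fun h => he (hVmono i' i (by omega) h)⟩
      have := Finset.card_le_card this
      simpa using this
    · intro he
      have : (Finset.range (n + 1)).filter (fun i => e ∉ V i) ⊆ Finset.range i := by
        intro i' hi'
        simp only [Finset.mem_range, Finset.mem_filter] at hi' ⊢
        by_contra hle
        exact hi'.2 (hVmono i i' (by omega) he)
      simpa using Finset.card_le_card this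
  have hblock : ∀ j : ℕ, ∃ p < m ^ m, ∀ i, sublevelCode m p
      ((Finset.range m).filter fun e => τ (m * j + e) ≤ i).card =
      ∑ e ∈ Finset.range m, if τ (m * j + e) ≤ i then 2 ^ e else 0 := fun j =>
    exists_sublevelCode_eq m fun e => τ (m * j + e)
  choose p hp hpi using hblock
  have hlist := fun j => h.exists_list hs (hp j)
  rw [← hL] at hlist
  choose l hl J hJ using hlist
  let r : ℕ → ℕ → ℕ := fun j i => ((Finset.range m).filter fun e => τ (m * j + e) ≤ i).card
  have hr : ∀ j i, r j i ≤ m := fun j i => by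
    simpa using Finset.card_filter_le (Finset.range m) fun e => τ (m * j + e) ≤ i
  have hrmono : ∀ j i i', i ≤ i' → r j i ≤ r j i' := fun j i i' hii => by
    refine Finset.card_le_card fun e he => ?_
    simp only [Finset.mem_filter] at he ⊢
    exact ⟨he.1, he.2.trans hii⟩
  have hpos : ∀ i, ∀ j < k, J j (r j i) < s := fun i j _ => ((hJ j).2 _ (hr j i)).1
  have hlk : ∀ j < k, l j < L := fun j _ => hl j
  refine ⟨∑ j ∈ Finset.range k, l j * L ^ j, digitSum_lt hlk,
    fun i => ∑ j ∈ Finset.range k, J j (r j i) * s ^ j, ⟨h0, hinj, ?_, ?_⟩,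
    fun i _ _ => digitSum_lt (hpos i)⟩
  · rintro i ⟨hi1, hin⟩ i' ⟨hi1', hin'⟩ hii'
    -- No digit decreases, and the one for the block of the city reached at time i' increases, as
    -- that city was not reached by time i.
    refine Finset.sum_lt_sum (fun j _ => ?_) ⟨(a i' : ℕ) / m, ?_, ?_⟩
    · gcongr
      exact (hJ j).1.monotoneOn (hr j i) (hr j i') (hrmono j i i' hii'.le)
    · rw [Finset.mem_range, hk]
      exact Nat.lt_succ_of_le (Nat.div_le_div_right (a i').2.le)
    · refine Nat.mul_lt_mul_of_pos_right ((hJ _).1 (hr _ _) (hr _ _) ?_) (by positivity)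
      refine Finset.card_lt_card ?_
      rw [Finset.ssubset_iff_of_subset]
      · refine ⟨(a i' : ℕ) % m, ?_, ?_⟩
        · simp only [Finset.mem_filter, Finset.mem_range, Nat.mod_lt _ hm, true_and,
            Nat.div_add_mod, hτ i' hin']
          exact Finset.mem_image.2 ⟨i', by simp [hi1'], rfl⟩
        · simp only [Finset.mem_filter, Finset.mem_range, Nat.div_add_mod, hτ i hin, not_and]
          intro _ hmem
          obtain ⟨j, hj, hja⟩ := Finset.mem_image.1 hmem
          rw [Finset.mem_Icc] at hj
          have := hinj ⟨hj.1, hj.2.trans hin⟩ ⟨hi1', hin'⟩ (Fin.ext hja)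
          omega
      · intro e he
        simp only [Finset.mem_filter] at he ⊢
        exact ⟨he.1, he.2.trans hii'.le⟩
  · intro i hi1 hin
    have hsub : V i ⊆ Finset.range (m * k) := by
      intro e he
      obtain ⟨j, -, rfl⟩ := Finset.mem_image.1 he
      rw [Finset.mem_range, hk]
      exact (a j).2.trans (Nat.lt_mul_div_succ n hm)
    have hV : ∑ j ∈ Finset.Icc 1 i, 2 ^ (a j : ℕ) =
        ∑ e ∈ Finset.range (m * k), if τ e ≤ i then 2 ^ e else 0 := by
      rw [← Finset.sum_image (f := fun e => 2 ^ e) (g := fun j => (a j : ℕ)),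
        ← Finset.sum_filter]
      · refine Finset.sum_congr ?_ fun _ _ => rfl
        ext e
        simp only [Finset.mem_filter, hτ i hin]
        exact ⟨fun he => ⟨hsub he, he⟩, fun he => he.2⟩
      · intro j hj j' hj' hjj
        simp only [Finset.coe_Icc, Set.mem_Icc] at hj hj'
        exact hinj ⟨hj.1, hj.2.trans hin⟩ ⟨hj'.1, hj'.2.trans hin⟩ (Fin.ext hjj)
    rw [hV, sum_range_mul_eq, blockUnion]
    refine Finset.sum_congr rfl fun j hj => ?_
    have hj := Finset.mem_range.1 hj
    rw [digitSum_div_mod hlk hj, digitSum_div_mod (hpos i) hj, ((hJ j).2 _ (hr j i)).2, hpi j i,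
      Finset.mul_sum]
    refine Finset.sum_congr rfl fun e _ => ?_
    split_ifs
    · rw [← pow_mul, ← pow_add]
    · simp

end TSP

namespace TSP

/-! ## Existence of cover codes -/

lemma mul_add_mod_eq {a b s : ℕ} (h : b < s) : (a * s + b) % s = b := by
  rw [Nat.add_comm, Nat.add_mul_mod_self_right, Nat.mod_eq_of_lt h]

/-- Greedy matching is never behind another matching. Each digit adds at most one match, so the
value m + 1 is attained exactly when it is first reached. The digit matched then is the whole block,
hence not zero, so it lies within the digits of `c`; this is the role of `hpos`. -/
lemma exists_greedy_eq {m s M c p l : ℕ} (hM : 1 < M) (hc : 0 < c)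
    {j : ℕ → ℕ} (hj : StrictMonoOn j (Set.Iic m)) (hjs : ∀ i ≤ m, j i < s)
    (hdigit : ∀ i ≤ m, c / M ^ (l * s + j i) % M = sublevelCode m p i)
    (hpos : 0 < sublevelCode m p m) :
    ∃ t < numDigits M c, greedy m s M c p (t + 1) = m + 1 := by
  let h : ℕ → ℕ := fun τ => greedy m s M c p (l * s + τ + 1)
  let g : ℕ → ℕ := fun τ => if τ = 0 then 0 else h (τ - 1)
  have hstep : ∀ τ < s, h τ =
      if c / M ^ (l * s + τ) % M = sublevelCode m p (g τ) then g τ + 1 else g τ := by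
    intro τ hτ
    have h1 : (l * s + τ) % s = 0 ↔ τ = 0 := by
      rw [mul_add_mod_eq hτ]
    have h2 : (if (l * s + τ) % s = 0 then 0 else greedy m s M c p (l * s + τ)) = g τ := by
      simp only [h1, g]
      split_ifs with h0
      · rfl
      · simp only [h]; congr 1; omega
    change greedy m s M c p (l * s + τ + 1) = _
    rw [greedy]
    simp only [h2]
  have hmono : ∀ τ < s, g τ ≤ h τ := fun τ hτ => by
    rw [hstep τ hτ]; split_ifs <;> omega
  have hmono' : ∀ τ' τ, τ < τ' → τ' < s → h τ ≤ g τ' := by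
    intro τ' τ hlt hs'
    induction τ', hlt using Nat.le_induction with
    | base => simp [g]
    | succ τ' hle ih =>
      have h1 := hmono τ' (by omega)
      have h2 : g (τ' + 1) = h τ' := by simp [g]
      have := ih (by omega)
      omega
  have hreach : ∀ i ≤ m, i + 1 ≤ h (j i) := by
    have key : ∀ i ≤ m, i ≤ g (j i) → i + 1 ≤ h (j i) := by
      intro i hi hgi
      rcases Nat.lt_or_ge i (g (j i)) with h1 | h1
      · exact h1.trans_le (hmono _ (hjs i hi))
      · obtain h2 : g (j i) = i := by omega
        rw [hstep _ (hjs i hi), h2, if_pos (hdigit i hi)]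
    intro i hi
    induction i with
    | zero => exact key 0 hi (Nat.zero_le _)
    | succ i ih =>
      refine key (i + 1) hi ((ih (by omega)).trans (hmono' _ _ ?_ (hjs _ hi)))
      exact hj (show i ≤ m by omega) hi (Nat.lt_succ_self i)
  classical
  have hex : ∃ τ, m + 1 ≤ h τ := ⟨j m, hreach m le_rfl⟩
  have hfind := Nat.find_spec hex
  have hle : Nat.find hex ≤ j m := Nat.find_min' hex (hreach m le_rfl)
  have hlt : g (Nat.find hex) < m + 1 := by
    by_cases h0 : Nat.find hex = 0
    · simp [g, h0]
    · have := Nat.find_min hex (m := Nat.find hex - 1) (by omega)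
      simp only [g, h0, if_false]
      omega
  have hτs : Nat.find hex < s := hle.trans_lt (hjs m le_rfl)
  rw [hstep _ hτs] at hfind
  split_ifs at hfind with hd
  · have hg : g (Nat.find hex) = m := by omega
    refine ⟨l * s + Nat.find hex, ?_, ?_⟩
    · rw [lt_numDigits_iff hM hc]
      refine Nat.pos_of_ne_zero fun h0 => ?_
      rw [h0, hg] at hd
      simp at hd
      omega
    · change h _ = _
      rw [hstep _ hτs, if_pos hd, hg]
  · omega

/-- The sublevel set number `i` of the `p`-th ordering of `{0, …, m - 1}`. -/
def sublevelSet (m p i : ℕ) : Finset ℕ := (Finset.range m).filter fun e => p / m ^ e % m < i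

/-- Each family is written m + 1 times in a row. Set number i of a chain is taken from copy number
i, so the chain is a subsequence whatever the order within the family. Families with fewer than `s₁`
members are filled up with empty sets. -/
lemma exists_isCoverCode {m N s₁ : ℕ} (hm : 0 < m) (G : Fin N → Finset (Finset ℕ))
    (hG : ∀ l, (G l).card ≤ s₁)
    (hcover : ∀ p < m ^ m, ∃ l, ∀ i ≤ m, sublevelSet m p i ∈ G l) :
    ∃ c < (2 ^ m) ^ (s₁ * (m + 1) * N), IsCoverCode m (s₁ * (m + 1)) (2 ^ m) c := by
  classical
  have henum : ∀ l, ∃ g : ℕ → Finset ℕ, ∀ A ∈ G l, ∃ x < s₁, g x = A := by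
    intro l
    refine ⟨fun x => if h : x < (G l).card then ((G l).equivFin.symm ⟨x, h⟩ : Finset ℕ) else ∅,
      fun A hA => ⟨(G l).equivFin ⟨A, hA⟩, (Fin.is_lt _).trans_le (hG l), ?_⟩⟩
    simp
  choose g hg using henum
  let s := s₁ * (m + 1)
  let T : ℕ → ℕ := fun t => if h : t / s < N then
    ∑ e ∈ Finset.range m, if e ∈ g ⟨t / s, h⟩ (t % s % s₁) then 2 ^ e else 0 else 0
  have hT : ∀ t < s * N, T t < 2 ^ m := fun t _ => by
    simp only [T]
    split_ifs
    · exact sum_ite_two_pow_lt m _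
    · positivity
  have hdig := fun t ht => digitSum_div_mod hT (i := t) ht
  have hM : 1 < 2 ^ m := Nat.one_lt_two_pow hm.ne'
  set c := ∑ t ∈ Finset.range (s * N), T t * (2 ^ m) ^ t with hcdef
  have key : ∀ p < m ^ m, ∃ l, ∃ j : ℕ → ℕ, StrictMonoOn j (Set.Iic m) ∧ (∀ i ≤ m, j i < s) ∧
      ∀ i ≤ m, c / (2 ^ m) ^ (l * s + j i) % 2 ^ m = sublevelCode m p i := by
    intro p hp
    obtain ⟨l, hl⟩ := hcover p hp
    have hx : ∀ i, ∃ x, i ≤ m → x < s₁ ∧ g l x = sublevelSet m p i := by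
      intro i
      by_cases hi : i ≤ m
      · obtain ⟨x, h1, h2⟩ := hg l _ (hl i hi)
        exact ⟨x, fun _ => ⟨h1, h2⟩⟩
      · exact ⟨0, fun h => absurd h hi⟩
    choose x hx using hx
    have hjs : ∀ i ≤ m, i * s₁ + x i < s := fun i hi => by
      have := (hx i hi).1
      simp only [s]
      nlinarith [Nat.mul_le_mul_right s₁ hi]
    refine ⟨l, fun i => i * s₁ + x i, fun i hi i' hi' hii' => ?_, hjs, fun i hi => ?_⟩
    · have := (hx i hi).1
      have := Nat.mul_le_mul_right s₁ (Nat.succ_le_of_lt hii')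
      simp only
      rw [Nat.succ_mul] at this
      omega
    · have h1 := hjs i hi
      have hspos : 0 < s := by omega
      have h2 : l * s + (i * s₁ + x i) < s * N := by
        have := Nat.mul_le_mul_left s (Nat.succ_le_of_lt l.2)
        rw [Nat.mul_succ, mul_comm s] at this
        omega
      have h3 : (l * s + (i * s₁ + x i)) / s = l := by
        rw [Nat.add_comm, Nat.add_mul_div_right _ _ hspos, Nat.div_eq_of_lt h1, zero_add]
      have h4 : (l * s + (i * s₁ + x i)) % s % s₁ = x i := by
        rw [mul_add_mod_eq h1, mul_add_mod_eq (hx i hi).1]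
      rw [hdig _ h2]
      simp only [T, h4]
      rw [dif_pos (by rw [h3]; exact l.2)]
      simp only [h3, Fin.eta, (hx i hi).2, sublevelCode]
      refine Finset.sum_congr rfl fun e he => ?_
      simp only [sublevelSet, Finset.mem_filter, he, true_and]
  have hfull : ∀ p, 0 < sublevelCode m p m := fun p => by
    rw [sublevelCode]
    refine Finset.sum_pos (fun e _ => ?_) ⟨0, by simpa using hm⟩
    rw [if_pos (Nat.mod_lt _ hm)]
    positivity
  have hcpos : 0 < c := by
    obtain ⟨l, j, -, -, hd⟩ := key 0 (by positivity)
    refine Nat.pos_of_ne_zero fun h0 => ?_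
    have h1 := hd m le_rfl
    have h2 := hfull 0
    rw [h0] at h1
    simp at h1
    omega
  refine ⟨c, digitSum_lt hT, hcpos, fun p hp => ?_⟩
  obtain ⟨l, j, hj, hjs, hd⟩ := key p hp
  exact exists_greedy_eq hM hcpos hj hjs hd (hfull p)

/-- Every ordering has its own list. -/
lemma exists_isCoverCode_trivial {m s₁ : ℕ} (hm : 0 < m) (hs : m + 1 ≤ s₁) :
    ∃ c < (2 ^ m) ^ (s₁ * (m + 1) * m ^ m), IsCoverCode m (s₁ * (m + 1)) (2 ^ m) c := by
  classical
  refine exists_isCoverCode hm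
    (fun l : Fin (m ^ m) => (Finset.range (m + 1)).image (sublevelSet m l)) (fun l => ?_)
    fun p hp => ⟨⟨p, hp⟩, fun i hi => Finset.mem_image.2 ⟨i, by simpa using by omega, rfl⟩⟩
  exact (Finset.card_image_le.trans (by simp)).trans hs

/-! ### The covering argument -/

/-- A family of subsets that contain every point often enough has a small subfamily that covers. -/
lemma exists_cover {H X : Type*} [Fintype H] [Fintype X] (R : H → X → Prop) {a N : ℕ}
    (hR : ∀ x, a ≤ Nat.card {h // R h x})
    (hN : Fintype.card X * (Fintype.card H - a) ^ N < Fintype.card H ^ N) :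
    ∃ h : Fin N → H, ∀ x, ∃ i, R (h i) x := by
  classical
  by_contra! hcon
  -- A tuple that covers nothing of some x avoids every h good for x. For each x there are at most
  -- `(|H| - a) ^ N` such tuples, and by `hN` they cannot exhaust all tuples.
  have hsub : (Finset.univ : Finset (Fin N → H)) ⊆ Finset.univ.biUnion fun x : X =>
      Fintype.piFinset fun _ : Fin N => Finset.univ.filter fun h => ¬ R h x := by
    intro h _
    obtain ⟨x, hx⟩ := hcon h
    simp only [Finset.mem_biUnion, Finset.mem_univ, true_and, Fintype.mem_piFinset,
      Finset.mem_filter]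
    exact ⟨x, hx⟩
  have h1 := (Finset.card_le_card hsub).trans Finset.card_biUnion_le
  have h2 : ∀ x : X, (Fintype.piFinset fun _ : Fin N =>
      Finset.univ.filter fun h => ¬ R h x).card ≤ (Fintype.card H - a) ^ N := by
    intro x
    rw [Fintype.card_piFinset_const]
    refine Nat.pow_le_pow_left ?_ _
    have h3 := Finset.card_filter_add_card_filter_not (s := (Finset.univ : Finset H)) (R · x)
    have h4 := hR x
    rw [Nat.card_eq_fintype_card, Fintype.card_subtype] at h4
    rw [Finset.card_univ] at h3
    omega
  have h5 := Finset.sum_le_card_nsmul Finset.univ _ _ fun x _ => h2 x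
  rw [Finset.card_univ, Fintype.card_pi_const, ] at h1
  rw [Finset.card_univ, smul_eq_mul] at h5
  omega

/-- A chain of n + 1 members gains a point at every step. These points are pairwise distinct, so
they are all points, ordered by the time at which they are gained. -/
lemma exists_perm_of_chain {n : ℕ} {c : Fin (n + 1) → Finset (Fin n)} (hc : StrictMono c) :
    ∃ ρ : Equiv.Perm (Fin n), ∀ i x, x ∈ c i ↔ (ρ.symm x : ℕ) < i := by
  have hex : ∀ i : Fin n, ∃ x, x ∈ c i.succ ∧ x ∉ c i.castSucc := fun i =>
    Finset.exists_of_ssubset (hc i.castSucc_lt_succ)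
  choose f hf hf' using hex
  have hlt : ∀ i i', i < i' → f i ≠ f i' := fun i i' h heq =>
    hf' i' (heq ▸ hc.monotone (show i.succ ≤ i'.castSucc from h) (hf i))
  have hinj : Function.Injective f := fun i i' heq => by
    rcases lt_trichotomy i i' with h | h | h
    · exact absurd heq (hlt _ _ h)
    · exact h
    · exact absurd heq.symm (hlt _ _ h)
  refine ⟨Equiv.ofBijective f (Finite.injective_iff_bijective.1 hinj), fun i x => ?_⟩
  obtain ⟨e, rfl⟩ := (Finite.injective_iff_bijective.1 hinj).2 x
  have he : (Equiv.ofBijective f (Finite.injective_iff_bijective.1 hinj)).symm (f e) = e :=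
    (Equiv.ofBijective f _).symm_apply_apply e
  rw [he]
  constructor
  · contrapose!
    exact fun h hmem => hf' e (hc.monotone (show i ≤ e.castSucc from h) hmem)
  · exact fun h => hc.monotone (show e.succ ≤ i from h) (hf e)

/-- Every ordering with ties is transformed into chains of `F` by at least as many permutations as
`F` has maximal chains. -/
lemma numMaximalChains_le {n : ℕ} (F : SetSystem n) (t : Fin n → ℕ) :
    numMaximalChains F ≤ Nat.card {h : Equiv.Perm (Fin n) //
      ∀ i, (Finset.univ.filter fun x => t (h.symm x) < i) ∈ F} := by
  have hρ := fun c : {c : Fin (n + 1) → Finset (Fin n) // (∀ i, c i ∈ F) ∧ StrictMono c} =>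
    exists_perm_of_chain c.2.2
  choose ρ hρ using hρ
  let σ := Tuple.sort t
  have hσ : Monotone (t ∘ σ) := Tuple.monotone_sort t
  -- Send the point of rank r in the order sorted by `t` to the point that the chain gains at step
  -- r. A sublevel set of `t` is an initial segment of the sorted order, so its image is a member of
  -- the chain.
  refine Nat.card_le_card_of_injective (fun c => ⟨σ.symm.trans (ρ c), fun i => ?_⟩) ?_
  · let D : Finset (Fin n) := Finset.univ.filter fun a => t (σ a) < i
    have hD : ∀ a, t (σ a) < i ↔ (a : ℕ) < D.card := by
      intro a
      constructor
      · intro ha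
        have : Finset.Iic a ⊆ D := fun b hb =>
          Finset.mem_filter.2 ⟨Finset.mem_univ _, (hσ (Finset.mem_Iic.1 hb)).trans_lt ha⟩
        have := Finset.card_le_card this
        rw [Fin.card_Iic] at this
        omega
      · contrapose!
        intro ha
        have : D ⊆ Finset.Iio a := fun b hb => by
          rw [Finset.mem_Iio]
          by_contra hle
          exact absurd (ha.trans (hσ (not_lt.1 hle))) (not_le.2 (Finset.mem_filter.1 hb).2)
        have := Finset.card_le_card this
        rwa [Fin.card_Iio] at this
    have hr : D.card < n + 1 := Nat.lt_succ_of_le (by simpa using Finset.card_le_univ D)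
    have : (Finset.univ.filter fun x => t ((σ.symm.trans (ρ c)).symm x) < i) =
        c.1 ⟨D.card, hr⟩ := by
      ext x
      rw [hρ c, Finset.mem_filter]
      simp only [Finset.mem_univ, true_and, Equiv.symm_trans_apply, Equiv.symm_symm]
      exact hD _
    rw [this]
    exact c.2.1 _
  · intro c c' h
    have h1 : σ.symm.trans (ρ c) = σ.symm.trans (ρ c') := congrArg Subtype.val h
    have h2 : ρ c = ρ c' := by
      ext x
      have := congrArg (fun e : Equiv.Perm (Fin n) => e (σ x)) h1
      simpa using congrArg Fin.val this
    refine Subtype.ext (funext fun i => Finset.ext fun x => ?_)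
    rw [hρ c, hρ c', h2]

lemma numMaximalChains_le_factorial {n : ℕ} (F : SetSystem n) : numMaximalChains F ≤ n ! := by
  refine (numMaximalChains_le F fun _ => 0).trans ((Nat.card_le_card_of_injective Subtype.val
    Subtype.val_injective).trans ?_)
  rw [Nat.card_eq_fintype_card, Fintype.card_perm, Fintype.card_fin]

/-- Products of relabelled copies of a set system contain the chains of all orderings. -/
lemma exists_lists {n m k N : ℕ} (F : SetSystem n) (hn : 0 < n) (hmk : m ≤ n * k)
    (hN : m ^ m * (n ! ^ k - numMaximalChains F ^ k) ^ N < (n ! ^ k) ^ N) :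
    ∃ G : Fin N → Finset (Finset ℕ), (∀ l, (G l).card ≤ F.card ^ k) ∧
      ∀ p < m ^ m, ∃ l, ∀ i ≤ m, sublevelSet m p i ∈ G l := by
  classical
  -- Points from m on only pad the ground set to size n k; the value m puts them above all digits.
  let t : ℕ → ℕ → ℕ := fun p e => if e < m then p / m ^ e % m else m
  let R : (Fin k → Equiv.Perm (Fin n)) → Fin (m ^ m) → Prop := fun h p => ∀ j : Fin k, ∀ i,
    (Finset.univ.filter fun x => t p (n * j + (h j).symm x) < i) ∈ F
  have hR : ∀ p, numMaximalChains F ^ k ≤ Nat.card {h // R h p} := by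
    intro p
    have hcard : Nat.card {h // R h p} = ∏ j : Fin k, Nat.card {h : Equiv.Perm (Fin n) // ∀ i,
        (Finset.univ.filter fun x => t p (n * j + h.symm x) < i) ∈ F} := by
      rw [← Nat.card_pi]
      exact Nat.card_congr (Equiv.subtypePiEquivPi (p := fun (j : Fin k) (h : Equiv.Perm (Fin n)) =>
        ∀ i, (Finset.univ.filter fun x => t p (n * j + h.symm x) < i) ∈ F))
    rw [hcard, ← Fin.prod_const]
    exact Finset.prod_le_prod' fun j _ => numMaximalChains_le F fun e => t p (n * j + e)
  obtain ⟨h, hh⟩ := exists_cover R hR (N := N) (by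
    simpa [Fintype.card_perm] using hN)
  -- Removing the padding can only identify members of the product, so the bound `F.card ^ k`
  -- persists.
  refine ⟨fun l => (Fintype.piFinset fun _ : Fin k => F).image fun B =>
    (Finset.range m).filter fun e => ∃ (j : Fin k) (e' : Fin n), e = n * j + e' ∧ h l j e' ∈ B j,
    fun l => Finset.card_image_le.trans (by rw [Fintype.card_piFinset_const]), fun p hp => ?_⟩
  obtain ⟨l, hl⟩ := hh ⟨p, hp⟩
  refine ⟨l, fun i _ => Finset.mem_image.2 ⟨fun j =>
    Finset.univ.filter fun x => t p (n * j + (h l j).symm x) < i,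
    Fintype.mem_piFinset.2 fun j => hl j i, ?_⟩⟩
  refine Finset.filter_congr fun e he => ?_
  have he := Finset.mem_range.1 he
  have hte : t p e = p / m ^ e % m := if_pos he
  rw [← hte]
  constructor
  · rintro ⟨j, e', rfl, hmem⟩
    simpa using hmem
  · intro hlt
    refine ⟨⟨e / n, Nat.div_lt_of_lt_mul (he.trans_le hmk)⟩, ⟨e % n, Nat.mod_lt _ hn⟩,
      (Nat.div_add_mod e n).symm, ?_⟩
    simpa [Nat.div_add_mod] using hlt

end TSP

namespace TSP

/-! ## Tours as paths -/

variable {S : ℝ} {n : ℕ} {d : Fin n → Fin n → ℝ} {B : ℕ}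

lemma tourLength_eq_sum (hn : 0 < n) (a : ℕ → Fin n) (π : Equiv.Perm (Fin n))
    (hπ : ∀ i : Fin n, π i = a i) (ha : a n = a 0) :
    tourLength d π = ∑ j ∈ Finset.range n, d (a j) (a (j + 1)) := by
  obtain ⟨n, rfl⟩ : ∃ n', n = n' + 1 := ⟨n - 1, by omega⟩
  rw [tourLength, ← Fin.sum_univ_eq_sum_range (fun j => d (a j) (a (j + 1)))]
  refine Finset.sum_congr rfl fun i _ => ?_
  have h : a (finRotate (n + 1) i : Fin (n + 1)) = a (i + 1) := by
    rcases eq_or_ne i (Fin.last n) with rfl | hi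
    · rw [finRotate_last]
      simp [ha]
    · rw [coe_finRotate_of_ne_last hi]
  rw [hπ, hπ, h]

/-- The mask forces every city to occur exactly once in steps 1 to the last, so there are n steps.
As the path returns to its start, it may be indexed by 0, …, n - 1 instead. -/
lemma exists_perm_of_isPath (hn : 0 < n) {w : ℝ × ℕ} (h : IsPath d (2 ^ n - 1) 0 w) :
    ∃ π, tourLength d π = w.1 := by
  classical
  obtain ⟨a, h0, hinj, hsum, hlast, hlen⟩ := h
  have hinj' : Set.InjOn (fun i => (a i : ℕ)) (Finset.Icc 1 w.2) := fun i hi j hj hij =>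
    hinj hi hj (Fin.ext hij)
  have himage : (Finset.Icc 1 w.2).image (fun i => (a i : ℕ)) = Finset.range n := by
    ext v
    rw [← sum_two_pow_div_mod (I := (Finset.Icc 1 w.2).image _), ← sum_two_pow_div_mod
      (I := Finset.range n), Finset.sum_image hinj', hsum, Nat.geomSum_eq le_rfl]
    simp
  have hw : w.2 = n := by
    have := congrArg Finset.card himage
    rwa [Finset.card_image_of_injOn hinj', Finset.card_range, Nat.card_Icc,
      Nat.add_sub_cancel] at this
  rw [hw] at hinj hlast hlen
  have han : a n = a 0 := Fin.ext (hlast.trans h0.symm)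
  have hpinj : Function.Injective fun i : Fin n => a i := by
    have key : ∀ i i' : Fin n, i < i' → a i ≠ a i' := by
      intro i i' hii' heq
      rcases Nat.eq_zero_or_pos (i : ℕ) with h1 | h1
      -- Injectivity is known on 1, …, n only, so index 0 is traded for n.
      · rw [h1, ← han] at heq
        have := hinj (by simp; omega) (by simp; omega) heq
        omega
      · have := hinj (by simp; omega) (by simp; omega) heq
        omega
    intro i i' heq
    rcases lt_trichotomy i i' with h | h | h
    · exact absurd heq (key _ _ h)
    · exact h
    · exact absurd heq.symm (key _ _ h)
  refine ⟨Equiv.ofBijective _ (Finite.injective_iff_bijective.1 hpinj), ?_⟩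
  rw [hlen]
  exact tourLength_eq_sum hn a _ (fun i => rfl) han

lemma exists_path_of_perm (hn : 0 < n) (π : Equiv.Perm (Fin n)) :
    ∃ a : ℕ → Fin n, (a 0 : ℕ) = 0 ∧ Set.InjOn a (Set.Icc 1 n) ∧ (a n : ℕ) = 0 ∧
      ∑ j ∈ Finset.range n, d (a j) (a (j + 1)) = tourLength d π := by
  obtain ⟨n, rfl⟩ : ∃ n', n = n' + 1 := ⟨n - 1, by omega⟩
  -- The tour is rotated so that it starts, and after n steps ends, at city 0.
  refine ⟨fun i : ℕ => π (π.symm 0 + Fin.ofNat (n + 1) i), by simp, ?_, by simp, ?_⟩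
  · intro i hi j hj hij
    have h2 : i ≡ j [MOD n + 1] := congrArg Fin.val (add_left_cancel (π.injective hij))
    obtain ⟨hi1, hi2⟩ := hi
    obtain ⟨hj1, hj2⟩ := hj
    by_contra hne
    rcases lt_or_gt_of_ne hne with h | h
    · have := (Nat.modEq_iff_dvd' h.le).1 h2
      have := Nat.le_of_dvd (by omega) this
      omega
    · have := (Nat.modEq_iff_dvd' h.le).1 h2.symm
      have := Nat.le_of_dvd (by omega) this
      omega
  · rw [← Fin.sum_univ_eq_sum_range
      (fun j : ℕ => d (π (π.symm 0 + Fin.ofNat (n + 1) j))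
        (π (π.symm 0 + Fin.ofNat (n + 1) (j + 1)))),
      tourLength, ← Equiv.sum_comp (Equiv.addLeft (π.symm 0))
        (fun i => d (π i) (π (finRotate (n + 1) i)))]
    refine Finset.sum_congr rfl fun j _ => ?_
    have hj : Fin.ofNat (n + 1) ((j : ℕ) + 1) = j + 1 :=
      Fin.ext (by simp [Fin.ofNat, Fin.val_add])
    simp only [hj, Equiv.coe_addLeft, finRotate_apply, add_assoc, Fin.ofNat_eq_cast,
      Fin.cast_val_eq_self]

/-! ## The program and its resources -/

/-- The program for the traveling salesman problem. -/
def tspProg : Program := paramProg ;; searchProg ;; sizesProg ;; dpProg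

/-! ### Step counts in terms of one common bound -/

lemma param_steps_le {m q Z : ℕ} (hm : m ≤ Z) (hq : q ≤ Z) (hZ : 1 ≤ Z) :
    m * (2 * q + 10) + 9 ≤ 21 * Z ^ 4 := by
  have h2 : Z ^ 2 ≤ Z ^ 4 := Nat.pow_le_pow_right hZ (by norm_num)
  have h1 : Z ^ 1 ≤ Z ^ 4 := Nat.pow_le_pow_right hZ (by norm_num)
  have h0 : 1 ≤ Z ^ 4 := Nat.one_le_pow _ _ hZ
  calc m * (2 * q + 10) + 9 ≤ Z * (2 * Z + 10) + 9 := by gcongr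
    _ = 2 * Z ^ 2 + 10 * Z ^ 1 + 9 := by ring
    _ ≤ 21 * Z ^ 4 := by omega

lemma search_steps_le {c P D m Z : ℕ} (hc : c ≤ Z) (hP : P ≤ Z) (hD : D ≤ Z) (hm : m ≤ Z)
    (hZ : 1 ≤ Z) : c * (P * (D * (6 * m + 14) + 9) + 5) + 3 ≤ 37 * Z ^ 4 := by
  have h3 : Z ^ 3 ≤ Z ^ 4 := Nat.pow_le_pow_right hZ (by norm_num)
  have h2 : Z ^ 2 ≤ Z ^ 4 := Nat.pow_le_pow_right hZ (by norm_num)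
  have h1 : Z ^ 1 ≤ Z ^ 4 := Nat.pow_le_pow_right hZ (by norm_num)
  have h0 : 1 ≤ Z ^ 4 := Nat.one_le_pow _ _ hZ
  calc c * (P * (D * (6 * m + 14) + 9) + 5) + 3
      ≤ Z * (Z * (Z * (6 * Z + 14) + 9) + 5) + 3 := by gcongr
    _ = 6 * Z ^ 4 + 14 * Z ^ 3 + 9 * Z ^ 2 + 5 * Z ^ 1 + 3 := by ring
    _ ≤ 37 * Z ^ 4 := by omega

lemma sizes_steps_le {k n Z : ℕ} (hk : k ≤ Z) (hn : n ≤ Z) (hZ : 1 ≤ Z) :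
    k * 4 + n * 3 + 9 ≤ 16 * Z ^ 4 := by
  have h1 : Z ^ 1 ≤ Z ^ 4 := Nat.pow_le_pow_right hZ (by norm_num)
  have h0 : 1 ≤ Z ^ 4 := Nat.one_le_pow _ _ hZ
  rw [pow_one] at h1
  omega

lemma dp_steps_le {X Y k w n Z : ℕ} (hX : 1 ≤ X) (hY : 1 ≤ Y) (hk : k ≤ Z) (hw : w ≤ Z)
    (hn : n ≤ Z) (hZ : 1 ≤ Z) :
    Y * (2 * (X * (k * (w * 3 + 10) + 6 + (n * (n * 6 + 7) + 5)) + 1) + 6) + 3 ≤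
      85 * Z ^ 4 * (X * Y) := by
  have h2 : Z ^ 2 ≤ Z ^ 4 := Nat.pow_le_pow_right hZ (by norm_num)
  have h1 : Z ^ 1 ≤ Z ^ 4 := Nat.pow_le_pow_right hZ (by norm_num)
  have h0 : 1 ≤ Z ^ 4 := Nat.one_le_pow _ _ hZ
  have h : k * (w * 3 + 10) + 6 + (n * (n * 6 + 7) + 5) ≤ 37 * Z ^ 4 := by
    calc k * (w * 3 + 10) + 6 + (n * (n * 6 + 7) + 5)
        ≤ Z * (Z * 3 + 10) + 6 + (Z * (Z * 6 + 7) + 5) := by gcongr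
      _ = 9 * Z ^ 2 + 17 * Z ^ 1 + 11 := by ring
      _ ≤ 37 * Z ^ 4 := by omega
  have hXY : 1 ≤ Z ^ 4 * (X * Y) := Nat.mul_pos h0 (Nat.mul_pos hX hY)
  have hY' : Y ≤ Z ^ 4 * (X * Y) := by
    calc Y = 1 * (1 * Y) := by ring
      _ ≤ Z ^ 4 * (X * Y) := by gcongr
  calc Y * (2 * (X * (k * (w * 3 + 10) + 6 + (n * (n * 6 + 7) + 5)) + 1) + 6) + 3
      ≤ Y * (2 * (X * (37 * Z ^ 4) + 1) + 6) + 3 := by gcongr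
    _ = 74 * (Z ^ 4 * (X * Y)) + 8 * Y + 3 := by ring
    _ ≤ 85 * (Z ^ 4 * (X * Y)) := by omega
    _ = 85 * Z ^ 4 * (X * Y) := by ring

lemma layout_initial (hB : n < 2 ^ B) : Layout B n (keptCells n) (State.initial n) where
  lt a := by
    simp only [State.initial, Finsupp.single_apply]
    split_ifs
    · exact hB
    · positivity
  ints k a h := by
    simp only [State.initial, Finsupp.single_apply, ne_eq, ite_eq_right_iff, not_forall] at h
    obtain ⟨h, -⟩ := h
    simp only [Prod.mk.injEq] at h
    exact .inl ⟨h.1 ▸ by norm_num, h.2.symm⟩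
  weights k a h := absurd rfl h
  count a := Nat.zero_le _

lemma sound_initial : Sound d (State.initial n) := fun A v _ => .inl (by simp [State.initial])

theorem wp_tspProg {m s c k L Z : ℕ} (hS : 1 ≤ S) (hn : 0 < n) (hm : 0 < m)
    (hm₁ : ∀ i < m, limitSeq i ≤ n) (hm₂ : n < limitSeq m)
    (hs : s = sizeSeq S m * ((m + 1) * (m + 1)))
    (hc : IsCoverCode m s (2 ^ m) c) (hc' : ∀ c' < c, ¬ IsCoverCode m s (2 ^ m) c')
    (hL : L = numDigits (2 ^ m) c / s + 1) (hk : k = n / m + 1)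
    (hZm : 2 ^ m ≤ Z) (hZq : limitSeq m ≤ Z) (hZP : m ^ m ≤ Z) (hZc : c ≤ Z)
    (hZD : numDigits (2 ^ m) c ≤ Z) (hZL : L * s ≤ Z) (hZn : n + 1 ≤ Z) :
    WP S d (DPLayout (Z * Z + Z) n (s ^ k)) tspProg (159 * Z ^ 4 * (s ^ k * L ^ k))
      (fun s' => IsLeast (Set.range (tourLength d)) s'.output) (State.initial n) := by
  -- The largest values are k-th powers of numbers up to Z with `k ≤ Z`, which are at most `2 ^ (Z *
  -- Z)`.
  set B := Z * Z + Z with hBdef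
  have hZB : Z ≤ B := Nat.le_add_left _ _
  have hL0 : 0 < L := hL ▸ Nat.succ_pos _
  have hZ : ∀ v, v ≤ Z → v < 2 ^ B := fun v hv =>
    (Nat.lt_two_pow_self (n := v)).trans_le (Nat.pow_le_pow_right (by norm_num) (hv.trans hZB))
  have hsz : 0 < sizeSeq S m :=
    (Nat.zero_le _).trans_lt (sizeSeq_mono hS hm)
  have hs0 : 0 < s := by rw [hs]; positivity
  have hsZ : s ≤ Z := (Nat.le_mul_of_pos_left s hL0).trans hZL
  have hLZ : L ≤ Z := (Nat.le_mul_of_pos_right L hs0).trans hZL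
  have hkZ : k ≤ Z := by rw [hk]; exact (Nat.succ_le_succ (Nat.div_le_self _ _)).trans hZn
  have hmZ : m < Z := Nat.lt_two_pow_self.trans_le hZm
  have hZpow : ∀ v, v ≤ Z → v ^ k < 2 ^ B := fun v hv => by
    calc v ^ k ≤ (2 ^ Z) ^ k := Nat.pow_le_pow_left (hv.trans Nat.lt_two_pow_self.le) _
      _ = 2 ^ (Z * k) := by rw [pow_mul]
      _ < 2 ^ B := Nat.pow_lt_pow_right (by norm_num)
        ((Nat.mul_le_mul_left Z hkZ).trans_lt (Nat.lt_add_of_pos_right (by omega)))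
  have hnB : n < B := by omega
  have hM : 1 < 2 ^ m := Nat.one_lt_two_pow hm.ne'
  have hdp : ∀ t, Layout B n (keptCells n) t → DPLayout B n (s ^ k) t := fun t ht =>
    ht.dpLayout_kept hnB
  have h := layout_initial (n := n) (hZ n (by omega))
  have e0 : (State.initial n).var 0 = n := by simp [State.initial, State.var]
  have hparam := wp_paramProg (S := S) (d := d) h hS hm (by omega) (by rwa [e0]) (by rwa [e0])
    (hZ _ hZq) (by rw [← hs]; exact hZ _ hsZ) (hZ _ hZP)
  have hszs : sizeSeq S m ≤ Z := (Nat.le_mul_of_pos_right _ (by positivity)).trans (hs ▸ hsZ)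
  have hPos : 1 ≤ s ^ k * L ^ k := Nat.mul_pos (by positivity) (Nat.pow_pos hL0)
  have hZ1 : 1 ≤ Z := by omega
  -- The phases account for 159 = 21 + 37 + 16 + 85.
  refine .seq (21 * Z ^ 4) (138 * Z ^ 4 * (s ^ k * L ^ k)) _ ?_
    ((hparam.weaken hdp).mono ?_ fun _ h => h) ?_
  · linarith [Nat.mul_le_mul_left (21 * Z ^ 4) hPos]
  · exact param_steps_le hmZ.le hszs hZ1
  rintro s₁ ⟨h1, hF1, e1, e3, e4, e9⟩
  rw [← hs] at e3
  have hsearch := wp_searchProg (S := S) (d := d) (c := c) h1 (by rw [e1]; omega) (by rwa [e4])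
    (hZ _ hZc) (by rw [e4]; exact hZ _ hZD) (by rw [e9]; positivity) (by rw [e9, e1])
    (by rwa [e1, e3, e4]) (by rwa [e1, e3, e4])
  rw [e4, e9, e1] at hsearch
  refine .seq (37 * Z ^ 4) (101 * Z ^ 4 * (s ^ k * L ^ k)) _ ?_
    ((hsearch.weaken hdp).mono ?_ fun _ h => h) ?_
  · linarith [Nat.mul_le_mul_left (37 * Z ^ 4) hPos]
  · exact search_steps_le hZc hZP hZD hmZ.le hZ1
  rintro s₂ ⟨h2, hF2, e6, e12⟩
  rw [← hF2.var (k := 3) (by simp)] at e3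
  rw [← hF2.var (k := 4) (by simp)] at e4
  rw [← hF2.var (k := 1) (by simp)] at e1
  have e0 : s₂.var 0 = n := by rw [hF2.var (by simp), hF1.var (by simp), e0]
  have hsizes := wp_sizesProg (S := S) (d := d) (k := k) (L := L) h2 (by rwa [e0])
    (by rw [e0, e1, hk]) (by rw [e12, e3, hL]) (by rwa [e3]) (hZ _ hkZ) (hZ _ hLZ)
    (by rw [e3]; exact hZpow _ hsZ) (hZpow _ hLZ)
  rw [e0, e3] at hsizes
  refine .seq (16 * Z ^ 4) (85 * Z ^ 4 * (s ^ k * L ^ k)) _ ?_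
    ((hsizes.weaken hdp).mono ?_ fun _ h => h) ?_
  · linarith [Nat.mul_le_mul_left (16 * Z ^ 4) hPos]
  · exact sizes_steps_le hkZ (by omega) hZ1
  rintro s₃ ⟨h3, hF3, e18, e19, e20, e21, e22⟩
  rw [← hF3.var (k := 3) (by simp)] at e3
  rw [← hF3.var (k := 4) (by simp)] at e4
  rw [← hF3.var (k := 1) (by simp)] at e1
  rw [← hF3.var (k := 6) (by simp)] at e6
  rw [← hF3.var (k := 0) (by simp)] at e0
  have hsound : Sound d s₃ := ((sound_initial.frame hF1 (by simp)).frame hF2 (by simp)).frame hF3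
    (by simp)
  have hready : Ready B n s₃ := ⟨hnB, e0, e22, by rwa [e4], by rwa [e3], by omega,
    by rw [e4, e18]; exact hZpow _ hZm, by rw [e19, e3]; exact hZ _ hZL⟩
  have hunion : unionAt s₃ = fun y x => blockUnion (2 ^ m) c s L k x y := by
    funext y x
    rw [unionAt, e4, e6, e3, e19, e18]
  have hsteps : unionSteps s₃ = k * (L * s * 3 + 10) + 6 := by rw [unionSteps, e18, e19, e3]
  have hdpp := wp_dpProg (S := S) hn h3 hsound hready
    (fun a h0 hinj => by
      rw [e21, e20, hunion]
      exact hc.exists_follows hm hs0 hL hk h0 hinj)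
    (by
      obtain ⟨a, h1, h2, h3, -⟩ := exists_path_of_perm (d := d) hn 1
      exact ⟨a, h1, h2, h3⟩)
  rw [e20, e21, hsteps] at hdpp
  refine hdpp.mono ?_ ?_
  · exact dp_steps_le (Nat.pow_pos hs0) (Nat.pow_pos hL0) hkZ hZL (by omega) hZ1
  · rintro t ⟨hpath, hle⟩
    refine ⟨exists_perm_of_isPath hn hpath, ?_⟩
    rintro _ ⟨π, rfl⟩
    obtain ⟨a, h1, h2, h3, h4⟩ := exists_path_of_perm (d := d) hn π
    rw [← h4]
    exact hle a h1 h2 h3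

/-- The number of cities that one block handles. -/
noncomputable def blockSize (n : ℕ) : ℕ := sInf {m | n < limitSeq m}

/-- The size of the set systems used on a block of size `m`. -/
noncomputable def listSize (S : ℝ) (m : ℕ) : ℕ := sizeSeq S m * ((m + 1) * (m + 1))

/-- The code of the collection of set systems used on blocks of size `m`. -/
noncomputable def coverCode (S : ℝ) (m : ℕ) : ℕ := sInf {c | IsCoverCode m (listSize S m) (2 ^ m) c}

/-- The number of set systems used on blocks of size `m`. -/
noncomputable def numLists (S : ℝ) (m : ℕ) : ℕ :=
  numDigits (2 ^ m) (coverCode S m) / listSize S m + 1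

/-- A bound for the parameters other than the sizes of the tables. -/
noncomputable def overhead (S : ℝ) (n m : ℕ) : ℕ :=
  2 ^ m + limitSeq m + m ^ m + coverCode S m + numDigits (2 ^ m) (coverCode S m) +
    numLists S m * listSize S m + (n + 1)

lemma lt_limitSeq_blockSize (n : ℕ) : n < limitSeq (blockSize n) :=
  Nat.sInf_mem (s := {m | n < limitSeq m}) ⟨n + 1, limitSeq_mono.le_apply⟩

lemma limitSeq_le_of_lt_blockSize {i : ℕ} (h : i < blockSize n) : limitSeq i ≤ n :=
  not_lt.1 fun hi => Nat.notMem_of_lt_sInf (s := {m | n < limitSeq m}) h hi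

lemma blockSize_pos (hn : 0 < n) : 0 < blockSize n := by
  by_contra! h
  have := lt_limitSeq_blockSize n
  rw [Nat.le_zero.1 h] at this
  simp only [limitSeq] at this
  omega

lemma listSize_pos {m : ℕ} (hS : 1 ≤ S) (hm : 0 < m) : 0 < listSize S m :=
  Nat.mul_pos ((Nat.zero_le _).trans_lt (sizeSeq_mono hS hm)) (by positivity)

lemma exists_isCoverCode_listSize {m : ℕ} (hS : 1 ≤ S) (hm : 0 < m) :
    ∃ c < (2 ^ m) ^ (listSize S m * m ^ m), IsCoverCode m (listSize S m) (2 ^ m) c := by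
  have h : m + 1 ≤ sizeSeq S m * (m + 1) :=
    Nat.le_mul_of_pos_left _ ((Nat.zero_le _).trans_lt (sizeSeq_mono hS hm))
  simpa [listSize, mul_assoc] using exists_isCoverCode_trivial hm h

lemma isCoverCode_coverCode {m : ℕ} (hS : 1 ≤ S) (hm : 0 < m) :
    IsCoverCode m (listSize S m) (2 ^ m) (coverCode S m) :=
  Nat.sInf_mem (s := {c | IsCoverCode m (listSize S m) (2 ^ m) c})
    ((exists_isCoverCode_listSize hS hm).imp fun _ h => h.2)

/-- The time and the space of the program in terms of its parameters. -/
theorem exists_exec_tspProg {m k Z : ℕ} (hS : 1 ≤ S) (hn : 0 < n) (hm : m = blockSize n)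
    (hk : k = n / m + 1) (hZ : Z = overhead S n m) (d : Fin n → Fin n → ℝ) :
    ∃ s' t M, Exec S d tspProg (State.initial n) s' t M ∧
      IsLeast (Set.range (tourLength d)) s'.output ∧
      t ≤ 477 * tspProg.costCoeff * Z ^ 6 * (listSize S m * numLists S m) ^ k ∧
      M ≤ 264 * Z ^ 3 * listSize S m ^ k := by
  have hm0 : 0 < m := hm ▸ blockSize_pos hn
  have hpow := Nat.two_pow_pos m
  obtain ⟨s', N, hR, hN, hQ⟩ := wp_tspProg (d := d) (s := listSize S m) (c := coverCode S m)
    (L := numLists S m) (Z := Z) hS hn hm0 (fun i hi => limitSeq_le_of_lt_blockSize (hm ▸ hi))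
    (hm ▸ lt_limitSeq_blockSize n) rfl (isCoverCode_coverCode hS hm0)
    (fun c' hc' => Nat.notMem_of_lt_sInf hc') rfl hk
    (by rw [hZ, overhead]; omega) (by rw [hZ, overhead]; omega) (by rw [hZ, overhead]; omega)
    (by rw [hZ, overhead]; omega) (by rw [hZ, overhead]; omega) (by rw [hZ, overhead]; omega)
    (by rw [hZ, overhead]; omega)
  have hnZ : n + 1 ≤ Z := by rw [hZ, overhead]; omega
  have hX : 1 ≤ listSize S m ^ k := Nat.pow_pos (listSize_pos hS hm0)
  rw [mul_pow]
  generalize listSize S m ^ k = X at hR hX hN ⊢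
  -- The factor 264 is 44 · 6: the cell count `40 + 2 * R.card` is at most 44 X Z, and each cell is
  -- charged at most 6 Z² for address and content.
  obtain ⟨t, M, hE, ht, hM⟩ := hR.exec (B := Z * Z + Z + n) (M := 264 * Z ^ 3 * X)
    (fun s ⟨R, h, _⟩ => h.bounded (by omega)) fun s ⟨R, h, hc, hA⟩ => by
      have hZ2 : Z ≤ Z * Z := Nat.le_mul_of_pos_left _ (by omega)
      have hZX : Z ≤ X * Z := Nat.le_mul_of_pos_left _ hX
      refine (h.space_le (A := Z * Z + Z + (n + 1)) fun a ha => (hA a ha).trans_le ?_).trans ?_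
      · rw [pow_add _ (Z * Z + Z)]
        exact Nat.mul_le_mul_left _ Nat.lt_two_pow_self.le
      · calc _ ≤ (44 * (X * Z)) * (6 * (Z * Z)) := by
              refine Nat.mul_le_mul ?_ (by omega)
              have : X * n + X ≤ X * Z := by
                rw [← Nat.mul_succ]
                exact Nat.mul_le_mul_left _ hnZ
              omega
          _ = 264 * Z ^ 3 * X := by ring
  refine ⟨s', t, M, hE, hQ, ht.trans ?_, hM⟩
  have hZ2 : Z ≤ Z * Z := Nat.le_mul_of_pos_left _ (by omega)
  calc N * (tspProg.costCoeff * (Z * Z + Z + n))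
      ≤ 159 * Z ^ 4 * (X * numLists S m ^ k) * (tspProg.costCoeff * (3 * (Z * Z))) := by
        gcongr
        omega
    _ = _ := by ring

end TSP

namespace TSP

/-! ## Bounds for the parameters -/

variable {S : ℝ} {n m : ℕ}

lemma pow_le_sizeSeq (hS : 0 ≤ S) (m : ℕ) : S ^ m ≤ sizeSeq S m := by
  induction m with
  | zero => simp [sizeSeq]
  | succ m ih =>
    calc S ^ (m + 1) = S * S ^ m := pow_succ' _ _
      _ ≤ S * sizeSeq S m := by gcongr
      _ ≤ sizeSeq S (m + 1) := by
        rw [sizeSeq]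
        push_cast
        exact (Nat.lt_floor_add_one _).le

/-- Rounding adds at most 1 ≤ S^(m + 1) in each step, so the errors amount to a factor of m + 1
only. -/
lemma sizeSeq_le (hS : 1 ≤ S) (m : ℕ) : (sizeSeq S m : ℝ) ≤ (m + 1) * S ^ m := by
  induction m with
  | zero => simp [sizeSeq]
  | succ m ih =>
    have h1 : (1 : ℝ) ≤ S ^ (m + 1) := one_le_pow₀ hS
    have h2 : (⌊S * sizeSeq S m⌋₊ : ℝ) ≤ S * sizeSeq S m := Nat.floor_le (by positivity)
    have h3 : S * sizeSeq S m ≤ S * ((m + 1) * S ^ m) := by gcongr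
    rw [sizeSeq]
    push_cast
    calc (⌊S * sizeSeq S m⌋₊ : ℝ) + 1 ≤ S * ((m + 1) * S ^ m) + S ^ (m + 1) := by linarith
      _ = (m + 1 + 1) * S ^ (m + 1) := by ring

lemma listSize_le (hS : 1 ≤ S) (m : ℕ) : (listSize S m : ℝ) ≤ (m + 1) ^ 3 * S ^ m := by
  have := sizeSeq_le hS m
  rw [listSize]
  push_cast
  calc (sizeSeq S m : ℝ) * ((m + 1) * (m + 1)) ≤ ((m + 1) * S ^ m) * ((m + 1) * (m + 1)) := by
        gcongr
    _ = (m + 1) ^ 3 * S ^ m := by ring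

/-- The crude bound from one list per ordering. It serves the cost of the search, not the number of
lists. -/
lemma coverCode_lt (hS : 1 ≤ S) (hm : 0 < m) :
    coverCode S m < (2 ^ m) ^ (listSize S m * m ^ m) := by
  obtain ⟨c, hc, h⟩ := exists_isCoverCode_listSize hS hm
  exact (Nat.sInf_le (s := {c | IsCoverCode m (listSize S m) (2 ^ m) c}) h).trans_lt hc

/-- Each term exceeds the square of the previous one; the doubly exponential growth keeps the block
size near log log n. -/
lemma two_pow_two_pow_le_limitSeq (q : ℕ) : 2 ^ 2 ^ q ≤ limitSeq (q + 1) := by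
  induction q with
  | zero => simp [limitSeq]
  | succ q ih =>
    rw [limitSeq, pow_succ 2 q, mul_comm, two_mul, pow_add]
    exact (Nat.mul_le_mul ih ih).trans (Nat.le_succ _)

lemma blockSize_tendsto : Filter.Tendsto blockSize Filter.atTop Filter.atTop := by
  refine Filter.tendsto_atTop.2 fun b => Filter.eventually_atTop.2 ⟨limitSeq b, fun n hn => ?_⟩
  by_contra! h
  exact absurd (lt_limitSeq_blockSize n) (not_lt.2 ((limitSeq_mono.monotone h.le).trans hn))

/-- A bound for the logarithm of the parameters. -/
def overheadExp (m : ℕ) : ℕ := m * ((m + 1) ^ 3 * 2 ^ m * m ^ m)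

lemma coverCode_le (hS : 1 ≤ S) (hS₂ : S ≤ 2) (hm : 0 < m) :
    coverCode S m ≤ 2 ^ overheadExp m := by
  refine (coverCode_lt hS hm).le.trans ?_
  rw [← pow_mul]
  refine Nat.pow_le_pow_right (by norm_num) ?_
  unfold overheadExp
  gcongr
  have h : (listSize S m : ℝ) ≤ (m + 1) ^ 3 * 2 ^ m := (listSize_le hS m).trans (by gcongr)
  exact_mod_cast h

lemma listSize_le_overheadExp (hS : 1 ≤ S) (hS₂ : S ≤ 2) (hm : 0 < m) :
    listSize S m ≤ overheadExp m := by
  have h : (listSize S m : ℝ) ≤ (m + 1) ^ 3 * 2 ^ m := (listSize_le hS m).trans (by gcongr)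
  have h' : listSize S m ≤ (m + 1) ^ 3 * 2 ^ m := by exact_mod_cast h
  exact (h'.trans (Nat.le_mul_of_pos_right _ (by positivity))).trans (Nat.le_mul_of_pos_left _ hm)

/-- The term before the first one that exceeds n is at most n. -/
lemma limitSeq_blockSize_le (hn : 0 < n) : limitSeq (blockSize n) ≤ n * n + 1 := by
  obtain ⟨q, hq⟩ : ∃ q, blockSize n = q + 1 := ⟨blockSize n - 1, by have := blockSize_pos hn; omega⟩
  have := limitSeq_le_of_lt_blockSize (n := n) (i := q) (by omega)
  rw [hq, limitSeq]
  gcongr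

lemma overhead_le (hS : 1 ≤ S) (hS₂ : S ≤ 2) (hn : 0 < n) :
    overhead S n (blockSize n) ≤ 13 * (n ^ 2 * 2 ^ overheadExp (blockSize n)) := by
  have hm := blockSize_pos hn
  have hq := limitSeq_blockSize_le hn
  generalize blockSize n = m at hm hq ⊢
  have h1 := coverCode_le hS hS₂ hm
  have h2 := listSize_le_overheadExp hS hS₂ hm
  have h3 : numDigits (2 ^ m) (coverCode S m) ≤ coverCode S m + 1 :=
    Nat.succ_le_succ (Nat.log_le_self _ _)
  have h4 : numLists S m * listSize S m ≤ numDigits (2 ^ m) (coverCode S m) + listSize S m := by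
    rw [numLists, add_mul, one_mul]
    gcongr
    exact Nat.div_mul_le_self _ _
  have h5 : overheadExp m < 2 ^ overheadExp m := Nat.lt_two_pow_self
  have h6 : 2 ^ m ≤ overheadExp m := by
    calc 2 ^ m ≤ 1 * (1 * 2 ^ m * 1) := by simp
      _ ≤ overheadExp m := by
        unfold overheadExp
        gcongr
        · exact hm
        · exact Nat.one_le_pow _ _ (by omega)
        · exact Nat.one_le_pow _ _ hm
  have h7 : m ^ m ≤ overheadExp m := by
    calc m ^ m ≤ 1 * (1 * 1 * m ^ m) := by simp
      _ ≤ overheadExp m := by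
        unfold overheadExp
        gcongr
        · exact hm
        · exact Nat.one_le_pow _ _ (by omega)
        · exact Nat.one_le_pow _ _ (by omega)
  have h8 : 2 ^ overheadExp m ≤ n ^ 2 * 2 ^ overheadExp m :=
    Nat.le_mul_of_pos_left _ (by positivity)
  have h9 : n ^ 2 ≤ n ^ 2 * 2 ^ overheadExp m := Nat.le_mul_of_pos_right _ (by positivity)
  have h10 : n ≤ n ^ 2 := Nat.le_self_pow (by norm_num) n
  have h11 : n * n = n ^ 2 := (sq n).symm
  have h12 := Nat.two_pow_pos m
  rw [overhead]
  omega

/-- The spare factor `2 ^ m` is what later improves a bound by n to o(n), as m tends to infinity. -/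
lemma overheadExp_mul_le (m : ℕ) : overheadExp m * 2 ^ m ≤ 2 ^ (m * m + 9 * m) := by
  have h1 : m ≤ 2 ^ m := Nat.lt_two_pow_self.le
  have h2 : m + 1 ≤ 2 ^ m := Nat.lt_two_pow_self
  calc overheadExp m * 2 ^ m = m * ((m + 1) ^ 3 * 2 ^ m * m ^ m) * 2 ^ m := rfl
    _ ≤ 2 ^ m * ((2 ^ m) ^ 3 * 2 ^ m * (2 ^ m) ^ m) * 2 ^ m := by gcongr
    _ = 2 ^ (m * m + 6 * m) := by
      rw [← pow_mul, ← pow_mul, ← pow_add, ← pow_add, ← pow_add, ← pow_add]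
      ring_nf
    _ ≤ 2 ^ (m * m + 9 * m) := Nat.pow_le_pow_right (by norm_num) (by omega)

lemma mul_self_add_le_two_pow (q : ℕ) : (q + 12) * (q + 12) + 9 * (q + 12) ≤ 2 ^ (q + 10) := by
  induction q with
  | zero => norm_num
  | succ q ih =>
    rw [show q + 1 + 10 = q + 10 + 1 by ring, pow_succ]
    nlinarith

/-- For block size m the number of cities is at least `limitSeq (m - 1)`, hence at least `2 ^ 2 ^ (m
- 2)`, and from m = 12 on `2 ^ (m - 2)` exceeds the exponent `m * m + 9 * m`. -/
lemma overheadExp_mul_le_of_le (hm : 12 ≤ blockSize n) :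
    overheadExp (blockSize n) * 2 ^ blockSize n ≤ n := by
  obtain ⟨q, hq⟩ : ∃ q, blockSize n = q + 12 := ⟨blockSize n - 12, by omega⟩
  have h := limitSeq_le_of_lt_blockSize (n := n) (i := q + 10 + 1) (by omega)
  refine (overheadExp_mul_le _).trans ((Nat.pow_le_pow_right (by norm_num) ?_).trans
    ((two_pow_two_pow_le_limitSeq _).trans h))
  rw [hq]
  exact mul_self_add_le_two_pow q

lemma overheadExp_isLittleO :
    (fun n => (overheadExp (blockSize n) : ℝ)) =o[Filter.atTop] fun n : ℕ => (n : ℝ) := by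
  refine Asymptotics.isLittleO_iff.2 fun ε hε => ?_
  obtain ⟨M, hM⟩ := exists_nat_gt (1 / ε)
  filter_upwards [blockSize_tendsto.eventually_ge_atTop 12,
    blockSize_tendsto.eventually_ge_atTop M] with n h1 h2
  have h3 : (overheadExp (blockSize n) * 2 ^ blockSize n : ℝ) ≤ n := by
    exact_mod_cast overheadExp_mul_le_of_le h1
  have h4 : 1 / ε ≤ (2 : ℝ) ^ blockSize n := by
    refine hM.le.trans ?_
    exact_mod_cast h2.trans Nat.lt_two_pow_self.le
  rw [Real.norm_of_nonneg (by positivity), Real.norm_of_nonneg (by positivity)]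
  calc (overheadExp (blockSize n) : ℝ) = ε * (overheadExp (blockSize n) * (1 / ε)) := by
        field_simp
    _ ≤ ε * (overheadExp (blockSize n) * 2 ^ blockSize n) := by gcongr
    _ ≤ ε * n := by gcongr

lemma blockSize_isLittleO :
    (fun n => (blockSize n : ℝ)) =o[Filter.atTop] fun n : ℕ => (n : ℝ) := by
  refine Asymptotics.IsBigO.trans_isLittleO ?_ overheadExp_isLittleO
  refine Asymptotics.isBigO_of_le _ fun n => ?_
  rw [Real.norm_of_nonneg (by positivity), Real.norm_of_nonneg (by positivity)]
  norm_cast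
  unfold overheadExp
  rcases Nat.eq_zero_or_pos (blockSize n) with h | h
  · omega
  · exact Nat.le_mul_of_pos_right _ (by positivity)

/-- The logarithm is at most a constant plus 2 log n plus a multiple of `overheadExp`, and each of
these is o(n). -/
lemma log_overhead_isLittleO (hS : 1 ≤ S) (hS₂ : S ≤ 2) :
    (fun n => Real.log (overhead S n (blockSize n))) =o[Filter.atTop] fun n : ℕ => (n : ℝ) := by
  have hlog : (fun n : ℕ => Real.log n) =o[Filter.atTop] fun n : ℕ => (n : ℝ) :=
    Real.isLittleO_log_id_atTop.comp_tendsto tendsto_natCast_atTop_atTop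
  have hconst : (fun _ : ℕ => Real.log 13) =o[Filter.atTop] fun n : ℕ => (n : ℝ) :=
    (Asymptotics.isLittleO_const_id_atTop (Real.log 13)).comp_tendsto tendsto_natCast_atTop_atTop
  have h := (hconst.add (hlog.const_mul_left 2)).add (overheadExp_isLittleO.const_mul_left
    (Real.log 2))
  refine Asymptotics.IsBigO.trans_isLittleO ?_ h
  refine Asymptotics.IsBigO.of_bound 1 ?_
  filter_upwards [Filter.eventually_gt_atTop 0] with n hn
  have h1 : (overhead S n (blockSize n) : ℝ) ≤ 13 * (n ^ 2 * 2 ^ overheadExp (blockSize n)) := by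
    exact_mod_cast overhead_le hS hS₂ hn
  have h2 : (1 : ℝ) ≤ overhead S n (blockSize n) := by
    have : 1 ≤ overhead S n (blockSize n) := by
      have := Nat.two_pow_pos (blockSize n)
      rw [overhead]
      omega
    exact_mod_cast this
  have hn' : (n : ℝ) ≠ 0 := by positivity
  have h3 := Real.log_le_log (by linarith) h1
  rw [Real.log_mul (by norm_num) (by positivity), Real.log_mul (by positivity) (by positivity),
    Real.log_pow, Real.log_pow] at h3
  rw [one_mul, Real.norm_of_nonneg (Real.log_nonneg h2)]
  refine le_trans (h3.trans (le_of_eq ?_)) (Real.le_norm_self _)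
  push_cast
  ring

end TSP

namespace TSP

/-! ## The exponent -/

variable {S η : ℝ} {n m : ℕ}

/-- No set system has more than n! maximal chains. This makes `log (S * P_S)` positive, so that it
can be divided by. -/
lemma one_le_extremalDensity (S : ℝ) : 1 ≤ extremalDensity S := by
  refine le_iInf fun n => le_iInf fun _ => le_iInf fun F => le_iInf fun _ => ?_
  rw [← ENNReal.one_rpow (1 / (n : ℝ))]
  refine ENNReal.rpow_le_rpow ?_ (by positivity)
  rcases Nat.eq_zero_or_pos (numMaximalChains F) with h | h
  · rw [h, Nat.cast_zero, ENNReal.div_zero (by exact_mod_cast n.factorial_ne_zero)]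
    exact le_top
  · rw [ENNReal.le_div_iff_mul_le (.inl (by exact_mod_cast h.ne')) (.inl (by simp)), one_mul]
    exact_mod_cast numMaximalChains_le_factorial F

lemma exists_setSystem (hη : 0 ≤ η) (h : extremalDensity S < ENNReal.ofReal η) :
    ∃ (n : ℕ) (F : SetSystem n), 0 < n ∧ (F.card : ℝ) ≤ S ^ n ∧
      (n ! : ℝ) ≤ numMaximalChains F * η ^ n := by
  simp only [extremalDensity, iInf_lt_iff] at h
  obtain ⟨n, hn, F, hF, h⟩ := h
  refine ⟨n, F, hn, ?_, ?_⟩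
  · calc (F.card : ℝ) = normSize F ^ n := by
          rw [normSize, one_div, Real.rpow_inv_natCast_pow (by positivity) hn.ne']
      _ ≤ S ^ n := pow_le_pow_left₀ (by unfold normSize; positivity) hF n
  · have h1 : (n ! : ℝ≥0∞) / numMaximalChains F ≤ ENNReal.ofReal η ^ n := by
      have := pow_le_pow_left' h.le n
      rwa [invChainDensity, one_div, ← ENNReal.rpow_natCast, ← ENNReal.rpow_mul,
        inv_mul_cancel₀ (by positivity), ENNReal.rpow_one] at this
    have h2 : numMaximalChains F ≠ 0 := by
      intro h0
      rw [h0, Nat.cast_zero, ENNReal.div_zero (by exact_mod_cast n.factorial_ne_zero),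
        top_le_iff] at h1
      exact ENNReal.pow_ne_top ENNReal.ofReal_ne_top h1
    rw [ENNReal.div_le_iff' (by exact_mod_cast h2) (by simp), ← ENNReal.ofReal_pow hη,
      ← ENNReal.ofReal_natCast, ← ENNReal.ofReal_natCast, ← ENNReal.ofReal_mul (by positivity),
      ENNReal.ofReal_le_ofReal_iff (by positivity)] at h1
    exact h1

/-- The probability that N independent trials fail is (1 - a / A)^N ≤ exp(-N a / A) ≤ exp(-m²),
since a / A ≥ 1 / x. The factor `m * m` in N beats the m^m orderings, because m < exp m. -/
lemma pow_mul_sub_pow_lt {A a : ℕ} {x : ℝ} (ha : a ≤ A) (hA : 0 < A)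
    (h : (A : ℝ) ≤ a * x) (hm : 0 < m) :
    m ^ m * (A - a) ^ (⌈x⌉₊ * (m * m)) < A ^ (⌈x⌉₊ * (m * m)) := by
  have hA' : (0 : ℝ) < A := by exact_mod_cast hA
  have hx' : x ≤ ⌈x⌉₊ := Nat.le_ceil x
  set N := ⌈x⌉₊ * (m * m) with hN
  have h1 : (A : ℝ) - a ≤ A * Real.exp (-(a / A)) := by
    have := Real.add_one_le_exp (-((a : ℝ) / A))
    calc (A : ℝ) - a = A * (-(a / A) + 1) := by field_simp; ring
      _ ≤ _ := by gcongr
  have h2 : (m * m : ℝ) ≤ a / A * N := by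
    have h4 : (1 : ℝ) ≤ a / A * ⌈x⌉₊ := by
      rw [div_mul_eq_mul_div, one_le_div hA']
      exact h.trans (by gcongr)
    calc (m * m : ℝ) = 1 * (m * m) := by ring
      _ ≤ a / A * ⌈x⌉₊ * (m * m) := by gcongr
      _ = a / A * N := by rw [hN]; push_cast; ring
  have h3 : (m : ℝ) ^ m < Real.exp (m * m) := by
    rw [Real.exp_mul, Real.rpow_natCast]
    exact pow_lt_pow_left₀ ((lt_add_one _).trans_le (Real.add_one_le_exp _)) (by positivity) hm.ne'
  have h0 : (0 : ℝ) ≤ (A : ℝ) - a := sub_nonneg.2 (by exact_mod_cast ha)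
  have : (m : ℝ) ^ m * ((A : ℝ) - a) ^ N < (A : ℝ) ^ N := by
    calc (m : ℝ) ^ m * ((A : ℝ) - a) ^ N ≤ (m : ℝ) ^ m * (A * Real.exp (-(a / A))) ^ N := by
          gcongr
      _ = (m : ℝ) ^ m * Real.exp (-(a / A * N)) * A ^ N := by
          rw [mul_pow, ← Real.exp_nat_mul]
          ring_nf
      _ ≤ (m : ℝ) ^ m * Real.exp (-(m * m)) * A ^ N := by gcongr
      _ < Real.exp (m * m) * Real.exp (-(m * m)) * A ^ N := by gcongr
      _ = A ^ N := by rw [← Real.exp_add]; simp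
  rw [← Nat.cast_sub ha] at this
  exact_mod_cast this

/-- The least code is also short: below `(2 ^ m) ^ (s * N)`, for lists of length s, it has at most
`s * N` digits, hence at most N full groups. The `+ 1` is the rounding in `numLists`. -/
lemma numLists_le {N : ℕ} (hN : 0 < N)
    (h : ∃ c < (2 ^ m) ^ (listSize S m * N), IsCoverCode m (listSize S m) (2 ^ m) c) :
    numLists S m ≤ N + 1 := by
  obtain ⟨c, hc, h⟩ := h
  have h1 : coverCode S m < (2 ^ m) ^ (listSize S m * N) :=
    (Nat.sInf_le (s := {c | IsCoverCode m (listSize S m) (2 ^ m) c}) h).trans_lt hc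
  rw [numLists]
  refine Nat.succ_le_succ ?_
  rcases Nat.eq_zero_or_pos (listSize S m) with h0 | h0
  · simp [h0]
  refine Nat.div_le_of_le_mul (Nat.succ_le_of_lt ?_)
  exact Nat.log_lt_of_lt_pow' (by positivity) h1

/-- A set system bounds the number of set systems that the program uses. -/
lemma numLists_le_of_setSystem {n₀ : ℕ} (F : SetSystem n₀) (hn₀ : 0 < n₀) (hS : 1 ≤ S) (hη : 1 ≤ η)
    (hF : (F.card : ℝ) ≤ S ^ n₀) (hC : (n₀ ! : ℝ) ≤ numMaximalChains F * η ^ n₀) (hm : 0 < m)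
    (hm' : S ^ n₀ ≤ m + 1) : (numLists S m : ℝ) ≤ 3 * m ^ 2 * η ^ (m + n₀) := by
  -- The copies overshoot the block by at most n₀ points. This costs a factor S^n₀ in the size,
  -- absorbed through `hm'` by one factor m + 1 of `listSize`; the other such factor pays for the m
  -- + 1 repetitions.
  set k := m / n₀ + 1 with hk
  have h1 : m ≤ n₀ * k := by
    have := Nat.div_add_mod m n₀
    have := Nat.mod_lt m hn₀
    rw [hk, mul_add]
    omega
  have h2 : n₀ * k ≤ m + n₀ := by
    rw [hk, mul_add, mul_one]
    gcongr
    exact Nat.mul_div_le m n₀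
  have hx : 1 ≤ η ^ (m + n₀) := one_le_pow₀ hη
  set N := ⌈η ^ (m + n₀)⌉₊ * (m * m) with hN
  have hN0 : 0 < N := Nat.mul_pos (Nat.ceil_pos.2 (by linarith)) (Nat.mul_pos hm hm)
  obtain ⟨G, hG, hcover⟩ := exists_lists (k := k) (N := N) F hn₀ h1 (by
    refine pow_mul_sub_pow_lt (Nat.pow_le_pow_left (numMaximalChains_le_factorial F) k)
      (Nat.pow_pos n₀.factorial_pos) ?_ hm
    push_cast
    calc (n₀ ! : ℝ) ^ k ≤ (numMaximalChains F * η ^ n₀) ^ k := by gcongr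
      _ = numMaximalChains F ^ k * η ^ (n₀ * k) := by rw [mul_pow, pow_mul]
      _ ≤ numMaximalChains F ^ k * η ^ (m + n₀) := by gcongr)
  have h3 : F.card ^ k ≤ sizeSeq S m * (m + 1) := by
    have : (F.card : ℝ) ^ k ≤ sizeSeq S m * (m + 1) := by
      calc (F.card : ℝ) ^ k ≤ (S ^ n₀) ^ k := by gcongr
        _ = S ^ (n₀ * k) := by rw [pow_mul]
        _ ≤ S ^ (m + n₀) := pow_le_pow_right₀ hS h2
        _ = S ^ m * S ^ n₀ := pow_add _ _ _
        _ ≤ sizeSeq S m * (m + 1) := by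
          gcongr
          exact pow_le_sizeSeq (by linarith) m
    exact_mod_cast this
  obtain ⟨c, hc, hcode⟩ := exists_isCoverCode hm G (fun l => (hG l).trans h3) hcover
  have h4 : sizeSeq S m * (m + 1) * (m + 1) = listSize S m := by rw [listSize, mul_assoc]
  rw [h4] at hc hcode
  have h5 : (numLists S m : ℝ) ≤ N + 1 := by exact_mod_cast numLists_le hN0 ⟨c, hc, hcode⟩
  have h6 : (⌈η ^ (m + n₀)⌉₊ : ℝ) ≤ η ^ (m + n₀) + 1 := (Nat.ceil_lt_add_one (by linarith)).le
  have hm1 : (1 : ℝ) ≤ m := by exact_mod_cast hm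
  calc (numLists S m : ℝ) ≤ ⌈η ^ (m + n₀)⌉₊ * (m * m) + 1 * 1 := by
        rw [hN] at h5; push_cast at h5; linarith
    _ ≤ (η ^ (m + n₀) + η ^ (m + n₀)) * (m * m) + η ^ (m + n₀) * (m * m) := by
        gcongr
        · linarith
        · nlinarith
    _ = 3 * m ^ 2 * η ^ (m + n₀) := by ring

lemma log_listSize_le (hS : 1 ≤ S) (hm : 0 < m) :
    Real.log (listSize S m) ≤ m * Real.log S + 3 * Real.log (m + 1) := by
  have h := Real.log_le_log (by exact_mod_cast listSize_pos hS hm) (listSize_le hS m)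
  rw [Real.log_mul (by positivity) (by positivity), Real.log_pow, Real.log_pow] at h
  push_cast at h
  linarith

lemma log_add_one_isLittleO (C : ℝ) {ε : ℝ} (hε : 0 < ε) (K : ℝ) :
    ∀ᶠ m : ℕ in Filter.atTop, C + K * Real.log (m + 1) ≤ ε * m := by
  have h1 : (fun m : ℕ => Real.log ((m + 1 : ℕ) : ℝ)) =o[Filter.atTop] fun m : ℕ => (m : ℝ) := by
    have h2 : (fun m : ℕ => Real.log ((m + 1 : ℕ) : ℝ)) =o[Filter.atTop]
        fun m : ℕ => ((m + 1 : ℕ) : ℝ) :=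
      (Real.isLittleO_log_id_atTop.comp_tendsto tendsto_natCast_atTop_atTop).comp_tendsto
        (Filter.tendsto_add_atTop_nat 1)
    refine h2.trans_isBigO (Asymptotics.IsBigO.of_bound 2 ?_)
    filter_upwards [Filter.eventually_ge_atTop 1] with m hm
    have hm' : (1 : ℝ) ≤ m := by exact_mod_cast hm
    rw [Real.norm_of_nonneg (by positivity), Real.norm_of_nonneg (by positivity)]
    push_cast
    linarith
  have h3 : (fun _ : ℕ => C) =o[Filter.atTop] fun n : ℕ => (n : ℝ) :=
    (Asymptotics.isLittleO_const_id_atTop C).comp_tendsto tendsto_natCast_atTop_atTop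
  filter_upwards [(h3.add (h1.const_mul_left K)).bound hε] with m hm
  rw [Real.norm_of_nonneg (r := (m : ℝ)) (by positivity)] at hm
  push_cast at hm
  exact (Real.le_norm_self _).trans hm

lemma eventually_log_listSize_le (hS : 1 ≤ S) {ε : ℝ} (hε : 0 < ε) :
    ∀ᶠ m : ℕ in Filter.atTop, Real.log (listSize S m) ≤ m * (Real.log S + ε) := by
  filter_upwards [log_add_one_isLittleO 0 hε 3, Filter.eventually_gt_atTop 0] with m h hm
  have := log_listSize_le hS hm
  linarith

lemma numLists_pos (S : ℝ) (m : ℕ) : 0 < numLists S m := Nat.succ_pos _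

lemma eventually_log_mul_le (hS : 1 ≤ S) {p ε : ℝ} (hε : 0 < ε) (hp : 1 ≤ p)
    (h : extremalDensity S = ENNReal.ofReal p) :
    ∀ᶠ m : ℕ in Filter.atTop, Real.log (listSize S m * numLists S m : ℕ) ≤
      m * (Real.log (S * p) + ε) := by
  -- Half of ε buys one fixed set system near the infimum. The other half absorbs the polynomial
  -- factors in m and the overshoot of n₀ points.
  have hη : p < p * Real.exp (ε / 2) :=
    lt_mul_of_one_lt_right (by linarith) (Real.one_lt_exp_iff.2 (by linarith))
  set η := p * Real.exp (ε / 2) with hηdef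
  have hlog : Real.log η = Real.log p + ε / 2 := by
    rw [hηdef, Real.log_mul (by positivity) (by positivity), Real.log_exp]
  obtain ⟨n₀, F, hn₀, hF, hC⟩ := exists_setSystem (S := S) (η := η) (by linarith) (by
    rw [h]
    exact (ENNReal.ofReal_lt_ofReal_iff (by linarith)).2 hη)
  obtain ⟨M, hM⟩ := exists_nat_ge (S ^ n₀)
  filter_upwards [log_add_one_isLittleO (Real.log 3 + n₀ * Real.log η) (half_pos hε) 5,
    Filter.eventually_gt_atTop 0, Filter.eventually_ge_atTop M] with m h1 hm hmM
  have h2 := log_listSize_le hS hm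
  have hm0 : (0 : ℝ) < m := by exact_mod_cast hm
  have hη0 : 0 < η := by linarith
  have h3 := Real.log_le_log (by exact_mod_cast numLists_pos S m)
    (numLists_le_of_setSystem F hn₀ hS (by linarith) hF hC hm (hM.trans (by
      have : (M : ℝ) ≤ m := by exact_mod_cast hmM
      linarith)))
  rw [Real.log_mul (by positivity) (by positivity), Real.log_mul (by positivity) (by positivity),
    Real.log_pow, Real.log_pow] at h3
  have h4 : Real.log m ≤ Real.log (m + 1) := Real.log_le_log hm0 (by linarith)
  have h5 : (0 : ℝ) < listSize S m := by exact_mod_cast listSize_pos hS hm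
  have h6 : (0 : ℝ) < numLists S m := by exact_mod_cast numLists_pos S m
  rw [Nat.cast_mul, Real.log_mul h5.ne' h6.ne', Real.log_mul (by positivity) (by positivity)]
  push_cast at h3
  nlinarith

/-! ## The resource bounds -/

lemma exists_isLittleO_le {u : ℕ → ℝ} {l : ℝ} (hl : 0 < l)
    (hu : ∀ ε > 0, ∀ᶠ n : ℕ in Filter.atTop, u n ≤ n * (l + ε)) :
    ∃ f : ℕ → ℝ, f =o[Filter.atTop] (fun n : ℕ => (n : ℝ)) ∧ ∀ n, u n ≤ l * (n + f n) := by
  -- The excess of `u n / l` over n. Truncation at 0 makes a lower bound on `u` unnecessary.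
  refine ⟨fun n => max 0 (u n / l - n), Asymptotics.isLittleO_iff.2 fun ε hε => ?_, fun n => ?_⟩
  · filter_upwards [hu (l * ε) (by positivity)] with n hn
    rw [Real.norm_of_nonneg (le_max_left _ _), Real.norm_of_nonneg (by positivity)]
    refine max_le (by positivity) ?_
    rw [sub_le_iff_le_add, div_le_iff₀ hl]
    linarith
  · have := le_max_right 0 (u n / l - n)
    calc u n = l * (n + (u n / l - n)) := by field_simp; ring
      _ ≤ _ := by gcongr

/-- A product of a subexponential factor and a power over the blocks. -/
lemma eventually_log_mul_pow_le {l K : ℝ} {e : ℕ} {Z V : ℕ → ℕ} (hl : 0 ≤ l) (hK : 0 < K)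
    (hZ : ∀ n, 0 < Z n) (hV : ∀ m, 0 < m → 0 < V m)
    (hZlog : (fun n => Real.log (Z n)) =o[Filter.atTop] fun n : ℕ => (n : ℝ))
    (h : ∀ ε > 0, ∀ᶠ m : ℕ in Filter.atTop, Real.log (V m) ≤ m * (l + ε)) {ε : ℝ} (hε : 0 < ε) :
    ∀ᶠ n : ℕ in Filter.atTop,
      Real.log (K * Z n ^ e * V (blockSize n) ^ (n / blockSize n + 1)) ≤ n * (l + ε) := by
  have hconst : (fun _ : ℕ => Real.log K) =o[Filter.atTop] fun n : ℕ => (n : ℝ) :=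
    (Asymptotics.isLittleO_const_id_atTop (Real.log K)).comp_tendsto tendsto_natCast_atTop_atTop
  have hsum := (hconst.add (hZlog.const_mul_left e)).add
    (blockSize_isLittleO.const_mul_left (l + ε / 2))
  filter_upwards [blockSize_tendsto.eventually (h (ε / 2) (by positivity)),
    hsum.bound (half_pos hε), Filter.eventually_gt_atTop 0] with n h1 h2 hn
  have hm := blockSize_pos hn
  have hm0 : (0 : ℝ) < blockSize n := by exact_mod_cast hm
  have hZ0 : (0 : ℝ) < Z n := by exact_mod_cast hZ n
  have hV0 : (0 : ℝ) < V (blockSize n) := by exact_mod_cast hV _ hm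
  rw [Real.norm_of_nonneg (r := (n : ℝ)) (by positivity)] at h2
  replace h2 := (Real.le_norm_self _).trans h2
  rw [Real.log_mul (by positivity) (by positivity), Real.log_mul (by positivity) (by positivity),
    Real.log_pow, Real.log_pow]
  -- The blocks exceed n by at most one block size, which is o(n).
  have h3 : (((n / blockSize n + 1 : ℕ) : ℝ)) * blockSize n ≤ n + blockSize n := by
    have := Nat.div_mul_le_self n (blockSize n)
    have h4 : (n / blockSize n + 1) * blockSize n ≤ n + blockSize n := by
      rw [add_mul, one_mul]
      omega
    exact_mod_cast h4
  have h5 : ((n / blockSize n + 1 : ℕ) : ℝ) * Real.log (V (blockSize n)) ≤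
      (n + blockSize n) * (l + ε / 2) := by
    calc ((n / blockSize n + 1 : ℕ) : ℝ) * Real.log (V (blockSize n)) ≤
          ((n / blockSize n + 1 : ℕ) : ℝ) * (blockSize n * (l + ε / 2)) := by gcongr
      _ = ((n / blockSize n + 1 : ℕ) : ℝ) * blockSize n * (l + ε / 2) := by ring
      _ ≤ _ := by gcongr
  linarith

lemma natCast_le_ofReal_rpow {t : ℕ} {b x y : ℝ} (hb : 0 < b) (hx : 0 < x) (ht : (t : ℝ) ≤ x)
    (h : Real.log x ≤ Real.log b * y) : (t : ℝ≥0∞) ≤ ENNReal.ofReal b ^ y := by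
  rw [ENNReal.ofReal_rpow_of_pos hb, ← ENNReal.ofReal_natCast]
  refine ENNReal.ofReal_le_ofReal (ht.trans ?_)
  rw [Real.rpow_def_of_pos hb]
  exact (Real.log_le_iff_le_exp hx).1 h

lemma Program.costCoeff_pos (p : Program) : 0 < p.costCoeff := by
  induction p <;> simp only [Program.costCoeff] <;> omega

lemma overhead_pos (S : ℝ) (n m : ℕ) : 0 < overhead S n m := by
  have := Nat.two_pow_pos m
  rw [overhead]
  omega

end TSP

theorem mainTheorem3 (S : ℝ) (hS₁ : 1 < S) (hS₂ : S ≤ 2) :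
    ∃ (p : TSP.Program) (f g : ℕ → ℝ),
      f =o[Filter.atTop] (fun n : ℕ => (n : ℝ)) ∧
      g =o[Filter.atTop] (fun n : ℕ => (n : ℝ)) ∧
      TSP.SolvesTSP S p
        (fun n => (ENNReal.ofReal S * TSP.extremalDensity S) ^ ((n : ℝ) + f n))
        (fun n => ENNReal.ofReal S ^ ((n : ℝ) + g n)) := by
  open TSP in
  have hS : 1 ≤ S := hS₁.le
  have hS0 : 0 < S := by linarith
  have hZ : ∀ n, 0 < overhead S n (blockSize n) := fun n => overhead_pos S n _
  have hs : ∀ m, 0 < m → 0 < listSize S m := fun m hm => listSize_pos hS hm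
  have hsL : ∀ m, 0 < m → 0 < listSize S m * numLists S m := fun m hm =>
    Nat.mul_pos (hs m hm) (numLists_pos S m)
  have hlogZ := log_overhead_isLittleO hS hS₂
  obtain ⟨g, hg, hgle⟩ := exists_isLittleO_le (Real.log_pos hS₁) fun ε hε =>
    eventually_log_mul_pow_le (K := 264) (e := 3) (Real.log_nonneg hS) (by norm_num) hZ hs hlogZ
      (fun ε hε => eventually_log_listSize_le hS hε) hε
  have hspace : ∀ n : ℕ, 0 < n → ∀ M : ℕ, M ≤ 264 * overhead S n (blockSize n) ^ 3 *
      listSize S (blockSize n) ^ (n / blockSize n + 1) →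
      (M : ℝ≥0∞) ≤ ENNReal.ofReal S ^ ((n : ℝ) + g n) := fun n hn M hM => by
    have h1 : (0 : ℝ) < overhead S n (blockSize n) := by exact_mod_cast hZ n
    have h2 : (0 : ℝ) < listSize S (blockSize n) := by exact_mod_cast hs _ (blockSize_pos hn)
    exact natCast_le_ofReal_rpow hS0 (by positivity) (by exact_mod_cast hM) (hgle n)
  rcases eq_or_ne (extremalDensity S) ⊤ with htop | htop
  -- For infinite density the time bound is infinite, since S and the exponent are positive; only
  -- the space needs an estimate.
  · refine ⟨tspProg, 0, g, Asymptotics.isLittleO_zero _ _, hg, fun n hn d => ?_⟩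
    obtain ⟨s', t, M, hE, hleast, -, hM⟩ := exists_exec_tspProg hS hn rfl rfl rfl d
    refine ⟨s', t, M, hE, hleast, ?_, hspace n hn M hM⟩
    dsimp only
    rw [htop, ENNReal.mul_top (by simpa using hS0), ENNReal.top_rpow_of_pos (by simpa using hn)]
    exact le_top
  obtain ⟨p, hp0, hp⟩ : ∃ p : ℝ, 0 ≤ p ∧ extremalDensity S = ENNReal.ofReal p :=
    ⟨_, ENNReal.toReal_nonneg, (ENNReal.ofReal_toReal htop).symm⟩
  have hp1 : 1 ≤ p := by
    have := one_le_extremalDensity S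
    rwa [hp, ENNReal.one_le_ofReal] at this
  have hSp : 1 < S * p := by nlinarith
  have hcoef : 0 < 477 * tspProg.costCoeff := by
    have := tspProg.costCoeff_pos
    omega
  obtain ⟨f, hf, hfle⟩ := exists_isLittleO_le (Real.log_pos hSp) fun ε hε =>
    eventually_log_mul_pow_le (K := (477 * tspProg.costCoeff : ℕ)) (e := 6) (Real.log_nonneg hSp.le)
      (by exact_mod_cast hcoef) hZ hsL hlogZ
      (fun ε hε => eventually_log_mul_le hS hε hp1 hp) hε
  refine ⟨tspProg, f, g, hf, hg, fun n hn d => ?_⟩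
  obtain ⟨s', t, M, hE, hleast, ht, hM⟩ := exists_exec_tspProg hS hn rfl rfl rfl d
  refine ⟨s', t, M, hE, hleast, ?_, hspace n hn M hM⟩
  dsimp only
  rw [hp, ← ENNReal.ofReal_mul hS0.le]
  have h1 : (0 : ℝ) < overhead S n (blockSize n) := by exact_mod_cast hZ n
  have h2 : (0 : ℝ) < (listSize S (blockSize n) * numLists S (blockSize n) : ℕ) := by
    exact_mod_cast hsL _ (blockSize_pos hn)
  have h3 : (0 : ℝ) < (477 * tspProg.costCoeff : ℕ) := by exact_mod_cast hcoef
  exact natCast_le_ofReal_rpow (by linarith) (by positivity) (by exact_mod_cast ht) (hfle n)
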